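/- **Setting.** A function $p:\{-1,1\}^n\to\mathbb R$ is identified with its multilinear expansion $p(x)=\sum_{S\subseteq[n]}\widehat p(S)\prod_{j\in S}x_j$; put $\|p\|_1=\sum_S|\widehat p(S)|$ and $\|p\|_\infty=\max_S|\widehat p(S)|$. A Hamiltonian $\psi$ defines a $(k,d,\lambda)$-Markov random field $\mu_\psi(x)\propto e^{\psi(x)}$ if $\deg\psi\le k$ and, for every $i$, the neighborhood $\mathcal N(i)$ (the set of variables occurring in $\partial_i\psi$) has at most $d$ elements and $\|\partial_i\psi\|_1\le\lambda$. The discrete-time Glauber dynamics $(X^t)_{t\ge0}$ starts at an arbitrary (possibly random) configuration; at each time $t\ge1$ a uniformly random site $i_t$ is chosen and $X^t$ is obtained from $X^{t-1}$ by resampling this coordinate, which becomes $+1$ with probability $\sigma(2\,\partial_{i_t}\psi(X^{t-1}))$, where $\sigma(z)=1/(1+e^{-z})$. For a node $i$ let $\tau_0=0$ and $\tau_{m+1}=\inf\{t\ge\tau_m+4\log(d)\,n:\ i_t=i\}$. The $T$ samples for node $i$ are $X^{\tau_1},\dots,X^{\tau_T}$. Let $P_i$ be the set of polynomials in the variables $\mathcal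 N(i)$ of degree at most $k$ with $\|p\|_1\le\lambda$. Logistic regression for node $i$ outputs a minimizer $\widehat p_i$ over $p\in P_i$ of the empirical loss $$L_i(p)=\frac1T\sum_{m=1}^T\log\bigl(1+\exp(-2X_i^{\tau_m}\,p(X^{\tau_m}))\bigr).$$ **Theorem.** For every $\lambda_0>0$ there is a constant $C>0$, depending only on $\lambda_0$, such that the following holds for all $n\ge1$, $d\ge3$, $k\ge1$, $\lambda\ge\lambda_0$, $\varepsilon>0$, $\delta\in(0,1)$ and every $(k,d,\lambda)$-Markov random field on $\{-1,1\}^n$ with Hamiltonian $\psi$. Put $$A(\delta)=\frac{\lambda^2\,k\,\log(d/\delta)\,d^{C\lambda k^2}}{\varepsilon^4},\qquad T_0(\delta)=C\,A(\delta)\,\bigl(\log(3+A(\delta))\bigr)^C .$$ 1. If $T\ge T_0(\delta)$, then for each node $i$, with probability at least $1-\delta$, minimizers $\widehat p_i$ exist and every one of them satisfies $\|\widehat p_i-\partial_i\psi\|_\infty\le\varepsilon$. 2. If $T\ge T_0(\delta/n)$, then with probability at least $1-\delta$ minimizers exist for all nodes, and whatever minimizers $\widehat p_1,\dots,\widehat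 p_n$ are chosen, the polynomial $\widehat\psi$ with coefficients $\widehat\psi(\emptyset)=0$ and $\widehat\psi(S)=\widehat p_{\min S}(S\setminus\{\min S\})$ for $S\ne\emptyset$ satisfies $\|\widehat\psi-(\psi-c)\|_\infty\le\varepsilon$, where $c$ is the constant coefficient of $\psi$ (which does not affect $\mu_\psi$). 3. (Efficiency.) Let $T\ge T_0(\delta/n)$, and let the neighborhoods be known: sets $N_1,\dots,N_n\subseteq[n]$ with $|N_i|\le d$ are given. Then there are maps sending every possible array of $T$ configurations for node $i$ to a polynomial $q_i$ in the variables $N_i$, of degree at most $k$, with $\|q_i\|_1\le\lambda$, whose empirical loss for node $i$ is within $\varepsilon$ of the minimum over such polynomials; all coefficients of the polynomial $\tilde\psi$ assembled from $q_1,\dots,q_n$ as in part 2 are computed, from the spins of $i$ and of $N_i$ in the samples of each node $i$, by one straight-line program over $\mathbb R$ with instructions constant, $+,-,\times,/,\exp$ and with at most $$n\cdot C\,d^{C\lambda k^2}\bigl(T(1+1/\varepsilon)\bigr)^C$$ instructions; and for every $(k,d,\lambda)$-Markov random field with neighborhoods $\mathcal N(i)=N_i$, with probability at least $1-\delta$,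 $\|\tilde\psi-(\psi-c)\|_\infty\le\varepsilon$. -/

import Mathlib

namespace GlauberMRF

noncomputable section

/-! ### Multilinear polynomials on the hypercube -/

/-- A configuration in `{-1,1}^n`. -/
abbrev Config (n : ℕ) : Type := Fin n → ℤˣ

/-- The value `x_j ∈ {-1,1}` as a real number. -/
def spin {n : ℕ} (x : Config n) (j : Fin n) : ℝ := ((x j : ℤ) : ℝ)

/-- A multilinear polynomial in `x_1, …, x_n`, represented by its coefficients: `p S` is the
coefficient of the monomial `∏ j ∈ S, x_j`. Every function `{-1,1}^n → ℝ` has exactly one such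
representation. -/
abbrev MPoly (n : ℕ) : Type := Finset (Fin n) → ℝ

/-- The value of a multilinear polynomial at a configuration. -/
def MPoly.eval {n : ℕ} (p : MPoly n) (x : Config n) : ℝ :=
  ∑ S : Finset (Fin n), p S * ∏ j ∈ S, spin x j

/-- `p` has degree at most `k`. -/
def MPoly.DegreeLE {n : ℕ} (p : MPoly n) (k : ℕ) : Prop :=
  ∀ S, p S ≠ 0 → S.card ≤ k

/-- The partial derivative `∂_i p`. -/
def MPoly.pderiv {n : ℕ} (i : Fin n) (p : MPoly n) : MPoly n :=
  fun S => if i ∈ S then 0 else p (insert i S)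

/-- The Fourier `1`-norm: the sum of the absolute values of the coefficients. -/
def MPoly.l1Norm {n : ℕ} (p : MPoly n) : ℝ := ∑ S : Finset (Fin n), |p S|

/-- The Fourier `∞`-norm: the maximum of the absolute values of the coefficients. -/
def MPoly.supNorm {n : ℕ} (p : MPoly n) : ℝ :=
  Finset.univ.sup' Finset.univ_nonempty (fun S : Finset (Fin n) => |p S|)

/-- The polynomial with its constant coefficient removed. -/
def MPoly.dropConst {n : ℕ} (p : MPoly n) : MPoly n := Function.update p ∅ 0

open Classical in
/-- The neighborhood `N(i)`: the variables that occur in `∂_i ψ`. -/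
def neighbors {n : ℕ} (ψ : MPoly n) (i : Fin n) : Finset (Fin n) :=
  Finset.univ.filter fun j => ∃ S, j ∈ S ∧ ψ.pderiv i S ≠ 0

/-- `ψ` is the Hamiltonian of a `(k,d,lam)`-Markov random field `μ(x) ∝ exp (ψ x)`: order at most
`k`, at most `d` neighbors of every site, and width at most `lam`. -/
structure IsMRF {n : ℕ} (k d : ℕ) (lam : ℝ) (ψ : MPoly n) : Prop where
  degree : ψ.DegreeLE k
  card_neighbors : ∀ i, (neighbors ψ i).card ≤ d
  width : ∀ i, (ψ.pderiv i).l1Norm ≤ lam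

/-! ### Discrete-time Glauber dynamics -/

/-- The sigmoid function. -/
def sigm (z : ℝ) : ℝ := 1 / (1 + Real.exp (-z))

/-- The probability that site `i`, when it is updated in the configuration `x`, receives the
spin `e`. It does not depend on `x i`. -/
def updateProb {n : ℕ} (ψ : MPoly n) (x : Config n) (i : Fin n) (e : ℤˣ) : ℝ :=
  if e = 1 then sigm (2 * (ψ.pderiv i).eval x) else 1 - sigm (2 * (ψ.pderiv i).eval x)

open Classical in
/-- The one-step transition probability from the configuration `x`: choose the site `i` uniformly
at random, resample its spin, and arrive at the configuration `y`. -/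
def stepProb {n : ℕ} (ψ : MPoly n) (x : Config n) (i : Fin n) (y : Config n) : ℝ :=
  if ∀ j, j ≠ i → y j = x j then (1 / (n : ℝ)) * updateProb ψ x i (y i) else 0

/-- The event that up to time `t` the configurations are `x 0, …, x t` and the updated sites are
`u 1, …, u t`. -/
def history {Ω : Type*} {n : ℕ} (X : ℕ → Ω → Config n) (U : ℕ → Ω → Fin n) (t : ℕ)
    (x : ℕ → Config n) (u : ℕ → Fin n) : Set Ω :=
  {ω | (∀ s, s ≤ t → X s ω = x s) ∧ ∀ s, 1 ≤ s → s ≤ t → U s ω = u s}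

/-- `X 0, X 1, …` with updated sites `U 1, U 2, …` is a trajectory of the discrete-time Glauber
dynamics for `ψ`, with an arbitrary (possibly random) initial configuration: given any history up to
time `t`, the next site and the next configuration have the law `stepProb ψ (X t)`.
The variable `U 0` plays no role. -/
structure IsGlauber {Ω : Type*} [MeasurableSpace Ω] {n : ℕ} (ψ : MPoly n)
    (P : MeasureTheory.Measure Ω) (X : ℕ → Ω → Config n) (U : ℕ → Ω → Fin n) : Prop where
  measurable_config : ∀ t x, MeasurableSet {ω | X t ω = x}
  measurable_site : ∀ t i, MeasurableSet {ω | U t ω = i}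
  step : ∀ (t : ℕ) (x : ℕ → Config n) (u : ℕ → Fin n),
    P (history X U (t + 1) x u) =
      P (history X U t x u) * ENNReal.ofReal (stepProb ψ (x t) (u (t + 1)) (x (t + 1)))

/-- For a sequence `u` of updated sites: `τ_0 = 0`, and `τ_{m+1}` is the first time
`t ≥ τ_m + 4 log(d) n` at which site `i` is updated (`0` if there is none, which has
probability zero). -/
def tau {n : ℕ} (d : ℕ) (i : Fin n) (u : ℕ → Fin n) : ℕ → ℕ
  | 0 => 0
  | m + 1 => sInf {t : ℕ | (tau d i u m : ℝ) + 4 * Real.log d * n ≤ t ∧ u t = i}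

/-- The `T` generated samples for node `i`: the configurations at the times `τ_1, …, τ_T`. -/
def samples {Ω : Type*} {n : ℕ} (d : ℕ) (X : ℕ → Ω → Config n) (U : ℕ → Ω → Fin n)
    (i : Fin n) (T : ℕ) (ω : Ω) : Fin T → Config n :=
  fun m => X (tau d i (fun t => U t ω) (m + 1)) ω

/-! ### Node-wise logistic regression -/

/-- The logistic loss. -/
def logisticLoss (z : ℝ) : ℝ := Real.log (1 + Real.exp (-z))

/-- The polynomials of degree at most `k` in the variables `N` with `1`-norm at most `lam`. -/
def feasible {n : ℕ} (N : Finset (Fin n)) (k : ℕ) (lam : ℝ) : Set (MPoly n) :=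
  {p | (∀ S, p S ≠ 0 → S ⊆ N) ∧ p.DegreeLE k ∧ p.l1Norm ≤ lam}

/-- The empirical logistic loss of `p` for node `i` on the samples `Z`. -/
def empLoss {n T : ℕ} (i : Fin n) (Z : Fin T → Config n) (p : MPoly n) : ℝ :=
  (1 / (T : ℝ)) * ∑ m : Fin T, logisticLoss (2 * spin (Z m) i * p.eval (Z m))

/-- `p` is an output of logistic regression for node `i` with neighborhood `N`. -/
def IsLogReg {n T : ℕ} (i : Fin n) (N : Finset (Fin n)) (k : ℕ) (lam : ℝ)
    (Z : Fin T → Config n) (p : MPoly n) : Prop :=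
  p ∈ feasible N k lam ∧ ∀ q ∈ feasible N k lam, empLoss i Z p ≤ empLoss i Z q

/-- The polynomial on `{-1,1}^n` put together from node-wise polynomials `p i` (estimates of
`∂_i ψ`): the coefficient of a nonempty `S` is read off from the node `min S`. -/
def assemble {n : ℕ} (p : Fin n → MPoly n) : MPoly n :=
  fun S => if h : S.Nonempty then p (S.min' h) (S.erase (S.min' h)) else 0

/-! ### Rates and operation counts -/

/-- The quantity `A = lam² k log(d/δ) d^(C lam k²) / ε⁴`. -/
def rate (C : ℝ) (k d : ℕ) (lam ε δ : ℝ) : ℝ :=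
  lam ^ 2 * k * Real.log (d / δ) * (d : ℝ) ^ (C * lam * (k : ℝ) ^ 2) / ε ^ 4

/-- The sample size `C A log(3 + A)^C`, that is, `A` up to a factor polylogarithmic in `A`. -/
def sampleBound (C : ℝ) (k d : ℕ) (lam ε δ : ℝ) : ℝ :=
  C * rate C k d lam ε δ * (Real.log (3 + rate C k d lam ε δ)) ^ C

/-- Straight-line programs over the reals: `Computes inputs m R` says that some program with `m`
instructions, started with the functions `inputs` of the data in its registers, ends with the
functions `R` of the data in its registers. An instruction writes a constant, or the result of one
operation `+`, `-`, `*`, `/`, `exp` on registers, into a new register. -/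
inductive Computes {D : Type*} (inputs : Set (D → ℝ)) : ℕ → Set (D → ℝ) → Prop
  | start : Computes inputs 0 inputs
  | const {m : ℕ} {R : Set (D → ℝ)} (c : ℝ) (h : Computes inputs m R) :
      Computes inputs (m + 1) (insert (fun _ => c) R)
  | add {m : ℕ} {R : Set (D → ℝ)} {f g : D → ℝ} (h : Computes inputs m R) (hf : f ∈ R)
      (hg : g ∈ R) : Computes inputs (m + 1) (insert (fun z => f z + g z) R)
  | sub {m : ℕ} {R : Set (D → ℝ)} {f g : D → ℝ} (h : Computes inputs m R) (hf : f ∈ R)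
      (hg : g ∈ R) : Computes inputs (m + 1) (insert (fun z => f z - g z) R)
  | mul {m : ℕ} {R : Set (D → ℝ)} {f g : D → ℝ} (h : Computes inputs m R) (hf : f ∈ R)
      (hg : g ∈ R) : Computes inputs (m + 1) (insert (fun z => f z * g z) R)
  | div {m : ℕ} {R : Set (D → ℝ)} {f g : D → ℝ} (h : Computes inputs m R) (hf : f ∈ R)
      (hg : g ∈ R) : Computes inputs (m + 1) (insert (fun z => f z / g z) R)
  | exp {m : ℕ} {R : Set (D → ℝ)} {f : D → ℝ} (h : Computes inputs m R) (hf : f ∈ R) :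
      Computes inputs (m + 1) (insert (fun z => Real.exp (f z)) R)

/-- The data read by the node-wise regressions: for every node `i`, the spins of `i` and of its
neighbors in the `T` samples for node `i`. -/
def dataInputs {n : ℕ} (T : ℕ) (N : Fin n → Finset (Fin n)) :
    Set ((Fin n → Fin T → Config n) → ℝ) :=
  {f | ∃ (i : Fin n) (m : Fin T) (j : Fin n), j ∈ insert i (N i) ∧ f = fun z => spin (z i m) j}

end

end GlauberMRF

open GlauberMRF

namespace GlauberMRF

noncomputable section

/-! ### Multilinear polynomials -/

/-! Fix a node i. The configurations at the times τ_m have path probabilities bounded by those of a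
Markov chain with kernel `sampleKernel`: a fixed number of unrestricted steps, then the waiting time
until i is updated (`IsGlauber.measure_samples_le`). No mixing is used, only two properties of a
single transition, valid from every starting state.

Mean zero: the transition ends by resampling x_i with exactly the sigmoid probability, so the
gradient of the logistic loss at the truth ∂_iψ has conditional mean 0 (`updOp_score`,
`sampleKernel_mulVec_eq_zero`).

Spread: if r has degree at most k and variables in N(i), the conditional mean of r² at the next
sample is at least `spread` times the squared largest coefficient of r (`spread_mul_supNorm_sq_le`).
Each spin value has probability at least e^{-2λ}/2 at an update, so an update of j turns r² into at
least e^{-2λ}(∂_j r)² on average. A block of about n/|N| steps contains a single update inside N,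
made at j, with probability of order 1/|N|. One block for each j in S thus isolates the coefficient
of S, up to coefficients of strict supersets (`le_stepMat_blocks_mulVec_sq`), and these are removed
by descending induction on |S| (`MPoly.abs_coeff_le_of_top_down`). Finally, i is updated before all
of N with probability 1/(1+|N|), which preserves r.

An Azuma bound along the chain (`IsChain.measure_deviation_le`), used for the finitely many products
of two monomials and the finitely many gradient coordinates, makes the samples `Typical` with high
probability. The rest is deterministic: strong convexity of the loss on [-2λ, 2λ] converts small
excess loss into a small empirical mean of r² for r = p - ∂_iψ, hence into small coefficients
(`Typical.supNorm_sq_le`). This covers every approximate minimizer at once. Exact minimizers exist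
by compactness; efficient ones come from exponentiated gradient descent over the vertices
±λ·monomial of the feasible set (`empLoss_hedgeAvg_le`), whose iterates are explicit expressions in
exp and arithmetic, so that a straight-line program computes them
(`exists_computes_assemble_hedgeAvg`). -/

/-- The monomial `∏ j ∈ S, x_j`. -/
def chi {n : ℕ} (S : Finset (Fin n)) (x : Config n) : ℝ := ∏ j ∈ S, spin x j

theorem spin_eq_one_or {n : ℕ} (x : Config n) (j : Fin n) : spin x j = 1 ∨ spin x j = -1 := by
  unfold spin
  rcases Int.units_eq_one_or (x j) with h | h <;> simp [h]

theorem abs_spin {n : ℕ} (x : Config n) (j : Fin n) : |spin x j| = 1 := by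
  rcases spin_eq_one_or x j with h | h <;> simp [h]

theorem abs_chi {n : ℕ} (S : Finset (Fin n)) (x : Config n) : |chi S x| = 1 := by
  unfold chi
  rw [Finset.abs_prod]
  exact Finset.prod_eq_one fun j _ => abs_spin x j

theorem MPoly.eval_eq_sum_chi {n : ℕ} (p : MPoly n) (x : Config n) :
    p.eval x = ∑ S : Finset (Fin n), p S * chi S x := rfl

theorem MPoly.abs_eval_le {n : ℕ} (p : MPoly n) (x : Config n) : |p.eval x| ≤ p.l1Norm := by
  rw [MPoly.eval_eq_sum_chi]
  refine (Finset.abs_sum_le_sum_abs _ _).trans (le_of_eq ?_)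
  simp [MPoly.l1Norm, abs_mul, abs_chi]

theorem MPoly.eval_sub {n : ℕ} (p q : MPoly n) (x : Config n) :
    (p - q).eval x = p.eval x - q.eval x := by
  simp [MPoly.eval_eq_sum_chi, sub_mul]

theorem MPoly.l1Norm_sub_le {n : ℕ} (p q : MPoly n) :
    (p - q).l1Norm ≤ p.l1Norm + q.l1Norm := by
  unfold MPoly.l1Norm
  rw [← Finset.sum_add_distrib]
  exact Finset.sum_le_sum fun S _ => abs_sub (p S) (q S)

theorem MPoly.supNorm_le_iff {n : ℕ} (p : MPoly n) (b : ℝ) :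
    p.supNorm ≤ b ↔ ∀ S, |p S| ≤ b := by
  simp [MPoly.supNorm]

theorem MPoly.abs_le_supNorm {n : ℕ} (p : MPoly n) (S : Finset (Fin n)) : |p S| ≤ p.supNorm :=
  (p.supNorm_le_iff _).1 le_rfl S

theorem MPoly.supNorm_nonneg {n : ℕ} (p : MPoly n) : 0 ≤ p.supNorm :=
  (abs_nonneg _).trans (p.abs_le_supNorm ∅)

/-- Only the variables in `N` occur in `p`. -/
def MPoly.VarsIn {n : ℕ} (p : MPoly n) (N : Finset (Fin n)) : Prop := ∀ S, p S ≠ 0 → S ⊆ N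

theorem MPoly.VarsIn.eval_congr {n : ℕ} {p : MPoly n} {N : Finset (Fin n)} (hp : p.VarsIn N)
    {x y : Config n} (h : ∀ j ∈ N, x j = y j) : p.eval x = p.eval y := by
  unfold MPoly.eval
  refine Finset.sum_congr rfl fun S _ => ?_
  by_cases hS : p S = 0
  · simp [hS]
  · congr 1
    exact Finset.prod_congr rfl fun j hj => by simp [spin, h j (hp S hS hj)]

theorem MPoly.VarsIn.pderiv {n : ℕ} {p : MPoly n} {N : Finset (Fin n)} (hp : p.VarsIn N)
    (j : Fin n) : (p.pderiv j).VarsIn N := by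
  intro S hS
  unfold MPoly.pderiv at hS
  split_ifs at hS
  · exact absurd rfl hS
  · exact (Finset.subset_insert j S).trans (hp _ hS)

theorem MPoly.DegreeLE.pderiv {n k : ℕ} {p : MPoly n} (hp : p.DegreeLE k)
    (j : Fin n) : (p.pderiv j).DegreeLE k := by
  intro S hS
  unfold MPoly.pderiv at hS
  split_ifs at hS
  · exact absurd rfl hS
  · exact (Finset.card_le_card (Finset.subset_insert j S)).trans (hp _ hS)

theorem sum_finset_eq_sum_powerset_erase {n : ℕ} (j : Fin n) (f : Finset (Fin n) → ℝ) :
    ∑ S, f S = ∑ S ∈ (Finset.univ.erase j).powerset, (f S + f (insert j S)) := by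
  rw [Finset.sum_add_distrib, ← Finset.sum_powerset_insert (Finset.notMem_erase j _),
    Finset.insert_erase (Finset.mem_univ j), Finset.powerset_univ]

theorem chi_update_of_notMem {n : ℕ} {S : Finset (Fin n)} {j : Fin n} (h : j ∉ S) (x : Config n)
    (e : ℤˣ) : chi S (Function.update x j e) = chi S x := by
  unfold chi
  refine Finset.prod_congr rfl fun l hl => ?_
  have : l ≠ j := fun h' => h (h' ▸ hl)
  simp [spin, Function.update_of_ne this]

theorem MPoly.eval_update_sub {n : ℕ} (p : MPoly n) (j : Fin n) (x : Config n) :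
    p.eval (Function.update x j 1) - p.eval (Function.update x j (-1))
      = 2 * (p.pderiv j).eval x := by
  rw [MPoly.eval_eq_sum_chi, MPoly.eval_eq_sum_chi, MPoly.eval_eq_sum_chi,
    ← Finset.sum_sub_distrib, Finset.mul_sum, sum_finset_eq_sum_powerset_erase j,
    sum_finset_eq_sum_powerset_erase j]
  refine Finset.sum_congr rfl fun S hS => ?_
  have hj : j ∉ S := fun h => by simpa using Finset.mem_powerset.1 hS h
  have hc : ∀ e, chi (insert j S) (Function.update x j e) = ((e : ℤ) : ℝ) * chi S x := by
    intro e
    rw [← chi_update_of_notMem hj x e]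
    unfold chi
    rw [Finset.prod_insert hj]
    simp [spin]
  simp [MPoly.pderiv, hj, chi_update_of_notMem hj, hc]
  ring

/-- Base case of `le_stepMat_blocks_mulVec_sq`: after all variables of a set have been
differentiated away, the coefficient of interest is the constant one. -/
theorem MPoly.abs_coeff_empty_sub_le {n : ℕ} (p : MPoly n) (x : Config n) :
    |p ∅| - ∑ T ∈ Finset.univ.filter (fun T => ∅ ⊂ T), |p T| ≤ |p.eval x| := by
  have h1 : p.eval x = p ∅ + ∑ T ∈ Finset.univ.filter (fun T => ∅ ⊂ T), p T * chi T x := by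
    rw [MPoly.eval_eq_sum_chi, ← Finset.sum_filter_add_sum_filter_not _ (fun T => ∅ ⊂ T), add_comm]
    congr 1
    have : Finset.univ.filter (fun T : Finset (Fin n) => ¬ ∅ ⊂ T) = {∅} := by
      ext T; simp [Finset.not_nonempty_iff_eq_empty]
    rw [this]; simp [chi]
  have h2 : |∑ T ∈ Finset.univ.filter (fun T => ∅ ⊂ T), p T * chi T x|
      ≤ ∑ T ∈ Finset.univ.filter (fun T => ∅ ⊂ T), |p T| := by
    refine (Finset.abs_sum_le_sum_abs _ _).trans (le_of_eq ?_)
    simp [abs_mul, abs_chi]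
  have h3 := abs_sub_abs_le_abs_sub (p ∅)
    (-∑ T ∈ Finset.univ.filter (fun T => ∅ ⊂ T), p T * chi T x)
  rw [abs_neg, sub_neg_eq_add, ← h1] at h3
  linarith

/-- Inserting j is injective on the sets avoiding j and sends strict supersets of S to strict
supersets of `insert j S`. Hence the error term in the block iteration does not grow under
differentiation. -/
theorem MPoly.sum_abs_pderiv_ssuperset_le {n : ℕ} (p : MPoly n) {j : Fin n}
    {S : Finset (Fin n)} (hj : j ∉ S) :
    ∑ T ∈ Finset.univ.filter (fun T => S ⊂ T), |p.pderiv j T|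
      ≤ ∑ T ∈ Finset.univ.filter (fun T => insert j S ⊂ T), |p T| := by
  have h1 : ∑ T ∈ Finset.univ.filter (fun T => S ⊂ T), |p.pderiv j T|
      = ∑ T ∈ Finset.univ.filter (fun T => S ⊂ T ∧ j ∉ T), |p (insert j T)| := by
    rw [← Finset.filter_filter, Finset.sum_filter (fun T => j ∉ T)]
    refine Finset.sum_congr rfl fun T _ => ?_
    by_cases h : j ∈ T <;> simp [MPoly.pderiv, h]
  rw [h1, ← Finset.sum_image (f := fun T => |p T|) (g := insert j)]
  · refine Finset.sum_le_sum_of_subset_of_nonneg ?_ fun _ _ _ => abs_nonneg _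
    intro T hT
    obtain ⟨T', hT', rfl⟩ := Finset.mem_image.1 hT
    simp only [Finset.mem_filter, Finset.mem_univ, true_and] at hT' ⊢
    refine (Finset.ssubset_iff_subset_ne).2 ⟨Finset.insert_subset_insert _ hT'.1.1, fun h => ?_⟩
    apply hT'.1.ne
    rw [← Finset.erase_insert hj, h, Finset.erase_insert hT'.2]
  · intro T hT T' hT' h
    simp only [Finset.coe_filter, Finset.mem_univ, true_and, Set.mem_ofPred_eq] at hT hT'
    rw [← Finset.erase_insert hT.2, h, Finset.erase_insert hT'.2]

/-! ### Scalar inequalities -/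

/-- Taking means over a centred z removes the linear term and leaves a subgaussian moment bound with
no restriction on the size of z. It serves both the concentration bound and the regret bound. -/
theorem exp_le_add_exp_sq (z : ℝ) : Real.exp z ≤ z + Real.exp (z ^ 2) := by
  have h1 := Real.add_one_le_exp (z ^ 2)
  rcases le_or_gt |z| 1 with h | h
  · have := (abs_le.1 (Real.abs_exp_sub_one_sub_id_le h)).2
    linarith
  · rcases lt_abs.1 h with h | h
    · have : Real.exp z ≤ Real.exp (z ^ 2) := Real.exp_le_exp.2 (by nlinarith)
      linarith
    · have : Real.exp z ≤ 1 := Real.exp_le_one_iff.2 (by linarith)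
      nlinarith

theorem sigm_neg (z : ℝ) : sigm (-z) = 1 - sigm z := by
  unfold sigm
  have := Real.exp_pos z
  rw [neg_neg, Real.exp_neg]
  field_simp
  ring

theorem sigm_pos (z : ℝ) : 0 < sigm z := by unfold sigm; positivity

theorem sigm_lt_one (z : ℝ) : sigm z < 1 := by
  have := sigm_pos (-z)
  rw [sigm_neg] at this; linarith

theorem exp_neg_le_sigm {z a : ℝ} (ha : 0 ≤ a) (h : |z| ≤ a) : Real.exp (-a) / 2 ≤ sigm z := by
  unfold sigm
  have h1 : Real.exp (-z) ≤ Real.exp a := Real.exp_le_exp.2 (by linarith [neg_abs_le z])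
  have h2 : 1 ≤ Real.exp a := Real.one_le_exp ha
  rw [Real.exp_neg a, div_le_div_iff₀ two_pos (by positivity), inv_mul_eq_div, div_le_iff₀
    (by positivity)]
  linarith

theorem hasDerivAt_logisticLoss (z : ℝ) : HasDerivAt logisticLoss (-sigm (-z)) z := by
  have h : HasDerivAt (fun z => 1 + Real.exp (-z)) (-Real.exp (-z)) z := by
    simpa using ((hasDerivAt_neg z).exp).const_add 1
  have h2 := h.log (by positivity)
  refine h2.congr_deriv ?_
  unfold sigm
  rw [neg_neg, Real.exp_neg]
  have := Real.exp_pos z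
  field_simp
  ring

theorem hasDerivAt_neg_sigm_neg (z : ℝ) :
    HasDerivAt (fun z => -sigm (-z)) (sigm z * sigm (-z)) z := by
  have h : HasDerivAt (fun z => 1 + Real.exp z) (Real.exp z) z := by
    simpa using (Real.hasDerivAt_exp z).const_add 1
  have h2 := (h.inv (by positivity)).neg
  have e : (fun z => -sigm (-z)) = -(fun z => 1 + Real.exp z)⁻¹ := by
    funext z; simp [sigm]
  rw [e]
  refine h2.congr_deriv ?_
  unfold sigm
  rw [neg_neg, Real.exp_neg]
  have := Real.exp_pos z
  field_simp
  ring

theorem ConvexOn.tangent_le {S : Set ℝ} {f : ℝ → ℝ} {a b f' : ℝ} (hf : ConvexOn ℝ S f)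
    (ha : a ∈ S) (hb : b ∈ S) (h : HasDerivAt f f' a) : f a + f' * (b - a) ≤ f b := by
  rcases lt_trichotomy a b with hab | rfl | hab
  · have := hf.le_slope_of_hasDerivAt ha hb hab h
    rw [slope_def_field, le_div_iff₀ (by linarith)] at this
    linarith
  · simp
  · have := hf.slope_le_of_hasDerivAt hb ha hab h
    rw [slope_def_field, div_le_iff₀ (by linarith)] at this
    linarith

/-- The second derivative is σ(z)σ(-z). One factor is at least 1/2, the other at least e^{-2l}/2, so
subtracting a small multiple of z² keeps the loss convex on the interval, and the tangent inequality
applies to the difference. -/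
theorem logisticLoss_strongly_convex {l a b : ℝ} (hl : 0 ≤ l) (ha : |a| ≤ 2 * l)
    (hb : |b| ≤ 2 * l) :
    logisticLoss a - sigm (-a) * (b - a) + Real.exp (-(2 * l)) / 16 * (b - a) ^ 2
      ≤ logisticLoss b := by
  set κ := Real.exp (-(2 * l)) / 16 with hκ
  have hd : ∀ z, HasDerivAt (fun z => logisticLoss z - κ * z ^ 2) (-sigm (-z) - κ * (2 * z)) z :=
    fun z => (hasDerivAt_logisticLoss z).sub
      (by simpa using (hasDerivAt_pow 2 z).const_mul κ)
  have hd2 : ∀ z, HasDerivAt (fun z => -sigm (-z) - κ * (2 * z))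
      (sigm z * sigm (-z) - κ * 2) z :=
    fun z => (hasDerivAt_neg_sigm_neg z).sub
      (by simpa using ((hasDerivAt_id z).const_mul 2).const_mul κ)
  have hc : ConvexOn ℝ (Set.Icc (-(2 * l)) (2 * l)) (fun z => logisticLoss z - κ * z ^ 2) := by
    refine convexOn_of_hasDerivWithinAt2_nonneg (convex_Icc _ _)
      (fun z _ => (hd z).continuousAt.continuousWithinAt)
      (fun z _ => (hd z).hasDerivWithinAt) (fun z _ => (hd2 z).hasDerivWithinAt) ?_
    intro z hz
    rw [interior_Icc] at hz
    have hz' : |z| ≤ 2 * l := abs_le.2 ⟨hz.1.le, hz.2.le⟩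
    have h1 := exp_neg_le_sigm (by linarith) hz'
    have h2 := exp_neg_le_sigm (z := -z) (a := 2 * l) (by linarith) (by rwa [abs_neg])
    have h0 := Real.exp_pos (-(2 * l))
    have h3 := sigm_neg z
    by_cases h : 1 / 2 ≤ sigm z <;> nlinarith
  have := ConvexOn.tangent_le hc (abs_le.1 ha) (abs_le.1 hb) (hd a)
  nlinarith

end

end GlauberMRF

namespace GlauberMRF

noncomputable section

open Matrix

/-! ### Transition matrices of the Glauber dynamics -/

theorem updateProb_add {n : ℕ} (ψ : MPoly n) (x : Config n) (j : Fin n) :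
    updateProb ψ x j 1 + updateProb ψ x j (-1) = 1 := by
  simp [updateProb]

theorem updateProb_nonneg {n : ℕ} (ψ : MPoly n) (x : Config n) (j : Fin n) (e : ℤˣ) :
    0 ≤ updateProb ψ x j e := by
  unfold updateProb
  have := sigm_pos (2 * (ψ.pderiv j).eval x)
  have := sigm_lt_one (2 * (ψ.pderiv j).eval x)
  split_ifs <;> linarith

theorem le_updateProb {n : ℕ} {ψ : MPoly n} {j : Fin n} {lam : ℝ}
    (h : (ψ.pderiv j).l1Norm ≤ lam) (x : Config n) (e : ℤˣ) :
    Real.exp (-(2 * lam)) / 2 ≤ updateProb ψ x j e := by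
  have h1 : |2 * (ψ.pderiv j).eval x| ≤ 2 * lam := by
    rw [abs_mul, abs_two]
    linarith [(ψ.pderiv j).abs_eval_le x]
  have h0 : 0 ≤ 2 * lam := (abs_nonneg _).trans h1
  unfold updateProb
  split_ifs
  · exact exp_neg_le_sigm h0 h1
  · rw [← sigm_neg]
    exact exp_neg_le_sigm h0 (by rwa [abs_neg])

theorem stepProb_nonneg {n : ℕ} (ψ : MPoly n) (x : Config n) (i : Fin n) (y : Config n) :
    0 ≤ stepProb ψ x i y := by
  unfold stepProb
  have := updateProb_nonneg ψ x i (y i)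
  split_ifs <;> positivity

/-- The mean of `f` after the update of site `j`. -/
def updOp {n : ℕ} (ψ : MPoly n) (j : Fin n) (f : Config n → ℝ) (x : Config n) : ℝ :=
  updateProb ψ x j 1 * f (Function.update x j 1) +
    updateProb ψ x j (-1) * f (Function.update x j (-1))

theorem sum_stepProb_mul {n : ℕ} (ψ : MPoly n) (j : Fin n) (f : Config n → ℝ) (x : Config n) :
    ∑ y, stepProb ψ x j y * f y = (1 / (n : ℝ)) * updOp ψ j f x := by
  have hne : Function.update x j 1 ≠ Function.update x j (-1) := fun h => by
    have := congrFun h j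
    simp only [Function.update_self] at this
    exact absurd this (by decide)
  rw [← Finset.sum_subset (Finset.subset_univ {Function.update x j 1, Function.update x j (-1)}),
    Finset.sum_pair hne]
  · have h : ∀ e, stepProb ψ x j (Function.update x j e) = 1 / (n : ℝ) * updateProb ψ x j e := by
      intro e
      unfold stepProb
      rw [if_pos fun l hl => Function.update_of_ne hl _ _, Function.update_self]
    rw [h, h]
    unfold updOp
    ring
  · intro y _ hy
    unfold stepProb
    rw [if_neg, zero_mul]
    intro h
    apply hy
    have h1 : y = Function.update x j (y j) := by
      funext l
      by_cases hl : l = j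
      · subst hl; simp
      · rw [Function.update_of_ne hl, h l hl]
    rw [Finset.mem_insert, Finset.mem_singleton]
    rcases Int.units_eq_one_or (y j) with h2 | h2
    · left; rwa [h2] at h1
    · right; rwa [h2] at h1

theorem updOp_of_indep {n : ℕ} (ψ : MPoly n) {j : Fin n} {f : Config n → ℝ}
    (hf : ∀ x e, f (Function.update x j e) = f x) : updOp ψ j f = f := by
  funext x
  unfold updOp
  rw [hf, hf, ← add_mul, updateProb_add, one_mul]

theorem updOp_nonneg {n : ℕ} (ψ : MPoly n) (j : Fin n) {f : Config n → ℝ} (hf : ∀ x, 0 ≤ f x)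
    (x : Config n) : 0 ≤ updOp ψ j f x :=
  add_nonneg (mul_nonneg (updateProb_nonneg _ _ _ _) (hf _))
    (mul_nonneg (updateProb_nonneg _ _ _ _) (hf _))

/-- With values a, b of p at the two spins, the mean is at least e^{-2λ}(a² + b²)/2, and (a² + b²)/2
≥ ((a - b)/2)² = (∂_j p)². -/
theorem le_updOp_sq {n : ℕ} {ψ : MPoly n} {j : Fin n} {lam : ℝ}
    (h : (ψ.pderiv j).l1Norm ≤ lam) (p : MPoly n) (x : Config n) :
    Real.exp (-(2 * lam)) * (p.pderiv j).eval x ^ 2 ≤ updOp ψ j (fun x => p.eval x ^ 2) x := by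
  have h1 := le_updateProb h x 1
  have h2 := le_updateProb h x (-1)
  have h3 := p.eval_update_sub j x
  have h0 := Real.exp_pos (-(2 * lam))
  unfold updOp
  set a := p.eval (Function.update x j 1)
  set b := p.eval (Function.update x j (-1))
  have h4 : (p.pderiv j).eval x = (a - b) / 2 := by linarith
  rw [h4]
  calc _ ≤ Real.exp (-(2 * lam)) / 2 * a ^ 2 + Real.exp (-(2 * lam)) / 2 * b ^ 2 := by
        nlinarith [mul_nonneg h0.le (sq_nonneg (a + b))]
    _ ≤ _ := by gcongr

/-- The transition matrix of the dynamics restricted to updates of the sites in `J`. -/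
def stepMat {n : ℕ} (ψ : MPoly n) (J : Finset (Fin n)) : Matrix (Config n) (Config n) ℝ :=
  fun x y => ∑ j ∈ J, stepProb ψ x j y

theorem stepMat_nonneg {n : ℕ} (ψ : MPoly n) (J : Finset (Fin n)) (x y : Config n) :
    0 ≤ stepMat ψ J x y := Finset.sum_nonneg fun _ _ => stepProb_nonneg _ _ _ _

theorem stepMat_mulVec {n : ℕ} (ψ : MPoly n) (J : Finset (Fin n)) (f : Config n → ℝ)
    (x : Config n) : (stepMat ψ J *ᵥ f) x = (1 / (n : ℝ)) * ∑ j ∈ J, updOp ψ j f x := by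
  simp only [Matrix.mulVec, dotProduct, stepMat, Finset.sum_mul]
  rw [Finset.sum_comm, Finset.mul_sum]
  exact Finset.sum_congr rfl fun j _ => sum_stepProb_mul ψ j f x

theorem stepMat_mulVec_const {n : ℕ} (ψ : MPoly n) (J : Finset (Fin n)) (c : ℝ) :
    stepMat ψ J *ᵥ (fun _ => c) = fun _ => (J.card / (n : ℝ)) * c := by
  funext x
  rw [stepMat_mulVec]
  have : ∀ j, updOp ψ j (fun _ => c) x = c := fun j =>
    congrFun (updOp_of_indep ψ (fun _ _ => rfl)) x
  simp [this]
  ring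

/-- A matrix with nonnegative entries. -/
def EntryNonneg {α : Type*} (M : Matrix α α ℝ) : Prop := ∀ x y, 0 ≤ M x y

theorem EntryNonneg.mul {α : Type*} [Fintype α] {M M' : Matrix α α ℝ} (h : EntryNonneg M)
    (h' : EntryNonneg M') : EntryNonneg (M * M') := fun x y =>
  Finset.sum_nonneg fun z _ => mul_nonneg (h x z) (h' z y)

theorem EntryNonneg.pow {α : Type*} [Fintype α] [DecidableEq α] {M : Matrix α α ℝ}
    (h : EntryNonneg M) (s : ℕ) : EntryNonneg (M ^ s) := by
  induction s with
  | zero => intro x y; rw [pow_zero, Matrix.one_apply]; split_ifs <;> norm_num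
  | succ s ih => rw [pow_succ]; exact ih.mul h

theorem EntryNonneg.mulVec_mono {α : Type*} [Fintype α] {M : Matrix α α ℝ}
    (h : EntryNonneg M) {f g : α → ℝ} (hfg : f ≤ g) : M *ᵥ f ≤ M *ᵥ g := fun x =>
  Finset.sum_le_sum fun y _ => mul_le_mul_of_nonneg_left (hfg y) (h x y)

theorem stepMat_pow_mulVec_const {n : ℕ} (ψ : MPoly n) (J : Finset (Fin n)) (s : ℕ) (c : ℝ) :
    stepMat ψ J ^ s *ᵥ (fun _ => c) = fun _ => (J.card / (n : ℝ)) ^ s * c := by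
  induction s with
  | zero => simp
  | succ s ih =>
    rw [pow_succ', ← Matrix.mulVec_mulVec, ih, stepMat_mulVec_const]
    funext; ring

theorem stepMat_univ_pow_mulVec_const {n : ℕ} (hn : n ≠ 0) (ψ : MPoly n) (s : ℕ) (c : ℝ) :
    stepMat ψ Finset.univ ^ s *ᵥ (fun _ => c) = fun _ => c := by
  rw [stepMat_pow_mulVec_const]
  have : (n : ℝ) ≠ 0 := Nat.cast_ne_zero.2 hn
  simp [this]

/-! ### The law of the next sample -/

/-- The probability to move from `x` to `y` in `w` unrestricted steps, then `s` steps without an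
update of `i`, then an update of `i`. -/
def sampleMat {n : ℕ} (ψ : MPoly n) (i : Fin n) (w s : ℕ) : Matrix (Config n) (Config n) ℝ :=
  stepMat ψ Finset.univ ^ w * stepMat ψ {i}ᶜ ^ s * stepMat ψ {i}

/-- The transition matrix between consecutive samples: `w` unrestricted steps followed by the
first subsequent update of `i`. -/
def sampleKernel {n : ℕ} (ψ : MPoly n) (i : Fin n) (w : ℕ) : Matrix (Config n) (Config n) ℝ :=
  fun x y => ∑' s, sampleMat ψ i w s x y

theorem sampleMat_nonneg {n : ℕ} (ψ : MPoly n) (i : Fin n) (w s : ℕ) :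
    EntryNonneg (sampleMat ψ i w s) :=
  ((EntryNonneg.pow (stepMat_nonneg ψ _) w).mul (EntryNonneg.pow (stepMat_nonneg ψ _) s)).mul
    (stepMat_nonneg ψ _)

theorem sampleMat_mulVec {n : ℕ} (ψ : MPoly n) (i : Fin n) (w s : ℕ) (f : Config n → ℝ) :
    sampleMat ψ i w s *ᵥ f =
      stepMat ψ Finset.univ ^ w *ᵥ (stepMat ψ {i}ᶜ ^ s *ᵥ (stepMat ψ {i} *ᵥ f)) := by
  simp [sampleMat, Matrix.mulVec_mulVec, Matrix.mul_assoc]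

theorem Fin.card_compl_singleton_div {n : ℕ} (i : Fin n) :
    ((({i}ᶜ : Finset (Fin n)).card : ℝ) / n) = 1 - 1 / n := by
  have hn : 0 < n := i.pos
  have hn' : (n : ℝ) ≠ 0 := Nat.cast_ne_zero.2 hn.ne'
  rw [Finset.card_compl, Finset.card_singleton, Fintype.card_fin, Nat.cast_sub hn]
  field_simp
  simp

theorem sampleMat_mulVec_one {n : ℕ} (ψ : MPoly n) (i : Fin n) (w s : ℕ) (x : Config n) :
    (sampleMat ψ i w s *ᵥ (fun _ => 1)) x = (1 - 1 / (n : ℝ)) ^ s * (1 / n) := by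
  rw [sampleMat_mulVec, stepMat_mulVec_const, stepMat_pow_mulVec_const,
    stepMat_univ_pow_mulVec_const i.pos.ne', Fin.card_compl_singleton_div]
  simp

theorem one_sub_inv_mem {n : ℕ} (hn : 0 < n) : 0 ≤ 1 - 1 / (n : ℝ) ∧ 1 - 1 / (n : ℝ) < 1 := by
  have h1 : (1 : ℝ) ≤ n := by exact_mod_cast hn
  have h2 : 1 / (n : ℝ) ≤ 1 := by rw [div_le_one (by linarith)]; exact h1
  have h3 : 0 < 1 / (n : ℝ) := by positivity
  constructor <;> linarith

theorem summable_sampleMat {n : ℕ} (ψ : MPoly n) (i : Fin n) (w : ℕ) (x y : Config n) :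
    Summable fun s => sampleMat ψ i w s x y := by
  have h := one_sub_inv_mem i.pos
  refine Summable.of_nonneg_of_le (fun s => sampleMat_nonneg ψ i w s x y) (fun s => ?_)
    ((summable_geometric_of_lt_one h.1 h.2).mul_right (1 / (n : ℝ)))
  rw [← sampleMat_mulVec_one ψ i w s x]
  simp only [Matrix.mulVec, dotProduct, mul_one]
  exact Finset.single_le_sum (fun z _ => sampleMat_nonneg ψ i w s x z) (Finset.mem_univ y)

theorem sampleKernel_nonneg {n : ℕ} (ψ : MPoly n) (i : Fin n) (w : ℕ) :
    EntryNonneg (sampleKernel ψ i w) := fun x y =>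
  tsum_nonneg fun s => sampleMat_nonneg ψ i w s x y

theorem hasSum_sampleKernel_mulVec {n : ℕ} (ψ : MPoly n) (i : Fin n) (w : ℕ) (f : Config n → ℝ)
    (x : Config n) :
    HasSum (fun s => (sampleMat ψ i w s *ᵥ f) x) ((sampleKernel ψ i w *ᵥ f) x) :=
  hasSum_sum fun y _ => (summable_sampleMat ψ i w x y).hasSum.mul_right (f y)

theorem sampleKernel_row_sum {n : ℕ} (ψ : MPoly n) (i : Fin n) (w : ℕ) (x : Config n) :
    ∑ y, sampleKernel ψ i w x y = 1 := by
  have h := hasSum_sampleKernel_mulVec ψ i w (fun _ => 1) x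
  simp only [sampleMat_mulVec_one] at h
  have hn := one_sub_inv_mem i.pos
  have h2 := (hasSum_geometric_of_lt_one hn.1 hn.2).mul_right (1 / (n : ℝ))
  have h3 := h.unique h2
  have hn' : (n : ℝ) ≠ 0 := Nat.cast_ne_zero.2 i.pos.ne'
  simpa [Matrix.mulVec, dotProduct, hn'] using h3

/-- The last factor of every `sampleMat` is an update of i, which already annihilates f; the earlier
steps are irrelevant. -/
theorem sampleKernel_mulVec_eq_zero {n : ℕ} (ψ : MPoly n) (i : Fin n) (w : ℕ)
    {f : Config n → ℝ} (hf : ∀ x, updOp ψ i f x = 0) (x : Config n) :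
    (sampleKernel ψ i w *ᵥ f) x = 0 := by
  have h := hasSum_sampleKernel_mulVec ψ i w f x
  have h0 : stepMat ψ {i} *ᵥ f = 0 := by
    funext z; rw [stepMat_mulVec]; simp [hf]
  simp only [sampleMat_mulVec, h0, Matrix.mulVec_zero, Pi.zero_apply] at h
  exact h.unique hasSum_zero

/-! ### Lower bounds for the second moment of a polynomial at the next sample -/

theorem MPoly.VarsIn.eval_update {n : ℕ} {p : MPoly n} {N : Finset (Fin n)} (hp : p.VarsIn N)
    {j : Fin n} (hj : j ∉ N) (x : Config n) (e : ℤˣ) :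
    p.eval (Function.update x j e) = p.eval x :=
  hp.eval_congr fun l hl => Function.update_of_ne (fun h => hj (by rwa [← h])) _ _

theorem le_sum_updOp_sq {n : ℕ} (ψ : MPoly n) {p : MPoly n} {N J : Finset (Fin n)}
    (hp : p.VarsIn N) (x : Config n) :
    (J \ N).card * p.eval x ^ 2 ≤ ∑ j ∈ J \ N, updOp ψ j (fun x => p.eval x ^ 2) x := by
  rw [← nsmul_eq_mul, ← Finset.sum_const]
  refine Finset.sum_le_sum fun j hj => le_of_eq ?_
  have : updOp ψ j (fun x => p.eval x ^ 2) = fun x => p.eval x ^ 2 :=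
    updOp_of_indep ψ fun x e => by rw [hp.eval_update (Finset.mem_sdiff.1 hj).2]
  rw [this]

theorem le_stepMat_mulVec_sq {n : ℕ} (ψ : MPoly n) {p : MPoly n} {N : Finset (Fin n)}
    (J : Finset (Fin n)) (hp : p.VarsIn N) (x : Config n) :
    ((J \ N).card / (n : ℝ)) * p.eval x ^ 2 ≤ (stepMat ψ J *ᵥ fun x => p.eval x ^ 2) x := by
  rw [stepMat_mulVec, div_mul_eq_mul_div, ← one_div_mul_eq_div]
  refine mul_le_mul_of_nonneg_left ((le_sum_updOp_sq ψ hp x).trans ?_) (by positivity)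
  exact Finset.sum_le_sum_of_subset_of_nonneg Finset.sdiff_subset fun j _ _ =>
    updOp_nonneg ψ j (fun _ => sq_nonneg _) x

/-- An update outside N does not change p, and an update of j yields the derivative. The updates at
the other sites of N contribute nonnegatively and are dropped. -/
theorem le_stepMat_univ_mulVec_sq {n : ℕ} {ψ : MPoly n} {p : MPoly n} {N : Finset (Fin n)}
    {lam : ℝ} (hp : p.VarsIn N) {j : Fin n} (hj : j ∈ N) (h : (ψ.pderiv j).l1Norm ≤ lam)
    (x : Config n) :
    (1 - N.card / (n : ℝ)) * p.eval x ^ 2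
        + Real.exp (-(2 * lam)) / n * (p.pderiv j).eval x ^ 2
      ≤ (stepMat ψ Finset.univ *ᵥ fun x => p.eval x ^ 2) x := by
  have hn' : (n : ℝ) ≠ 0 := Nat.cast_ne_zero.2 j.pos.ne'
  have hc : ((Finset.univ \ N).card : ℝ) = n - N.card := by
    rw [Finset.card_sdiff_of_subset (Finset.subset_univ N),
      Nat.cast_sub (Finset.card_le_card (Finset.subset_univ N))]
    simp
  have h1 := le_sum_updOp_sq ψ (J := Finset.univ) hp x
  have h2 := le_updOp_sq h p x
  rw [hc] at h1
  have h3 : ∑ l ∈ Finset.univ \ N, updOp ψ l (fun x => p.eval x ^ 2) x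
      + updOp ψ j (fun x => p.eval x ^ 2) x ≤ ∑ l, updOp ψ l (fun x => p.eval x ^ 2) x := by
    rw [add_comm, ← Finset.sum_insert (f := fun l => updOp ψ l (fun x => p.eval x ^ 2) x)
      (show j ∉ Finset.univ \ N by simp [hj])]
    exact Finset.sum_le_sum_of_subset_of_nonneg (Finset.subset_univ _) fun j _ _ =>
      updOp_nonneg ψ j (fun _ => sq_nonneg _) x
  rw [stepMat_mulVec]
  have h4 : (1 - N.card / (n : ℝ)) * p.eval x ^ 2
        + Real.exp (-(2 * lam)) / n * (p.pderiv j).eval x ^ 2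
      = 1 / n * ((n - N.card) * p.eval x ^ 2
        + Real.exp (-(2 * lam)) * (p.pderiv j).eval x ^ 2) := by
    field_simp
  rw [h4]
  exact mul_le_mul_of_nonneg_left (by linarith) (by positivity)

/-- The second term collects the trajectories with a single update inside N, made at j, at one of
the L possible times. -/
theorem le_stepMat_pow_mulVec_sq {n : ℕ} {ψ : MPoly n} {p : MPoly n} {N : Finset (Fin n)}
    {lam : ℝ} (hp : p.VarsIn N) {j : Fin n} (hj : j ∈ N) (h : (ψ.pderiv j).l1Norm ≤ lam)
    (L : ℕ) (x : Config n) :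
    (1 - N.card / (n : ℝ)) ^ L * p.eval x ^ 2
        + L * (1 - N.card / (n : ℝ)) ^ (L - 1) * (Real.exp (-(2 * lam)) / n)
          * (p.pderiv j).eval x ^ 2
      ≤ (stepMat ψ Finset.univ ^ L *ᵥ fun x => p.eval x ^ 2) x := by
  have hn : (0 : ℝ) < n := Nat.cast_pos.2 j.pos
  set a := 1 - N.card / (n : ℝ) with ha
  set b := Real.exp (-(2 * lam)) / n
  have ha0 : 0 ≤ a := by
    rw [ha, sub_nonneg, div_le_one hn]
    exact_mod_cast (Finset.card_le_univ N).trans_eq (Fintype.card_fin n)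
  have hb0 : 0 ≤ b := by positivity
  induction L generalizing x with
  | zero => simp
  | succ L ih =>
    rw [pow_succ' (stepMat ψ Finset.univ), ← Matrix.mulVec_mulVec]
    refine le_trans ?_ (EntryNonneg.mulVec_mono (stepMat_nonneg ψ Finset.univ)
      (f := a ^ L • (fun x => p.eval x ^ 2)
        + (L * a ^ (L - 1) * b) • fun x => (p.pderiv j).eval x ^ 2) (fun z => ih z) x)
    rw [Matrix.mulVec_add, Matrix.mulVec_smul, Matrix.mulVec_smul]
    simp only [Pi.add_apply, Pi.smul_apply, smul_eq_mul]
    have h1 := mul_le_mul_of_nonneg_left (le_stepMat_univ_mulVec_sq hp hj h x) (pow_nonneg ha0 L)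
    have h2 := mul_le_mul_of_nonneg_left (le_stepMat_univ_mulVec_sq (hp.pderiv j) hj h x)
      (show 0 ≤ L * a ^ (L - 1) * b by positivity)
    have h3 : 0 ≤ (L * a ^ (L - 1) * b) * (b * ((p.pderiv j).pderiv j).eval x ^ 2) := by positivity
    refine le_trans ?_ (add_le_add h1 h2)
    change _ ≤ a ^ L * (a * p.eval x ^ 2 + b * (p.pderiv j).eval x ^ 2)
      + L * a ^ (L - 1) * b * (a * (p.pderiv j).eval x ^ 2
        + b * ((p.pderiv j).pderiv j).eval x ^ 2)
    -- For L = 0 the truncated exponent L - 1 is harmless because of the factor L.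
    have h4 : (L : ℝ) * a ^ (L - 1) * a = L * a ^ L := by
      rcases Nat.eq_zero_or_pos L with h0 | h0
      · simp [h0]
      · rw [mul_assoc, ← pow_succ, Nat.sub_add_cancel h0]
    have h5 : L * a ^ (L - 1) * b * (a * (p.pderiv j).eval x ^ 2)
      = L * a ^ L * b * (p.pderiv j).eval x ^ 2 := by rw [← h4]; ring
    rw [Nat.add_sub_cancel, mul_add, mul_add (L * a ^ (L - 1) * b), h5]
    push_cast
    rw [pow_succ]
    linarith

end

end GlauberMRF

namespace GlauberMRF

noncomputable section

open Matrix

/-! ### Isolating one coefficient block by block -/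

/-- The inverse of 1 - x is 1 + x/(1 - x) ≤ exp(x/(1 - x)), and (L - 1)x ≤ 1 - x, so the inverse
power is at most e ≤ 3. -/
theorem one_third_le_one_sub_pow {x : ℝ} (hx : x < 1) (hx0 : 0 ≤ x) {L : ℕ}
    (hL : 1 ≤ L) (h : L * x ≤ 1) : 1 / 3 ≤ (1 - x) ^ (L - 1) := by
  have h1 : 0 < 1 - x := by linarith
  have h2 : (1 - x) * (x / (1 - x) + 1) = 1 := by field_simp; ring
  have h3 : ((L - 1 : ℕ) : ℝ) * (x / (1 - x)) ≤ 1 := by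
    rw [Nat.cast_sub hL, mul_div_assoc', div_le_one h1]
    push_cast
    linarith
  have h4 : (x / (1 - x) + 1) ^ (L - 1) ≤ 3 := by
    calc _ ≤ Real.exp (x / (1 - x)) ^ (L - 1) :=
          pow_le_pow_left₀ (by positivity) (Real.add_one_le_exp _) _
      _ = Real.exp (((L - 1 : ℕ) : ℝ) * (x / (1 - x))) := by rw [Real.exp_nat_mul]
      _ ≤ Real.exp 1 := Real.exp_le_exp.2 h3
      _ ≤ 3 := Real.exp_one_lt_d9.le.trans (by norm_num)
  have h5 : (1 - x) ^ (L - 1) * (x / (1 - x) + 1) ^ (L - 1) = 1 := by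
    rw [← mul_pow, h2, one_pow]
  have h6 : 0 < (1 - x) ^ (L - 1) := by positivity
  nlinarith

/-- With blocks of ⌊n/D⌋ steps, the number of possible times divided by n is at least 1/(2D), and
the chance of no other update in N is at least 1/3. -/
theorem le_block_weight {n D : ℕ} (hD : 0 < D) (hDn : D < n) {c : ℝ} (hc : 0 ≤ c) :
    c / (6 * D) ≤ ((n / D : ℕ) : ℝ) * (1 - D / (n : ℝ)) ^ (n / D - 1) * (c / n) := by
  have hn : (0 : ℝ) < n := by exact_mod_cast hD.trans hDn
  have hD' : (0 : ℝ) < D := by exact_mod_cast hD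
  have hL : 1 ≤ n / D := (Nat.one_le_div_iff hD).2 hDn.le
  have h1 : ((n / D : ℕ) : ℝ) * (D / n) ≤ 1 := by
    rw [mul_div_assoc', div_le_one hn]
    exact_mod_cast Nat.div_mul_le_self n D
  have h2 := one_third_le_one_sub_pow (x := D / n) (by rw [div_lt_one hn]; exact_mod_cast hDn)
    (by positivity) hL h1
  have h3 : (n : ℝ) ≤ 2 * D * (n / D : ℕ) := by
    have := Nat.lt_mul_div_succ n hD
    have h4 : D * (n / D + 1) ≤ 2 * D * (n / D) := by nlinarith
    exact_mod_cast this.le.trans h4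
  calc c / (6 * D) = (1 / (2 * D)) * (1 / 3) * c := by field_simp; ring
    _ ≤ ((n / D : ℕ) / n) * (1 - D / (n : ℝ)) ^ (n / D - 1) * c := by
        refine mul_le_mul_of_nonneg_right (mul_le_mul ?_ h2 (by norm_num) (by positivity)) hc
        rw [div_le_div_iff₀ (by positivity) hn]
        linarith
    _ = _ := by ring

/-- The last block resamples one variable j of S and replaces p by its j-derivative at the cost of
one factor; the earlier blocks treat the remaining variables by induction. The maximum with 0 makes
squaring monotone when the supersets outweigh the coefficient of S. -/
theorem le_stepMat_blocks_mulVec_sq {n : ℕ} {ψ : MPoly n} {N : Finset (Fin n)} {lam : ℝ}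
    (hN : N.card < n) (h : ∀ j, (ψ.pderiv j).l1Norm ≤ lam) (S : Finset (Fin n)) (hS : S ⊆ N) :
    ∀ (p : MPoly n), p.VarsIn N → ∀ x : Config n,
    (Real.exp (-(2 * lam)) / (6 * N.card)) ^ S.card
        * (max 0 (|p S| - ∑ T ∈ Finset.univ.filter (fun T => S ⊂ T), |p T|)) ^ 2
      ≤ (stepMat ψ Finset.univ ^ ((n / N.card) * S.card) *ᵥ fun x => p.eval x ^ 2) x := by
  induction S using Finset.induction_on with
  | empty =>
    intro p hp x
    simp only [Finset.card_empty, pow_zero, one_mul, mul_zero, Matrix.one_mulVec]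
    rw [← sq_abs (p.eval x)]
    exact pow_le_pow_left₀ (le_max_left _ _)
      (max_le (abs_nonneg _) (p.abs_coeff_empty_sub_le x)) 2
  | insert j S hj ih =>
    intro p hp x
    have hjN : j ∈ N := hS (Finset.mem_insert_self j S)
    have hD : 0 < N.card := Finset.card_pos.2 ⟨j, hjN⟩
    set c := Real.exp (-(2 * lam)) with hc
    set w := c / (6 * N.card) with hw
    have hw0 : 0 ≤ w := by positivity
    rw [Finset.card_insert_of_notMem hj, mul_add, mul_one,
      pow_add (stepMat ψ Finset.univ), ← Matrix.mulVec_mulVec]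
    have h1 : (fun x => w * (p.pderiv j).eval x ^ 2) ≤
        stepMat ψ Finset.univ ^ (n / N.card) *ᵥ fun x => p.eval x ^ 2 := by
      intro z
      refine le_trans ?_ (le_stepMat_pow_mulVec_sq hp hjN (h j) (n / N.card) z)
      have h2 := mul_le_mul_of_nonneg_right (le_block_weight hD hN (Real.exp_pos (-(2 * lam))).le)
        (sq_nonneg ((p.pderiv j).eval z))
      have h3 : 0 ≤ (1 - N.card / (n : ℝ)) ^ (n / N.card) * p.eval z ^ 2 := by
        refine mul_nonneg (pow_nonneg ?_ _) (sq_nonneg _)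
        rw [sub_nonneg, div_le_one (by exact_mod_cast hD.trans hN)]
        exact_mod_cast hN.le
      linarith
    refine le_trans ?_ (EntryNonneg.mulVec_mono
      (EntryNonneg.pow (stepMat_nonneg ψ Finset.univ) _) h1 x)
    have h4 : (fun x => w * (p.pderiv j).eval x ^ 2) = w • fun x => (p.pderiv j).eval x ^ 2 := rfl
    rw [h4, Matrix.mulVec_smul, Pi.smul_apply, smul_eq_mul, pow_succ' w, mul_assoc]
    refine mul_le_mul_of_nonneg_left (le_trans ?_
      (ih ((Finset.subset_insert j S).trans hS) _ (hp.pderiv j) x)) hw0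
    refine mul_le_mul_of_nonneg_left (pow_le_pow_left₀ (le_max_left _ _)
      (max_le_max le_rfl ?_) 2) (by positivity)
    have h5 : p.pderiv j S = p (insert j S) := by simp [MPoly.pderiv, hj]
    rw [h5]
    exact sub_le_sub_left (p.sum_abs_pderiv_ssuperset_le hj) _

/-- Only trajectories without updates of N in the waiting phase are kept, and the final update of i
∉ N leaves p unchanged. The factor in s is geometric; its sum in `le_sampleKernel_mulVec_sq` is the
probability that i is updated before all of N. -/
theorem le_sampleMat_mulVec_sq {n : ℕ} (ψ : MPoly n) {i : Fin n} {N : Finset (Fin n)}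
    (hi : i ∉ N) {p : MPoly n} (hp : p.VarsIn N) (w s : ℕ) (x : Config n) :
    (1 / n : ℝ) * (1 - (1 + N.card) / (n : ℝ)) ^ s
        * (stepMat ψ Finset.univ ^ w *ᵥ fun x => p.eval x ^ 2) x
      ≤ (sampleMat ψ i w s *ᵥ fun x => p.eval x ^ 2) x := by
  have hn : (0 : ℝ) < n := Nat.cast_pos.2 i.pos
  set a := 1 - (1 + N.card) / (n : ℝ) with ha
  have hcard : (insert i N).card = N.card + 1 := Finset.card_insert_of_notMem hi
  have hc : ((({i}ᶜ : Finset (Fin n)) \ N).card / (n : ℝ)) = a := by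
    have h1 : ({i}ᶜ : Finset (Fin n)) \ N = (insert i N)ᶜ := by
      ext l; simp
    rw [h1, Finset.card_compl, Nat.cast_sub (Finset.card_le_univ _), Fintype.card_fin, hcard, ha]
    push_cast
    field_simp
    ring
  have ha0 : 0 ≤ a := by rw [← hc]; positivity
  have h1 : (1 / n : ℝ) • (fun x => p.eval x ^ 2) ≤ stepMat ψ {i} *ᵥ fun x => p.eval x ^ 2 := by
    intro z
    have := le_stepMat_mulVec_sq ψ {i} hp z
    rwa [Finset.sdiff_eq_self_of_disjoint (Finset.disjoint_singleton_left.2 hi),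
      Finset.card_singleton, Nat.cast_one] at this
  have h2 : ∀ s, a ^ s • (fun x => p.eval x ^ 2)
      ≤ stepMat ψ {i}ᶜ ^ s *ᵥ fun x => p.eval x ^ 2 := by
    intro s
    induction s with
    | zero => simp
    | succ s ih =>
      rw [pow_succ' (stepMat ψ {i}ᶜ), ← Matrix.mulVec_mulVec]
      refine le_trans ?_ (EntryNonneg.mulVec_mono (stepMat_nonneg ψ _) ih)
      rw [Matrix.mulVec_smul, pow_succ, mul_smul]
      refine smul_le_smul_of_nonneg_left (fun z => ?_) (pow_nonneg ha0 s)
      have := le_stepMat_mulVec_sq ψ {i}ᶜ hp z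
      rwa [hc] at this
  have h3 : ((1 / n : ℝ) * a ^ s) • (fun x => p.eval x ^ 2)
      ≤ stepMat ψ {i}ᶜ ^ s *ᵥ (stepMat ψ {i} *ᵥ fun x => p.eval x ^ 2) := by
    refine le_trans ?_ (EntryNonneg.mulVec_mono (EntryNonneg.pow (stepMat_nonneg ψ _) s) h1)
    rw [Matrix.mulVec_smul, mul_smul]
    exact smul_le_smul_of_nonneg_left (h2 s) (by positivity)
  have h4 := EntryNonneg.mulVec_mono (EntryNonneg.pow (stepMat_nonneg ψ Finset.univ) w) h3 x
  rw [Matrix.mulVec_smul] at h4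
  rw [sampleMat_mulVec]
  exact h4

theorem le_sampleKernel_mulVec_sq {n : ℕ} (ψ : MPoly n) {i : Fin n} {N : Finset (Fin n)}
    (hi : i ∉ N) {p : MPoly n} (hp : p.VarsIn N) (w : ℕ) (x : Config n) :
    1 / (1 + N.card : ℝ) * (stepMat ψ Finset.univ ^ w *ᵥ fun x => p.eval x ^ 2) x
      ≤ (sampleKernel ψ i w *ᵥ fun x => p.eval x ^ 2) x := by
  have hn : (0 : ℝ) < n := Nat.cast_pos.2 i.pos
  set a := 1 - (1 + N.card) / (n : ℝ) with ha
  have ha0 : 0 ≤ a := by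
    have hcard : (insert i N).card = N.card + 1 := Finset.card_insert_of_notMem hi
    have : N.card + 1 ≤ n := by
      rw [← hcard]; exact (Finset.card_le_univ _).trans_eq (Fintype.card_fin n)
    rw [ha, sub_nonneg, div_le_one hn, add_comm]
    exact_mod_cast this
  have ha1 : a < 1 := by rw [ha]; linarith [show 0 < (1 + N.card) / (n : ℝ) by positivity]
  have h1 := ((hasSum_geometric_of_lt_one ha0 ha1).mul_left (1 / n : ℝ)).mul_right
    ((stepMat ψ Finset.univ ^ w *ᵥ fun x => p.eval x ^ 2) x)
  have h2 := hasSum_le (fun s => le_sampleMat_mulVec_sq ψ hi hp w s x) h1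
    (hasSum_sampleKernel_mulVec ψ i w _ x)
  have h3 : (1 / n : ℝ) * (1 - a)⁻¹ = 1 / (1 + N.card : ℝ) := by
    rw [ha, sub_sub_cancel]; field_simp
  rwa [h3] at h2

/-! ### From single coefficients to the maximal coefficient -/

/-- The sets of at most `k` variables in `N`. -/
def monos {n : ℕ} (N : Finset (Fin n)) (k : ℕ) : Finset (Finset (Fin n)) :=
  N.powerset.filter fun S => S.card ≤ k

theorem mem_monos {n : ℕ} {N S : Finset (Fin n)} {k : ℕ} :
    S ∈ monos N k ↔ S ⊆ N ∧ S.card ≤ k := by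
  simp [monos]

theorem card_monos_le {n : ℕ} {N : Finset (Fin n)} {d : ℕ} (hd : N.card ≤ d) (k : ℕ) :
    (monos N k).card ≤ (d + 1) ^ k := by
  induction k with
  | zero =>
    have : monos N 0 ⊆ {∅} := fun S hS => by simpa [monos] using (mem_monos.1 hS).2
    simpa using Finset.card_le_card this
  | succ k ih =>
    have h1 : monos N (k + 1) ⊆ monos N k ∪ N.powersetCard (k + 1) := by
      intro S hS
      rw [mem_monos] at hS
      rw [Finset.mem_union, mem_monos, Finset.mem_powersetCard]
      rcases Nat.lt_or_ge S.card (k + 1) with h | h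
      · exact Or.inl ⟨hS.1, by omega⟩
      · exact Or.inr ⟨hS.1, by omega⟩
    have h2 : (N.powersetCard (k + 1)).card ≤ d ^ (k + 1) := by
      rw [Finset.card_powersetCard]
      exact (Nat.choose_le_pow _ _).trans (Nat.pow_le_pow_left hd _)
    have h3 : d ^ (k + 1) ≤ d * (d + 1) ^ k := by
      rw [pow_succ']
      exact Nat.mul_le_mul_left d (Nat.pow_le_pow_left (Nat.le_succ d) k)
    calc _ ≤ _ := Finset.card_le_card h1
      _ ≤ _ := Finset.card_union_le _ _
      _ ≤ (d + 1) ^ k + d * (d + 1) ^ k := by omega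
      _ = (d + 1) ^ (k + 1) := by ring

/-- Descending induction on the size of S: maximal sets have no supersets in F, and each lower layer
costs a factor 1 + B, since at most B supersets contribute. -/
theorem MPoly.abs_coeff_le_of_top_down {n k : ℕ} {p : MPoly n} {F : Finset (Finset (Fin n))}
    {B M : ℝ} (hF : ∀ S, p S ≠ 0 → S ∈ F) (hk : ∀ S ∈ F, S.card ≤ k) (hB : F.card ≤ B)
    (hM : 0 ≤ M)
    (h : ∀ S ∈ F, |p S| ≤ M + ∑ T ∈ Finset.univ.filter (fun T => S ⊂ T), |p T|)
    (S : Finset (Fin n)) : |p S| ≤ M * (1 + B) ^ k := by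
  have hB0 : 0 ≤ B := (Nat.cast_nonneg _).trans hB
  suffices H : ∀ m S, k ≤ S.card + m → |p S| ≤ M * (1 + B) ^ m from H k S (by omega)
  intro m
  induction m with
  | zero =>
    intro S hS
    by_cases hSF : S ∈ F
    · refine (h S hSF).trans (le_of_eq ?_)
      rw [Finset.sum_eq_zero]
      · simp
      · intro T hT
        have h1 := Finset.card_lt_card (Finset.mem_filter.1 hT).2
        by_contra h2
        have := hk T (hF T fun h0 => h2 (by rw [h0, abs_zero]))
        omega
    · have : p S = 0 := by_contra fun h0 => hSF (hF S h0)
      simpa [this] using hM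
  | succ m ih =>
    intro S hS
    have h0 : 0 ≤ M * (1 + B) ^ m := by positivity
    by_cases hSF : S ∈ F
    · have h1 : ∑ T ∈ Finset.univ.filter (fun T => S ⊂ T), |p T| ≤ B * (M * (1 + B) ^ m) := by
        calc _ ≤ ∑ T ∈ F, (M * (1 + B) ^ m) := by
              rw [← Finset.sum_filter_add_sum_filter_not (Finset.univ.filter (fun T => S ⊂ T))
                (fun T => T ∈ F)]
              rw [Finset.sum_eq_zero (s := Finset.filter (fun T => ¬ T ∈ F) _), add_zero]
              · refine (Finset.sum_le_sum fun T hT => ih T ?_).trans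
                  (Finset.sum_le_sum_of_subset_of_nonneg
                    (fun T hT => (Finset.mem_filter.1 hT).2) fun _ _ _ => h0)
                have := Finset.card_lt_card (Finset.mem_filter.1 (Finset.mem_filter.1 hT).1).2
                omega
              · intro T hT
                by_contra h2
                exact (Finset.mem_filter.1 hT).2 (hF T fun h0 => h2 (by rw [h0, abs_zero]))
          _ = F.card * (M * (1 + B) ^ m) := by rw [Finset.sum_const, nsmul_eq_mul]
          _ ≤ _ := mul_le_mul_of_nonneg_right hB h0
      have h2 : M ≤ M * (1 + B) ^ m :=
        le_mul_of_one_le_right hM (one_le_pow₀ (by linarith))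
      calc _ ≤ _ := h S hSF
        _ ≤ M * (1 + B) ^ m + B * (M * (1 + B) ^ m) := add_le_add h2 h1
        _ = _ := by ring
    · have : p S = 0 := by_contra fun h0 => hSF (hF S h0)
      rw [this, abs_zero]
      positivity

/-- The constant in the lower bound for the second moment of a polynomial at the next sample. -/
def spread (d k : ℕ) (lam : ℝ) : ℝ :=
  1 / (1 + d) * (Real.exp (-(2 * lam)) / (6 * d)) ^ k / (1 + (d + 1) ^ k) ^ (2 * k)

/-- The three factors of `spread` have three sources: i is updated before N, at most k blocks
isolate a coefficient, and the top-down elimination costs (1 + B)^k, which is squared because second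
moments are compared. -/
theorem spread_mul_supNorm_sq_le {n d k : ℕ} {ψ : MPoly n} {lam : ℝ} {i : Fin n}
    {N : Finset (Fin n)} (hd : 1 ≤ d) (hlam : 0 ≤ lam) (hi : i ∉ N) (hN : N.card ≤ d)
    (h : ∀ j, (ψ.pderiv j).l1Norm ≤ lam) {p : MPoly n} (hp : p.VarsIn N) (hk : p.DegreeLE k)
    {w : ℕ} (hw : n ≤ w) (x : Config n) :
    spread d k lam * p.supNorm ^ 2 ≤ (sampleKernel ψ i w *ᵥ fun x => p.eval x ^ 2) x := by
  have hd' : (1 : ℝ) ≤ d := by exact_mod_cast hd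
  have hNn : N.card < n := by
    have hcard : (insert i N).card = N.card + 1 := Finset.card_insert_of_notMem hi
    have := (Finset.card_le_univ (insert i N)).trans_eq (Fintype.card_fin n)
    omega
  set c := Real.exp (-(2 * lam)) with hc
  have hc1 : c ≤ 1 := Real.exp_le_one_iff.2 (by linarith)
  have hc0 : 0 < c := Real.exp_pos _
  set g := 1 / (1 + d : ℝ) * (c / (6 * d)) ^ k with hg
  have hg0 : 0 < g := by positivity
  set V := (sampleKernel ψ i w *ᵥ fun x => p.eval x ^ 2) x with hV
  have key : ∀ S ∈ monos N k,
      g * (max 0 (|p S| - ∑ T ∈ Finset.univ.filter (fun T => S ⊂ T), |p T|)) ^ 2 ≤ V := by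
    intro S hS
    obtain ⟨hSN, hSk⟩ := mem_monos.1 hS
    set β := max 0 (|p S| - ∑ T ∈ Finset.univ.filter (fun T => S ⊂ T), |p T|)
    refine le_trans ?_ (le_sampleKernel_mulVec_sq ψ hi hp w x)
    -- All blocks together take at most n steps since |S| ≤ |N|; this is why w ≥ n free steps
    -- suffice.
    have hL : (n / N.card) * S.card ≤ w :=
      (Nat.mul_le_mul_left _ (Finset.card_le_card hSN)).trans ((Nat.div_mul_le_self _ _).trans hw)
    have h1 : (c / (6 * d)) ^ k * β ^ 2 ≤
        (stepMat ψ Finset.univ ^ w *ᵥ fun x => p.eval x ^ 2) x := by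
      -- The r surplus steps are placed before the blocks. They cost nothing, as the block bound
      -- holds from every state and the full transition matrix preserves constants.
      obtain ⟨r, hr⟩ := Nat.exists_eq_add_of_le' hL
      rw [hr, pow_add, ← Matrix.mulVec_mulVec]
      refine le_trans ?_ (EntryNonneg.mulVec_mono
        (EntryNonneg.pow (stepMat_nonneg ψ Finset.univ) r) (f := fun _ => (c / (6 * d)) ^ k * β ^ 2)
        (fun z => le_trans ?_ (le_stepMat_blocks_mulVec_sq hNn h S hSN p hp z)) x)
      · rw [stepMat_univ_pow_mulVec_const i.pos.ne']
      · refine mul_le_mul_of_nonneg_right ?_ (sq_nonneg _)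
        have h2 : c / (6 * d) ≤ 1 := by
          rw [div_le_one (by positivity)]; linarith
        refine (pow_le_pow_of_le_one (by positivity) h2 hSk).trans ?_
        rcases Finset.eq_empty_or_nonempty S with rfl | hne
        · simp
        · have hN0 : 0 < N.card := Finset.card_pos.2 (hne.mono hSN)
          have : (0 : ℝ) < N.card := by exact_mod_cast hN0
          refine pow_le_pow_left₀ (by positivity) ?_ _
          gcongr
    have h3 : 1 / (1 + d : ℝ) ≤ 1 / (1 + N.card : ℝ) := by gcongr
    calc g * β ^ 2 = 1 / (1 + d : ℝ) * ((c / (6 * d)) ^ k * β ^ 2) := by rw [hg]; ring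
      _ ≤ _ := mul_le_mul h3 h1 (by positivity) (by positivity)
  have hV0 : 0 ≤ V := le_trans (by positivity) (key ∅ (mem_monos.2 (by simp)))
  have hM : ∀ S ∈ monos N k,
      |p S| ≤ Real.sqrt (V / g) + ∑ T ∈ Finset.univ.filter (fun T => S ⊂ T), |p T| := by
    intro S hS
    have h1 := key S hS
    have h2 : |p S| - ∑ T ∈ Finset.univ.filter (fun T => S ⊂ T), |p T| ≤ Real.sqrt (V / g) := by
      refine (le_max_right 0 _).trans (Real.le_sqrt_of_sq_le ?_)
      rw [le_div_iff₀ hg0]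
      linarith
    linarith
  have h1 := MPoly.abs_coeff_le_of_top_down (k := k) (B := (d + 1) ^ k)
    (fun S hS => mem_monos.2 ⟨hp S hS, hk S hS⟩) (fun S hS => (mem_monos.1 hS).2)
    (by exact_mod_cast card_monos_le hN k) (Real.sqrt_nonneg _) hM
  have h2 := (p.supNorm_le_iff _).2 h1
  have h3 := pow_le_pow_left₀ p.supNorm_nonneg h2 2
  rw [mul_pow, Real.sq_sqrt (by positivity), ← pow_mul, mul_comm k 2] at h3
  have h4 : (0 : ℝ) < (1 + (d + 1) ^ k) ^ (2 * k) := by positivity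
  calc _ = g / (1 + (d + 1) ^ k) ^ (2 * k) * p.supNorm ^ 2 := by rw [spread, hg]
    _ ≤ g / (1 + (d + 1) ^ k) ^ (2 * k) * (V / g * (1 + (d + 1) ^ k) ^ (2 * k)) :=
        mul_le_mul_of_nonneg_left h3 (by positivity)
    _ = V := by field_simp

end

end GlauberMRF

namespace GlauberMRF

noncomputable section

open Matrix MeasureTheory

/-! ### The Markov property -/

section Markov

variable {Ω : Type*} {n : ℕ}

/-- The event `A` depends only on the history up to time `t`. -/
def Adapted (X : ℕ → Ω → Config n) (U : ℕ → Ω → Fin n) (t : ℕ) (A : Set Ω) : Prop :=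
  ∀ ω ω', (∀ s, s ≤ t → X s ω = X s ω') → (∀ s, 1 ≤ s → s ≤ t → U s ω = U s ω') →
    ω ∈ A → ω' ∈ A

/-- The history up to time `t`, as an element of a finite type. -/
def historyCode (X : ℕ → Ω → Config n) (U : ℕ → Ω → Fin n) (t : ℕ) (ω : Ω) :
    (Fin (t + 1) → Config n) × (Fin t → Fin n) :=
  (fun s => X s ω, fun s => U (s + 1) ω)

theorem mem_history_iff_historyCode_eq (X : ℕ → Ω → Config n) (U : ℕ → Ω → Fin n) (t : ℕ)
    (ω ω₀ : Ω) : ω ∈ history X U t (fun s => X s ω₀) (fun s => U s ω₀) ↔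
      historyCode X U t ω = historyCode X U t ω₀ := by
  unfold history historyCode
  rw [Prod.ext_iff, funext_iff, funext_iff]
  constructor
  · rintro ⟨h1, h2⟩
    exact ⟨fun s => h1 s (by omega), fun s => h2 _ (by omega) (by omega)⟩
  · rintro ⟨h1, h2⟩
    refine ⟨fun s hs => h1 ⟨s, by omega⟩, fun s hs hs' => ?_⟩
    have := h2 ⟨s - 1, by omega⟩
    simpa [Nat.sub_add_cancel hs] using this

/-- The event that the `m`-th sample time is `t` and that the first `m` samples, preceded by the
initial configuration, are `y 0, …, y m`. Consecutive sample times are separated by `w` free steps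
and the waiting time for an update of `i`. -/
def sampleEvent (X : ℕ → Ω → Config n) (U : ℕ → Ω → Fin n) (i : Fin n) (w : ℕ)
    (y : ℕ → Config n) : ℕ → ℕ → Set Ω
  | 0, t => {ω | t = 0 ∧ X 0 ω = y 0}
  | m + 1, t' => {ω | ∃ t s, t' = t + (w + s + 1) ∧ ω ∈ sampleEvent X U i w y m t ∧
      (∀ r < s, U (t + w + r + 1) ω ≠ i) ∧ U t' ω = i ∧ X t' ω = y (m + 1)}

theorem config_of_mem_sampleEvent {X : ℕ → Ω → Config n} {U : ℕ → Ω → Fin n} {i : Fin n}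
    {w : ℕ} {y : ℕ → Config n} {m t : ℕ} {ω : Ω}
    (h : ω ∈ sampleEvent X U i w y m t) : X t ω = y m := by
  cases m with
  | zero => rw [h.1]; exact h.2
  | succ m => obtain ⟨_, _, _, _, _, _, h⟩ := h; exact h

/-- The sample times are stopping times. This is what allows the Markov property to be restarted at
each of them. -/
theorem adapted_sampleEvent (X : ℕ → Ω → Config n) (U : ℕ → Ω → Fin n) (i : Fin n) (w : ℕ)
    (y : ℕ → Config n) (m t : ℕ) : Adapted X U t (sampleEvent X U i w y m t) := by
  induction m generalizing t with
  | zero =>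
    rintro ω ω' h1 - ⟨h3, h4⟩
    exact ⟨h3, by rw [← h1 0 (by omega), h4]⟩
  | succ m ih =>
    rintro ω ω' h1 h2 ⟨t₀, s, rfl, h3, h4, h5, h6⟩
    refine ⟨t₀, s, rfl, ih t₀ ω ω' (fun r hr => h1 r (by omega))
      (fun r hr hr' => h2 r hr (by omega)) h3, fun r hr => ?_, ?_, ?_⟩
    · rw [← h2 _ (by omega) (by omega)]; exact h4 r hr
    · rw [← h2 _ (by omega) le_rfl]; exact h5
    · rw [← h1 _ le_rfl]; exact h6

variable [MeasurableSpace Ω] {ψ : MPoly n} {P : Measure Ω} {X : ℕ → Ω → Config n}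
  {U : ℕ → Ω → Fin n}

theorem IsGlauber.measurableSet_history (hG : IsGlauber ψ P X U) (t : ℕ) (x : ℕ → Config n)
    (u : ℕ → Fin n) : MeasurableSet (history X U t x u) := by
  have : history X U t x u = (⋂ s, ⋂ (_ : s ≤ t), {ω | X s ω = x s}) ∩
      ⋂ s, ⋂ (_ : 1 ≤ s), ⋂ (_ : s ≤ t), {ω | U s ω = u s} := by
    ext ω; simp [history]
  rw [this]
  exact (MeasurableSet.iInter fun s => MeasurableSet.iInter fun _ => hG.measurable_config s _).inter
    (MeasurableSet.iInter fun s => MeasurableSet.iInter fun _ => MeasurableSet.iInter fun _ =>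
      hG.measurable_site s _)

/-- Only the finitely many history cells have to be measurable, so A may be any set; no
measurability of adapted events is needed later. -/
theorem IsGlauber.sum_measure_inter_historyCode (hG : IsGlauber ψ P X U) (t : ℕ) (A : Set Ω) :
    ∑ c, P (historyCode X U t ⁻¹' {c} ∩ A) = P A := by
  have hm : ∀ c, MeasurableSet (historyCode X U t ⁻¹' {c}) := by
    intro c
    by_cases h : ∃ ω₀, historyCode X U t ω₀ = c
    · obtain ⟨ω₀, rfl⟩ := h
      convert hG.measurableSet_history t (fun s => X s ω₀) (fun s => U s ω₀) using 1
      ext ω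
      rw [mem_history_iff_historyCode_eq]
      rfl
    · convert MeasurableSet.empty
      ext ω
      simp only [Set.mem_preimage, Set.mem_singleton_iff, Set.mem_empty_iff_false, iff_false]
      exact fun h' => h ⟨ω, h'⟩
  have := sum_measure_preimage_singleton (μ := P.restrict A) Finset.univ
    (f := historyCode X U t) (fun c _ => hm c)
  simp only [Finset.coe_univ, Set.preimage_univ, Measure.restrict_apply_univ] at this
  rw [← this]
  exact Finset.sum_congr rfl fun c _ => (Measure.restrict_apply (hm c)).symm

/-- An adapted event is a union of full history cells, and on each cell the defining property of the
dynamics applies. -/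
theorem IsGlauber.measure_step (hG : IsGlauber ψ P X U) {t : ℕ} {A : Set Ω}
    (hA : Adapted X U t A) {x : Config n} (hx : ∀ ω ∈ A, X t ω = x) (j : Fin n) (y : Config n) :
    P (A ∩ {ω | U (t + 1) ω = j ∧ X (t + 1) ω = y})
      = P A * ENNReal.ofReal (stepProb ψ x j y) := by
  rw [← hG.sum_measure_inter_historyCode t A, ← hG.sum_measure_inter_historyCode t (A ∩ _),
    Finset.sum_mul]
  refine Finset.sum_congr rfl fun c _ => ?_
  by_cases h : ∃ ω₀ ∈ A, historyCode X U t ω₀ = c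
  · obtain ⟨ω₀, h₀, rfl⟩ := h
    have h1 : historyCode X U t ⁻¹' {historyCode X U t ω₀} ∩ A
        = history X U t (Function.update (fun s => X s ω₀) (t + 1) y)
          (Function.update (fun s => U s ω₀) (t + 1) j) := by
      have h2 : historyCode X U t ⁻¹' {historyCode X U t ω₀} ∩ A
          = history X U t (fun s => X s ω₀) (fun s => U s ω₀) := by
        ext ω
        rw [mem_history_iff_historyCode_eq]
        refine ⟨fun h => h.1, fun h => ⟨h, ?_⟩⟩
        rw [← mem_history_iff_historyCode_eq] at h
        exact hA ω₀ ω (fun s hs => (h.1 s hs).symm) (fun s hs hs' => (h.2 s hs hs').symm) h₀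
      rw [h2]
      ext ω
      refine and_congr (forall₂_congr fun s hs => ?_)
        (forall₃_congr fun s hs hs' => ?_) <;>
      rw [Function.update_of_ne (by omega)]
    have h3 := hG.step t (Function.update (fun s => X s ω₀) (t + 1) y)
          (Function.update (fun s => U s ω₀) (t + 1) j)
    rw [← h1, Function.update_self, Function.update_self, Function.update_of_ne (by omega),
      hx ω₀ h₀] at h3
    rw [← h3, ← Set.inter_assoc, h1]
    congr 1
    ext ω
    constructor
    · rintro ⟨⟨h4, h5⟩, h6, h7⟩
      refine ⟨fun s hs => ?_, fun s hs hs' => ?_⟩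
      · rcases Nat.lt_or_ge t s with h8 | h8
        · obtain rfl : s = t + 1 := by omega
          rw [h7, Function.update_self]
        · exact h4 s h8
      · rcases Nat.lt_or_ge t s with h8 | h8
        · obtain rfl : s = t + 1 := by omega
          rw [h6, Function.update_self]
        · exact h5 s hs h8
    · rintro ⟨h4, h5⟩
      refine ⟨⟨fun s hs => h4 s (by omega), fun s hs hs' => h5 s hs (by omega)⟩, ?_, ?_⟩
      · simpa using h5 (t + 1) (by omega) le_rfl
      · simpa using h4 (t + 1) le_rfl
  · have h1 : historyCode X U t ⁻¹' {c} ∩ A = ∅ := by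
      ext ω
      simp only [Set.mem_inter_iff, Set.mem_preimage, Set.mem_singleton_iff,
        Set.mem_empty_iff_false, iff_false]
      exact fun h' => h ⟨ω, h'.2, h'.1⟩
    rw [← Set.inter_assoc, h1]
    simp

/-- The product of the transition matrices of the dynamics restricted to the sites `J 0`,
`J 1`, … -/
def prodMat (ψ : MPoly n) (J : ℕ → Finset (Fin n)) : ℕ → Matrix (Config n) (Config n) ℝ
  | 0 => 1
  | s + 1 => prodMat ψ J s * stepMat ψ (J s)

theorem prodMat_nonneg (ψ : MPoly n) (J : ℕ → Finset (Fin n)) (s : ℕ) :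
    EntryNonneg (prodMat ψ J s) := by
  induction s with
  | zero =>
    have := EntryNonneg.pow (stepMat_nonneg ψ ∅) 0
    rwa [pow_zero] at this
  | succ s ih => exact ih.mul (stepMat_nonneg ψ _)

theorem prodMat_add (ψ : MPoly n) (J : ℕ → Finset (Fin n)) (a b : ℕ) :
    prodMat ψ J (a + b) = prodMat ψ J a * prodMat ψ (fun r => J (a + r)) b := by
  induction b with
  | zero => simp [prodMat]
  | succ b ih => rw [← add_assoc, prodMat, ih, prodMat, Matrix.mul_assoc]

theorem prodMat_eq_pow (ψ : MPoly n) {J : ℕ → Finset (Fin n)} {J₀ : Finset (Fin n)} {s : ℕ}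
    (h : ∀ r < s, J r = J₀) : prodMat ψ J s = stepMat ψ J₀ ^ s := by
  induction s with
  | zero => simp [prodMat]
  | succ s ih => rw [prodMat, ih fun r hr => h r (by omega), h s (by omega), pow_succ]

/-- An upper bound is all that the concentration argument requires, so subadditivity replaces a
disjoint decomposition over intermediate states. -/
theorem IsGlauber.measure_steps_le (hG : IsGlauber ψ P X U) {t : ℕ} {A : Set Ω}
    (hA : Adapted X U t A) {x : Config n} (hx : ∀ ω ∈ A, X t ω = x) (J : ℕ → Finset (Fin n))
    (s : ℕ) (y : Config n) :
    P (A ∩ {ω | (∀ r < s, U (t + r + 1) ω ∈ J r) ∧ X (t + s) ω = y})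
      ≤ P A * ENNReal.ofReal (prodMat ψ J s x y) := by
  induction s generalizing y with
  | zero =>
    by_cases hxy : x = y
    · subst hxy
      simp only [prodMat, Matrix.one_apply_eq, ENNReal.ofReal_one, mul_one]
      exact measure_mono Set.inter_subset_left
    · have : A ∩ {ω | (∀ r < 0, U (t + r + 1) ω ∈ J r) ∧ X (t + 0) ω = y} = ∅ := by
        ext ω
        simp only [Set.mem_inter_iff, Set.mem_empty_iff_false, iff_false]
        rintro ⟨h1, -, h2⟩
        exact hxy ((hx ω h1).symm.trans h2)
      rw [this]; simp
  | succ s ih =>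
    have hsub : A ∩ {ω | (∀ r < s + 1, U (t + r + 1) ω ∈ J r) ∧ X (t + (s + 1)) ω = y} ⊆
        ⋃ z ∈ (Finset.univ : Finset (Config n)), ⋃ j ∈ J s,
          (A ∩ {ω | (∀ r < s, U (t + r + 1) ω ∈ J r) ∧ X (t + s) ω = z}) ∩
            {ω | U (t + s + 1) ω = j ∧ X (t + s + 1) ω = y} := by
      rintro ω ⟨h1, h2, h3⟩
      simp only [Set.mem_iUnion]
      exact ⟨X (t + s) ω, Finset.mem_univ _, U (t + s + 1) ω, h2 s (by omega),
        ⟨h1, fun r hr => h2 r (by omega), rfl⟩, rfl, h3⟩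
    have had : ∀ z, Adapted X U (t + s)
        (A ∩ {ω | (∀ r < s, U (t + r + 1) ω ∈ J r) ∧ X (t + s) ω = z}) := by
      rintro z ω ω' h1 h2 ⟨h3, h4, h5⟩
      refine ⟨hA ω ω' (fun r hr => h1 r (by omega)) (fun r hr hr' => h2 r hr (by omega)) h3,
        fun r hr => ?_, ?_⟩
      · rw [← h2 _ (by omega) (by omega)]; exact h4 r hr
      · rw [← h1 _ le_rfl]; exact h5
    calc _ ≤ _ := measure_mono hsub
      _ ≤ ∑ z, ∑ j ∈ J s, P ((A ∩ {ω | (∀ r < s, U (t + r + 1) ω ∈ J r) ∧ X (t + s) ω = z}) ∩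
            {ω | U (t + s + 1) ω = j ∧ X (t + s + 1) ω = y}) :=
          (measure_biUnion_finset_le _ _).trans
            (Finset.sum_le_sum fun z _ => measure_biUnion_finset_le _ _)
      _ = ∑ z, P (A ∩ {ω | (∀ r < s, U (t + r + 1) ω ∈ J r) ∧ X (t + s) ω = z}) *
            ENNReal.ofReal (stepMat ψ (J s) z y) := by
          refine Finset.sum_congr rfl fun z _ => ?_
          rw [stepMat, ENNReal.ofReal_sum_of_nonneg fun j _ => stepProb_nonneg _ _ _ _,
            Finset.mul_sum]
          exact Finset.sum_congr rfl fun j _ =>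
            hG.measure_step (had z) (fun ω hω => hω.2.2) j y
      _ ≤ ∑ z, P A * ENNReal.ofReal (prodMat ψ J s x z) *
            ENNReal.ofReal (stepMat ψ (J s) z y) :=
          Finset.sum_le_sum fun z _ => mul_le_mul_left (ih z) _
      _ = P A * ENNReal.ofReal (prodMat ψ J (s + 1) x y) := by
          rw [prodMat, Matrix.mul_apply, ENNReal.ofReal_sum_of_nonneg
            fun z _ => mul_nonneg (prodMat_nonneg _ _ _ _ _) (stepMat_nonneg _ _ _ _),
            Finset.mul_sum]
          refine Finset.sum_congr rfl fun z _ => ?_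
          rw [ENNReal.ofReal_mul (prodMat_nonneg _ _ _ _ _), mul_assoc]

/-! ### Sample times -/

/-- Avoiding i during s steps has probability at most (1 - 1/n)^s. This discards the event on which
`tau` takes its default value `sInf ∅ = 0`. -/
theorem IsGlauber.ae_infinitely_often [IsProbabilityMeasure P] (hG : IsGlauber ψ P X U)
    (i : Fin n) : P {ω | ¬ ∀ t₀, ∃ t, t₀ ≤ t ∧ U t ω = i} = 0 := by
  have hn := one_sub_inv_mem i.pos
  have h0 : {ω | ¬ ∀ t₀, ∃ t, t₀ ≤ t ∧ U t ω = i} ⊆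
      ⋃ t₀ : ℕ, ⋃ x : Config n, {ω | X t₀ ω = x ∧ ∀ t, t₀ ≤ t → U t ω ≠ i} := by
    intro ω hω
    simp only [Set.mem_ofPred_eq, not_forall, not_exists, not_and] at hω
    obtain ⟨t₀, h⟩ := hω
    simp only [Set.mem_iUnion]
    exact ⟨t₀, X t₀ ω, rfl, h⟩
  refine measure_mono_null h0 (measure_iUnion_null fun t₀ => measure_iUnion_null fun x => ?_)
  have hA : Adapted X U t₀ {ω | X t₀ ω = x} := fun ω ω' h1 _ h => by
    simp only [Set.mem_ofPred_eq] at h ⊢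
    rw [← h1 t₀ le_rfl, h]
  have h1 : ∀ s : ℕ, P {ω | X t₀ ω = x ∧ ∀ t, t₀ ≤ t → U t ω ≠ i}
      ≤ ENNReal.ofReal ((1 - 1 / (n : ℝ)) ^ s) := by
    intro s
    have hsub : {ω | X t₀ ω = x ∧ ∀ t, t₀ ≤ t → U t ω ≠ i} ⊆
        ⋃ y ∈ (Finset.univ : Finset (Config n)), {ω | X t₀ ω = x} ∩
          {ω | (∀ r < s, U (t₀ + r + 1) ω ∈ ({i}ᶜ : Finset (Fin n))) ∧ X (t₀ + s) ω = y} := by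
      rintro ω ⟨h1, h2⟩
      simp only [Set.mem_iUnion]
      refine ⟨X (t₀ + s) ω, Finset.mem_univ _, h1, fun r _ => ?_, rfl⟩
      simpa using h2 (t₀ + r + 1) (by omega)
    calc _ ≤ _ := measure_mono hsub
      _ ≤ _ := measure_biUnion_finset_le _ _
      _ ≤ ∑ y, ENNReal.ofReal ((stepMat ψ {i}ᶜ ^ s) x y) := by
          refine Finset.sum_le_sum fun y _ => ?_
          refine (hG.measure_steps_le hA (fun ω hω => hω) (fun _ => {i}ᶜ) s y).trans ?_
          rw [prodMat_eq_pow ψ (fun _ _ => rfl)]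
          exact mul_le_of_le_one_left' prob_le_one
      _ = _ := by
          rw [← ENNReal.ofReal_sum_of_nonneg
            fun y _ => EntryNonneg.pow (stepMat_nonneg ψ _) s x y]
          congr 1
          have := congrFun (stepMat_pow_mulVec_const ψ {i}ᶜ s 1) x
          rw [Fin.card_compl_singleton_div] at this
          simpa [Matrix.mulVec, dotProduct] using this
  have h2 : Filter.Tendsto (fun s : ℕ => ENNReal.ofReal ((1 - 1 / (n : ℝ)) ^ s))
      Filter.atTop (nhds 0) := by
    rw [← ENNReal.ofReal_zero]
    exact ENNReal.tendsto_ofReal (tendsto_pow_atTop_nhds_zero_of_lt_one hn.1 hn.2)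
  exact le_antisymm (ge_of_tendsto' h2 h1) bot_le

theorem IsGlauber.measure_next_sample_le (hG : IsGlauber ψ P X U) {t : ℕ} {A : Set Ω}
    (hA : Adapted X U t A) {x : Config n} (hx : ∀ ω ∈ A, X t ω = x) (i : Fin n) (w s : ℕ)
    (y : Config n) :
    P {ω | ω ∈ A ∧ (∀ r < s, U (t + w + r + 1) ω ≠ i) ∧ U (t + (w + s + 1)) ω = i ∧
        X (t + (w + s + 1)) ω = y} ≤ P A * ENNReal.ofReal (sampleMat ψ i w s x y) := by
  -- The schedule of allowed sites: any site in the free phase, any site but i in the waiting phase,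
  -- then i itself.
  set J : ℕ → Finset (Fin n) := fun r =>
    if r < w then Finset.univ else if r < w + s then {i}ᶜ else {i} with hJ
  have hp : prodMat ψ J (w + s + 1) = sampleMat ψ i w s := by
    rw [prodMat, prodMat_add, sampleMat, prodMat_eq_pow ψ (J₀ := Finset.univ),
      prodMat_eq_pow ψ (J₀ := {i}ᶜ)]
    · simp [hJ]
    · intro r hr; simp [hJ, hr]
    · intro r hr; simp [hJ, hr]
  rw [← hp]
  refine (measure_mono ?_).trans (hG.measure_steps_le hA hx J (w + s + 1) y)
  rintro ω ⟨h1, h2, h3, h4⟩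
  refine ⟨h1, fun r hr => ?_, h4⟩
  simp only [hJ]
  split_ifs with h5 h6
  · exact Finset.mem_univ _
  · obtain ⟨r', rfl⟩ := Nat.exists_eq_add_of_le (not_lt.1 h5)
    have := h2 r' (by omega)
    rw [← add_assoc]
    simpa using this
  · obtain rfl : r = w + s := by omega
    rw [Finset.mem_singleton, ← h3]
    rfl

/-- Summing over the unknown sample time removes it from the bound: previous time and waiting time
determine the new time, and summing over waiting times turns `sampleMat` into `sampleKernel`. -/
theorem IsGlauber.tsum_measure_sampleEvent_le (hG : IsGlauber ψ P X U) (i : Fin n) (w : ℕ)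
    (y : ℕ → Config n) (m : ℕ) :
    ∑' t, P (sampleEvent X U i w y m t) ≤ P {ω | X 0 ω = y 0} *
      ENNReal.ofReal (∏ j ∈ Finset.range m, sampleKernel ψ i w (y j) (y (j + 1))) := by
  induction m with
  | zero =>
    rw [tsum_eq_single 0]
    · simp [sampleEvent]
    · intro t ht
      simp [sampleEvent, ht]
  | succ m ih =>
    set A := sampleEvent X U i w y m with hA
    have h1 : ∀ t', P (sampleEvent X U i w y (m + 1) t') ≤
        ∑' t, ∑' s, if t' = t + (w + s + 1) then
          P (A t) * ENNReal.ofReal (sampleMat ψ i w s (y m) (y (m + 1))) else 0 := by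
      intro t'
      have hsub : sampleEvent X U i w y (m + 1) t' ⊆ ⋃ t, ⋃ s, {ω | t' = t + (w + s + 1) ∧
          ω ∈ A t ∧ (∀ r < s, U (t + w + r + 1) ω ≠ i) ∧ U t' ω = i ∧ X t' ω = y (m + 1)} := by
        rintro ω ⟨t, s, h⟩
        simp only [Set.mem_iUnion]
        exact ⟨t, s, h⟩
      refine (measure_mono hsub).trans ((measure_iUnion_le _).trans (ENNReal.tsum_le_tsum fun t =>
        (measure_iUnion_le _).trans (ENNReal.tsum_le_tsum fun s => ?_)))
      split_ifs with h
      · subst h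
        simp only [true_and]
        exact hG.measure_next_sample_le (adapted_sampleEvent X U i w y m t)
          (fun ω hω => config_of_mem_sampleEvent hω) i w s _
      · simp [h]
    calc _ ≤ ∑' t', ∑' t, ∑' s, (if t' = t + (w + s + 1) then
          P (A t) * ENNReal.ofReal (sampleMat ψ i w s (y m) (y (m + 1))) else 0) :=
          ENNReal.tsum_le_tsum h1
      _ = ∑' t, ∑' s, ∑' t', (if t' = t + (w + s + 1) then
          P (A t) * ENNReal.ofReal (sampleMat ψ i w s (y m) (y (m + 1))) else 0) := by
          rw [ENNReal.tsum_comm]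
          exact tsum_congr fun t => ENNReal.tsum_comm
      _ = ∑' t, P (A t) * ENNReal.ofReal (sampleKernel ψ i w (y m) (y (m + 1))) := by
          refine tsum_congr fun t => ?_
          rw [sampleKernel, ENNReal.ofReal_tsum_of_nonneg
            (fun s => sampleMat_nonneg ψ i w s _ _) (summable_sampleMat ψ i w _ _),
            ← ENNReal.tsum_mul_left]
          exact tsum_congr fun s => tsum_ite_eq _ _
      _ ≤ _ := by
          rw [ENNReal.tsum_mul_right, Finset.prod_range_succ, ENNReal.ofReal_mul
            (Finset.prod_nonneg fun _ _ => sampleKernel_nonneg _ _ _ _ _), ← mul_assoc]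
          exact mul_le_mul_left ih _

/-- The number of free steps after each sample time. -/
def freeSteps (d n : ℕ) : ℕ := ⌈4 * Real.log d * n⌉₊ - 1

/-- Here d ≥ 3 enters: log d ≥ 1, so the prescribed gap exceeds n. The logarithmic factor in the gap
is not exploited further. -/
theorem succ_le_ceil_four_mul_log_mul {d n : ℕ} (hd : 3 ≤ d) (hn : 0 < n) :
    n + 1 ≤ ⌈4 * Real.log d * n⌉₊ := by
  have h1 : 1 ≤ Real.log d := by
    rw [Real.le_log_iff_exp_le (by positivity)]
    have : (3 : ℝ) ≤ d := by exact_mod_cast hd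
    linarith [Real.exp_one_lt_d9]
  have hn' : (1 : ℝ) ≤ n := by exact_mod_cast hn
  have h2 : ((n + 1 : ℕ) : ℝ) ≤ 4 * Real.log d * n := by push_cast; nlinarith
  exact_mod_cast h2.trans (Nat.le_ceil _)

theorem le_freeSteps {d n : ℕ} (hd : 3 ≤ d) (hn : 0 < n) : n ≤ freeSteps d n := by
  have := succ_le_ceil_four_mul_log_mul hd hn
  unfold freeSteps
  omega

/-- The first eligible time is the ceiling of the gap after τ_m, and the update at that time may
already be the sample; hence the free steps number one less than the ceiling. -/
theorem tau_succ_eq {d : ℕ} (hd : 3 ≤ d) (i : Fin n) {u : ℕ → Fin n}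
    (hu : ∀ t₀, ∃ t, t₀ ≤ t ∧ u t = i) (m : ℕ) :
    ∃ s, tau d i u (m + 1) = tau d i u m + (freeSteps d n + s + 1) ∧
      (∀ r < s, u (tau d i u m + freeSteps d n + r + 1) ≠ i) ∧ u (tau d i u (m + 1)) = i := by
  set t := tau d i u m with ht
  have hW : freeSteps d n + 1 = ⌈4 * Real.log d * n⌉₊ := by
    have := succ_le_ceil_four_mul_log_mul hd i.pos
    unfold freeSteps
    omega
  have hiff : ∀ t' : ℕ, ((t : ℝ) + 4 * Real.log d * n ≤ t') ↔ t + (freeSteps d n + 1) ≤ t' := by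
    intro t'
    have h0 : 0 ≤ 4 * Real.log d * n := by
      have := Real.log_natCast_nonneg d
      positivity
    rw [hW, add_comm t, ← Nat.ceil_add_natCast h0 t, Nat.ceil_le, add_comm]
  have hdef : tau d i u (m + 1) = sInf {t' : ℕ | t + (freeSteps d n + 1) ≤ t' ∧ u t' = i} := by
    simp only [tau, ← ht, hiff]
  have hmem := Nat.sInf_mem (s := {t' : ℕ | t + (freeSteps d n + 1) ≤ t' ∧ u t' = i})
    (hu (t + (freeSteps d n + 1)))
  rw [← hdef] at hmem
  obtain ⟨s, hs⟩ := Nat.exists_eq_add_of_le hmem.1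
  refine ⟨s, by omega, fun r hr h => ?_, hmem.2⟩
  have := Nat.sInf_le (s := {t' : ℕ | t + (freeSteps d n + 1) ≤ t' ∧ u t' = i})
    (m := t + freeSteps d n + r + 1) ⟨by omega, h⟩
  rw [← hdef] at this
  omega

theorem IsGlauber.measure_samples_le [IsProbabilityMeasure P] (hG : IsGlauber ψ P X U) {d : ℕ}
    (hd : 3 ≤ d) (i : Fin n) (m : ℕ) (y : ℕ → Config n) :
    P {ω | ∀ j ≤ m, X (tau d i (fun t => U t ω) j) ω = y j} ≤ P {ω | X 0 ω = y 0} *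
      ENNReal.ofReal (∏ j ∈ Finset.range m,
        sampleKernel ψ i (freeSteps d n) (y j) (y (j + 1))) := by
  have hsub : {ω | ∀ j ≤ m, X (tau d i (fun t => U t ω) j) ω = y j} ⊆
      {ω | ¬ ∀ t₀, ∃ t, t₀ ≤ t ∧ U t ω = i} ∪ ⋃ t, sampleEvent X U i (freeSteps d n) y m t := by
    intro ω hω
    by_cases h : ∀ t₀, ∃ t, t₀ ≤ t ∧ U t ω = i
    · right
      rw [Set.mem_iUnion]
      refine ⟨tau d i (fun t => U t ω) m, ?_⟩
      have H : ∀ j ≤ m, ω ∈ sampleEvent X U i (freeSteps d n) y j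
          (tau d i (fun t => U t ω) j) := by
        intro j
        induction j with
        | zero => exact fun h0 => ⟨rfl, hω 0 h0⟩
        | succ j ih =>
          intro hj
          obtain ⟨s, h1, h2, h3⟩ := tau_succ_eq hd i h j
          exact ⟨_, s, h1, ih (by omega), h2, h3, hω _ hj⟩
      exact H m le_rfl
    · exact Or.inl h
  calc _ ≤ _ := measure_mono hsub
    _ ≤ _ := measure_union_le _ _
    _ ≤ 0 + ∑' t, P (sampleEvent X U i (freeSteps d n) y m t) :=
        add_le_add (hG.ae_infinitely_often i).le (measure_iUnion_le _)
    _ ≤ _ := by rw [zero_add]; exact hG.tsum_measure_sampleEvent_le i _ y m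

end Markov

end

end GlauberMRF

namespace GlauberMRF

noncomputable section

open Matrix MeasureTheory

/-! ### Concentration along a Markov chain -/

/-- The first state is summed out and absorbed into the initial vector; this is the tower property
in finite-sum form. -/
theorem sum_paths_le {α : Type*} [Fintype α] (κ : α → α → ENNReal) {q : ENNReal}
    (hκ : ∀ x, ∑ y, κ x y ≤ q) (T : ℕ) (a : α → ENNReal) :
    ∑ z : Fin (T + 1) → α, a (z 0) * ∏ m : Fin T, κ (z m.castSucc) (z m.succ)
      ≤ (∑ x, a x) * q ^ T := by
  induction T generalizing a with
  | zero =>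
    rw [← (Fin.consEquiv (fun _ => α)).sum_comp, Fintype.sum_prod_type]
    simp [Fin.consEquiv]
  | succ T ih =>
    rw [← (Fin.consEquiv (fun _ => α)).sum_comp, Fintype.sum_prod_type, Finset.sum_comm]
    have h1 : ∀ z : Fin (T + 1) → α, ∑ x, a ((Fin.consEquiv fun _ => α) (x, z) 0) *
        ∏ m : Fin (T + 1), κ ((Fin.consEquiv fun _ => α) (x, z) m.castSucc)
          ((Fin.consEquiv fun _ => α) (x, z) m.succ)
        = (∑ x, a x * κ x (z 0)) * ∏ m : Fin T, κ (z m.castSucc) (z m.succ) := by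
      intro z
      rw [Finset.sum_mul]
      refine Finset.sum_congr rfl fun x _ => ?_
      rw [Fin.prod_univ_succ]
      simp only [Fin.consEquiv, Equiv.coe_fn_mk, Fin.castSucc_zero, Fin.cons_zero, Fin.cons_succ,
        ← Fin.succ_castSucc]
      rw [mul_assoc]
    rw [Finset.sum_congr rfl fun z _ => h1 z]
    refine (ih fun y => ∑ x, a x * κ x y).trans ?_
    rw [Finset.sum_comm, pow_succ', ← mul_assoc]
    refine mul_le_mul_left ?_ _
    rw [Finset.sum_mul]
    refine Finset.sum_le_sum fun x _ => ?_
    rw [← Finset.mul_sum]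
    exact mul_le_mul_right (hκ x) _

theorem abs_mulVec_le_one {α : Type*} [Fintype α] {K : Matrix α α ℝ} (hK : EntryNonneg K)
    (h1 : ∀ x, ∑ y, K x y = 1) {f : α → ℝ} (hf : ∀ x, |f x| ≤ 1) (x : α) :
    |(K *ᵥ f) x| ≤ 1 := by
  rw [← h1 x]
  refine (Finset.abs_sum_le_sum_abs _ _).trans (Finset.sum_le_sum fun y _ => ?_)
  rw [abs_mul, abs_of_nonneg (hK x y)]
  exact mul_le_of_le_one_right (hK x y) (hf y)

theorem sum_mul_exp_centered_le {α : Type*} [Fintype α] {K : Matrix α α ℝ} (hK : EntryNonneg K)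
    (h1 : ∀ x, ∑ y, K x y = 1) {f : α → ℝ} (hf : ∀ x, |f x| ≤ 1) (s : ℝ) (x : α) :
    ∑ y, K x y * Real.exp (s * (f y - (K *ᵥ f) x)) ≤ Real.exp (4 * s ^ 2) := by
  set g := (K *ᵥ f) x with hg
  have hle : ∀ y, Real.exp (s * (f y - g)) ≤ s * (f y - g) + Real.exp (4 * s ^ 2) := by
    intro y
    refine (exp_le_add_exp_sq _).trans (add_le_add le_rfl (Real.exp_le_exp.2 ?_))
    have h2 : |f y - g| ≤ 2 := (abs_sub _ _).trans
      (by linarith [hf y, abs_mulVec_le_one hK h1 hf x])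
    have h3 : (f y - g) ^ 2 ≤ 2 ^ 2 := sq_le_sq' (by linarith [(abs_le.1 h2).1]) (abs_le.1 h2).2
    rw [mul_pow]
    nlinarith [sq_nonneg s]
  calc _ ≤ ∑ y, K x y * (s * (f y - g) + Real.exp (4 * s ^ 2)) :=
        Finset.sum_le_sum fun y _ => mul_le_mul_of_nonneg_left (hle y) (hK x y)
    _ = s * (∑ y, K x y * f y) - (s * g) * ∑ y, K x y + (∑ y, K x y) * Real.exp (4 * s ^ 2) := by
        rw [Finset.mul_sum, Finset.mul_sum, Finset.sum_mul, ← Finset.sum_sub_distrib,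
          ← Finset.sum_add_distrib]
        exact Finset.sum_congr rfl fun y _ => by ring
    _ = _ := by
        rw [h1]
        have : ∑ y, K x y * f y = g := rfl
        rw [this]; ring

/-- The finite-dimensional distributions of `Y` are bounded by those of a Markov chain with
transition matrix `K`. -/
structure IsChain {Ω α : Type*} [MeasurableSpace Ω] [Fintype α] (P : Measure Ω) (Y : ℕ → Ω → α)
    (K : Matrix α α ℝ) : Prop where
  nonneg : EntryNonneg K
  row_sum : ∀ x, ∑ y, K x y = 1
  initial : ∑ x, P {ω | Y 0 ω = x} ≤ 1
  path : ∀ (m : ℕ) (y : ℕ → α), P {ω | ∀ j ≤ m, Y j ω = y j} ≤ P {ω | Y 0 ω = y 0} *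
    ENNReal.ofReal (∏ j ∈ Finset.range m, K (y j) (y (j + 1)))

theorem IsChain.path_fin {Ω α : Type*} [MeasurableSpace Ω] [Fintype α] {P : Measure Ω}
    {Y : ℕ → Ω → α} {K : Matrix α α ℝ} (h : IsChain P Y K) (T : ℕ) (z : Fin (T + 1) → α) :
    P {ω | ∀ j : Fin (T + 1), Y j ω = z j} ≤ P {ω | Y 0 ω = z 0} *
      ENNReal.ofReal (∏ m : Fin T, K (z m.castSucc) (z m.succ)) := by
  set y : ℕ → α := fun j => if hj : j < T + 1 then z ⟨j, hj⟩ else z 0 with hy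
  have hyz : ∀ j : Fin (T + 1), y j = z j := fun j => by simp only [hy]; rw [dif_pos j.2]
  have e1 : {ω | ∀ j : Fin (T + 1), Y j ω = z j} = {ω | ∀ j ≤ T, Y j ω = y j} := by
    ext ω
    refine ⟨fun h1 j hj => ?_, fun h1 j => ?_⟩
    · exact (h1 ⟨j, by omega⟩).trans (hyz ⟨j, by omega⟩).symm
    · exact (h1 j (by omega)).trans (hyz j)
  have e2 : ∏ m : Fin T, K (z m.castSucc) (z m.succ)
      = ∏ j ∈ Finset.range T, K (y j) (y (j + 1)) := by
    rw [Finset.prod_range]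
    refine Finset.prod_congr rfl fun m _ => ?_
    rw [← hyz, ← hyz]
    rfl
  rw [e1, e2, ← hyz 0]
  exact h.path T y

/-- Azuma's inequality written as a sum over finite paths: every bad path is weighted by exp(s(D -
Tη)) ≥ 1, after which the weights split into one exponential moment for each transition. -/
theorem IsChain.measure_deviation_le {Ω α : Type*} [MeasurableSpace Ω] [Fintype α]
    {P : Measure Ω} {Y : ℕ → Ω → α} {K : Matrix α α ℝ} (h : IsChain P Y K) {f : α → ℝ}
    (hf : ∀ x, |f x| ≤ 1) (T : ℕ) {η : ℝ} (hη : 0 ≤ η) :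
    P {ω | T * η ≤ ∑ m : Fin T, (f (Y (m + 1) ω) - (K *ᵥ f) (Y m ω))}
      ≤ ENNReal.ofReal (Real.exp (-(T * η ^ 2 / 16))) := by
  classical
  -- This s minimizes 4s² - sη, with minimum -η²/16.
  set s := η / 8 with hs
  have hs0 : 0 ≤ s := by positivity
  set D : (Fin (T + 1) → α) → ℝ := fun z =>
    ∑ m : Fin T, (f (z m.succ) - (K *ᵥ f) (z m.castSucc)) with hD
  set κ : α → α → ENNReal := fun x y =>
    ENNReal.ofReal (K x y * Real.exp (s * (f y - (K *ᵥ f) x))) with hκ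
  have hκ0 : ∀ x y, 0 ≤ K x y * Real.exp (s * (f y - (K *ᵥ f) x)) := fun x y =>
    mul_nonneg (h.nonneg x y) (Real.exp_pos _).le
  have hκ1 : ∀ x, ∑ y, κ x y ≤ ENNReal.ofReal (Real.exp (4 * s ^ 2)) := by
    intro x
    rw [← ENNReal.ofReal_sum_of_nonneg fun y _ => hκ0 x y]
    exact ENNReal.ofReal_le_ofReal (sum_mul_exp_centered_le h.nonneg h.row_sum hf s x)
  have hsub : {ω | T * η ≤ ∑ m : Fin T, (f (Y (m + 1) ω) - (K *ᵥ f) (Y m ω))} ⊆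
      ⋃ z ∈ Finset.univ.filter (fun z : Fin (T + 1) → α => T * η ≤ D z),
        {ω | ∀ j : Fin (T + 1), Y j ω = z j} := by
    intro ω hω
    simp only [Set.mem_iUnion]
    refine ⟨fun j => Y j ω, ?_, fun j => rfl⟩
    simp only [Finset.mem_filter, Finset.mem_univ, true_and, hD]
    simpa using hω
  have hterm : ∀ z ∈ Finset.univ.filter (fun z : Fin (T + 1) → α => T * η ≤ D z),
      P {ω | ∀ j : Fin (T + 1), Y j ω = z j} ≤ ENNReal.ofReal (Real.exp (-(s * (T * η)))) *
        (P {ω | Y 0 ω = z 0} * ∏ m : Fin T, κ (z m.castSucc) (z m.succ)) := by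
    intro z hz
    have hz' := (Finset.mem_filter.1 hz).2
    refine (h.path_fin T z).trans ?_
    rw [mul_left_comm]
    refine mul_le_mul_right ?_ _
    rw [← ENNReal.ofReal_prod_of_nonneg fun m _ => hκ0 _ _, ← ENNReal.ofReal_mul
      (Real.exp_pos _).le, Finset.prod_mul_distrib, ← Real.exp_sum, ← Finset.mul_sum]
    refine ENNReal.ofReal_le_ofReal ?_
    rw [mul_left_comm, ← Real.exp_add]
    refine le_mul_of_one_le_right (Finset.prod_nonneg fun _ _ => h.nonneg _ _) ?_
    refine Real.one_le_exp ?_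
    have := mul_le_mul_of_nonneg_left hz' hs0
    simp only [hD] at this
    linarith
  calc _ ≤ _ := measure_mono hsub
    _ ≤ _ := measure_biUnion_finset_le _ _
    _ ≤ _ := Finset.sum_le_sum hterm
    _ ≤ ∑ z : Fin (T + 1) → α, ENNReal.ofReal (Real.exp (-(s * (T * η)))) *
        (P {ω | Y 0 ω = z 0} * ∏ m : Fin T, κ (z m.castSucc) (z m.succ)) :=
        Finset.sum_le_sum_of_subset (Finset.filter_subset _ _)
    _ ≤ ENNReal.ofReal (Real.exp (-(s * (T * η)))) *
        (1 * ENNReal.ofReal (Real.exp (4 * s ^ 2)) ^ T) := by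
        rw [← Finset.mul_sum]
        refine mul_le_mul_right ((sum_paths_le κ hκ1 T fun x => P {ω | Y 0 ω = x}).trans ?_) _
        exact mul_le_mul_left h.initial _
    _ = _ := by
        rw [one_mul, ← ENNReal.ofReal_pow (Real.exp_pos _).le, ← ENNReal.ofReal_mul
          (Real.exp_pos _).le, ← Real.exp_nat_mul, ← Real.exp_add]
        congr 2
        rw [hs]; ring

theorem IsChain.measure_abs_deviation_le {Ω α : Type*} [MeasurableSpace Ω] [Fintype α]
    {P : Measure Ω} {Y : ℕ → Ω → α} {K : Matrix α α ℝ} (h : IsChain P Y K) {f : α → ℝ}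
    (hf : ∀ x, |f x| ≤ 1) (T : ℕ) {η : ℝ} (hη : 0 ≤ η) :
    P {ω | ¬ |∑ m : Fin T, (f (Y (m + 1) ω) - (K *ᵥ f) (Y m ω))| ≤ T * η}
      ≤ 2 * ENNReal.ofReal (Real.exp (-(T * η ^ 2 / 16))) := by
  have hsub : {ω | ¬ |∑ m : Fin T, (f (Y (m + 1) ω) - (K *ᵥ f) (Y m ω))| ≤ T * η} ⊆
      {ω | T * η ≤ ∑ m : Fin T, (f (Y (m + 1) ω) - (K *ᵥ f) (Y m ω))} ∪
      {ω | T * η ≤ ∑ m : Fin T, ((-f) (Y (m + 1) ω) - (K *ᵥ (-f)) (Y m ω))} := by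
    intro ω hω
    rw [Set.mem_ofPred_eq, not_le] at hω
    rcases lt_abs.1 hω with h1 | h1
    · exact Or.inl h1.le
    · right
      refine h1.le.trans (le_of_eq ?_)
      rw [← Finset.sum_neg_distrib, Matrix.mulVec_neg]
      exact Finset.sum_congr rfl fun m _ => by simp only [Pi.neg_apply]; ring
  rw [two_mul]
  exact (measure_mono hsub).trans ((measure_union_le _ _).trans (add_le_add
    (h.measure_deviation_le hf T hη)
    (h.measure_deviation_le (f := -f) (fun x => by simpa using hf x) T hη)))

theorem IsGlauber.isChain {Ω : Type*} [MeasurableSpace Ω] {n : ℕ} {ψ : MPoly n} {P : Measure Ω}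
    [IsProbabilityMeasure P] {X : ℕ → Ω → Config n} {U : ℕ → Ω → Fin n}
    (hG : IsGlauber ψ P X U) {d : ℕ} (hd : 3 ≤ d) (i : Fin n) :
    IsChain P (fun m ω => X (tau d i (fun t => U t ω) m) ω)
      (sampleKernel ψ i (freeSteps d n)) where
  nonneg := sampleKernel_nonneg ψ i _
  row_sum := sampleKernel_row_sum ψ i _
  initial := by
    have := sum_measure_preimage_singleton (μ := P) Finset.univ (f := X 0)
      (fun x _ => hG.measurable_config 0 x)
    exact this.le.trans prob_le_one
  path := hG.measure_samples_le hd i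

end

end GlauberMRF

namespace GlauberMRF

noncomputable section

open Matrix MeasureTheory

/-! ### Node-wise logistic regression -/

theorem pderiv_varsIn_neighbors {n : ℕ} (ψ : MPoly n) (i : Fin n) :
    (ψ.pderiv i).VarsIn (neighbors ψ i) := by
  classical
  intro S hS j hj
  simp only [neighbors, Finset.mem_filter, Finset.mem_univ, true_and]
  exact ⟨S, hj, hS⟩

theorem notMem_neighbors {n : ℕ} (ψ : MPoly n) (i : Fin n) : i ∉ neighbors ψ i := by
  classical
  simp only [neighbors, Finset.mem_filter, Finset.mem_univ, true_and, not_exists, not_and]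
  intro S hi
  simp [MPoly.pderiv, hi]

theorem IsMRF.pderiv_mem_feasible {n k d : ℕ} {lam : ℝ} {ψ : MPoly n} (h : IsMRF k d lam ψ)
    (i : Fin n) : ψ.pderiv i ∈ feasible (neighbors ψ i) k lam :=
  ⟨pderiv_varsIn_neighbors ψ i, h.degree.pderiv i, h.width i⟩

/-- Minus the derivative of the loss at `p`, on the sample `x`, in the direction of the monomial
with variables `S`, up to a factor `2`. -/
def score {n : ℕ} (i : Fin n) (p : MPoly n) (S : Finset (Fin n)) (x : Config n) : ℝ :=
  spin x i * sigm (-(2 * spin x i * p.eval x)) * chi S x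

theorem abs_score_le_one {n : ℕ} (i : Fin n) (p : MPoly n) (S : Finset (Fin n)) (x : Config n) :
    |score i p S x| ≤ 1 := by
  unfold score
  rw [abs_mul, abs_mul, abs_spin, abs_chi, one_mul, mul_one, abs_of_pos (sigm_pos _)]
  exact (sigm_lt_one _).le

/-- With g = ∂_iψ(x), the two spins contribute σ(2g)σ(-2g) with opposite signs, times a common
monomial that does not involve x_i. -/
theorem updOp_score {n : ℕ} (ψ : MPoly n) {i : Fin n} {S N : Finset (Fin n)}
    (hp : (ψ.pderiv i).VarsIn N) (hi : i ∉ N) (hS : i ∉ S) (x : Config n) :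
    updOp ψ i (score i (ψ.pderiv i) S) x = 0 := by
  unfold updOp score updateProb
  rw [hp.eval_update hi, hp.eval_update hi, chi_update_of_notMem hS, chi_update_of_notMem hS]
  have h1 : spin (Function.update x i 1) i = 1 := by simp [spin]
  have h2 : spin (Function.update x i (-1)) i = -1 := by simp [spin]
  rw [h1, h2, if_pos rfl, if_neg (by decide), mul_one, sigm_neg]
  have h3 : -(2 * (-1) * (ψ.pderiv i).eval x) = 2 * (ψ.pderiv i).eval x := by ring
  rw [h3]
  ring

theorem MPoly.eval_sq_eq {n : ℕ} (p : MPoly n) (x : Config n) :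
    p.eval x ^ 2 = ∑ S, ∑ S', p S * p S' * (chi S x * chi S' x) := by
  rw [sq, MPoly.eval_eq_sum_chi, Finset.sum_mul_sum]
  exact Finset.sum_congr rfl fun S _ => Finset.sum_congr rfl fun S' _ => by ring

theorem mulVec_eval_sq {n : ℕ} (K : Matrix (Config n) (Config n) ℝ) (p : MPoly n) (x : Config n) :
    (K *ᵥ fun x => p.eval x ^ 2) x =
      ∑ S, ∑ S', p S * p S' * (K *ᵥ fun x => chi S x * chi S' x) x := by
  simp only [Matrix.mulVec, dotProduct, MPoly.eval_sq_eq, Finset.mul_sum]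
  rw [Finset.sum_comm]
  refine Finset.sum_congr rfl fun S _ => ?_
  rw [Finset.sum_comm]
  exact Finset.sum_congr rfl fun S' _ => Finset.sum_congr rfl fun y _ => by ring

theorem abs_sum_mul_le {n : ℕ} {r : MPoly n} {F : Finset (Finset (Fin n))}
    (hF : ∀ S, r S ≠ 0 → S ∈ F) {a : Finset (Fin n) → ℝ} {b : ℝ} (ha : ∀ S ∈ F, |a S| ≤ b) :
    |∑ S, r S * a S| ≤ r.l1Norm * b := by
  refine (Finset.abs_sum_le_sum_abs _ _).trans ?_
  rw [MPoly.l1Norm, Finset.sum_mul]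
  refine Finset.sum_le_sum fun S _ => ?_
  rw [abs_mul]
  by_cases h : r S = 0
  · simp [h]
  · exact mul_le_mul_of_nonneg_left (ha S (hF S h)) (abs_nonneg _)

/-- The initial configuration and the samples `y 1, …, y T` deviate by at most `η` from their
conditional means, in all second moments and in all derivatives of the loss at `p`. -/
def Typical {n : ℕ} (K : Matrix (Config n) (Config n) ℝ) (i : Fin n) (F : Finset (Finset (Fin n)))
    (p : MPoly n) (T : ℕ) (η : ℝ) (y : ℕ → Config n) : Prop :=
  (∀ S ∈ F, ∀ S' ∈ F, |∑ m : Fin T, (chi S (y (m + 1)) * chi S' (y (m + 1))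
      - (K *ᵥ fun x => chi S x * chi S' x) (y m))| ≤ T * η) ∧
  ∀ S ∈ F, |∑ m : Fin T, score i p S (y (m + 1))| ≤ T * η

/-- The deviation of r² is a quadratic form in the coefficients of r whose entries are the
controlled deviations of products of two monomials. Finitely many events therefore handle all r
simultaneously, at the price of the squared 1-norm. -/
theorem Typical.le_sum_eval_sq {n : ℕ} {K : Matrix (Config n) (Config n) ℝ} {i : Fin n}
    {F : Finset (Finset (Fin n))} {p : MPoly n} {T : ℕ} {η : ℝ} {y : ℕ → Config n}
    (h : Typical K i F p T η y) {r : MPoly n} (hF : ∀ S, r S ≠ 0 → S ∈ F) :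
    ∑ m : Fin T, (K *ᵥ fun x => r.eval x ^ 2) (y m) - r.l1Norm * (r.l1Norm * (T * η))
      ≤ ∑ m : Fin T, r.eval (y (m + 1)) ^ 2 := by
  have h1 : ∑ m : Fin T, r.eval (y (m + 1)) ^ 2
      - ∑ m : Fin T, (K *ᵥ fun x => r.eval x ^ 2) (y m)
      = ∑ S, r S * ∑ S', r S' * ∑ m : Fin T, (chi S (y (m + 1)) * chi S' (y (m + 1))
          - (K *ᵥ fun x => chi S x * chi S' x) (y m)) := by
    have h0 : ∀ m, r.eval (y (m + 1)) ^ 2 - (K *ᵥ fun x => r.eval x ^ 2) (y m)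
        = ∑ S, ∑ S', r S * (r S' * (chi S (y (m + 1)) * chi S' (y (m + 1))
          - (K *ᵥ fun x => chi S x * chi S' x) (y m))) := by
      intro m
      rw [MPoly.eval_sq_eq, mulVec_eval_sq, ← Finset.sum_sub_distrib]
      refine Finset.sum_congr rfl fun S _ => ?_
      rw [← Finset.sum_sub_distrib]
      exact Finset.sum_congr rfl fun S' _ => by ring
    rw [← Finset.sum_sub_distrib, Finset.sum_congr rfl fun (m : Fin T) _ => h0 m, Finset.sum_comm]
    refine Finset.sum_congr rfl fun S _ => ?_
    rw [Finset.sum_comm, Finset.mul_sum]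
    exact Finset.sum_congr rfl fun S' _ => by rw [Finset.mul_sum, Finset.mul_sum]
  have h2 := abs_sum_mul_le hF fun S hS => abs_sum_mul_le hF (h.1 S hS)
  rw [← h1] at h2
  linarith [(abs_le.1 h2).1]

theorem Typical.abs_sum_score_le {n : ℕ} {K : Matrix (Config n) (Config n) ℝ} {i : Fin n}
    {F : Finset (Finset (Fin n))} {p : MPoly n} {T : ℕ} {η : ℝ} {y : ℕ → Config n}
    (h : Typical K i F p T η y) {r : MPoly n} (hF : ∀ S, r S ≠ 0 → S ∈ F) :
    |∑ m : Fin T, spin (y (m + 1)) i * sigm (-(2 * spin (y (m + 1)) i * p.eval (y (m + 1))))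
      * r.eval (y (m + 1))| ≤ r.l1Norm * (T * η) := by
  have h1 := abs_sum_mul_le hF h.2
  convert h1 using 2
  simp only [MPoly.eval_eq_sum_chi r, score, Finset.mul_sum]
  rw [Finset.sum_comm]
  exact Finset.sum_congr rfl fun S _ => Finset.sum_congr rfl fun m _ => by ring

/-- Strong convexity applied at the two margins, whose difference squared is 4(p - q)(x)²; this
turns the factor 1/16 into 1/4. -/
theorem loss_diff_ge {n : ℕ} {lam : ℝ} {p q : MPoly n} (hp : p.l1Norm ≤ lam)
    (hq : q.l1Norm ≤ lam) (i : Fin n) (x : Config n) :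
    logisticLoss (2 * spin x i * q.eval x)
        - 2 * (spin x i * sigm (-(2 * spin x i * q.eval x)) * (p - q).eval x)
        + Real.exp (-(2 * lam)) / 4 * (p - q).eval x ^ 2
      ≤ logisticLoss (2 * spin x i * p.eval x) := by
  have hb : ∀ p : MPoly n, p.l1Norm ≤ lam → |2 * spin x i * p.eval x| ≤ 2 * lam := by
    intro p hp
    rw [abs_mul, abs_mul, abs_spin, abs_two, mul_one]
    linarith [p.abs_eval_le x]
  have hl : 0 ≤ lam := by linarith [(abs_nonneg _).trans (hb p hp)]
  have h := logisticLoss_strongly_convex hl (hb q hq) (hb p hp)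
  have h2 : spin x i ^ 2 = 1 := by rw [← sq_abs, abs_spin, one_pow]
  have e1 : 2 * spin x i * p.eval x - 2 * spin x i * q.eval x
      = 2 * spin x i * (p - q).eval x := by rw [MPoly.eval_sub]; ring
  rw [e1, mul_pow, mul_pow, h2] at h
  refine le_trans (le_of_eq ?_) h
  ring

/-- Approximate minimizers of the empirical loss are close to the truth, if the samples are
typical. -/
theorem Typical.supNorm_sq_le {n d k : ℕ} {lam : ℝ} {ψ : MPoly n} (hM : IsMRF k d lam ψ)
    (hd : 3 ≤ d) (hlam : 0 ≤ lam) {i : Fin n} {T : ℕ} (hT : 0 < T) {η slack : ℝ} (hη : 0 ≤ η)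
    {y : ℕ → Config n}
    (h : Typical (sampleKernel ψ i (freeSteps d n)) i (monos (neighbors ψ i) k) (ψ.pderiv i)
      T η y) {p : MPoly n} (hp : p ∈ feasible (neighbors ψ i) k lam)
    (hloss : empLoss i (fun m : Fin T => y (m + 1)) p
      ≤ empLoss i (fun m : Fin T => y (m + 1)) (ψ.pderiv i) + slack) :
    Real.exp (-(2 * lam)) / 4 * spread d k lam * (p - ψ.pderiv i).supNorm ^ 2
      ≤ slack + 4 * lam * η + Real.exp (-(2 * lam)) * lam ^ 2 * η := by
  have hT' : (0 : ℝ) < T := Nat.cast_pos.2 hT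
  set q := ψ.pderiv i with hq
  have hq' : q ∈ feasible (neighbors ψ i) k lam := hM.pderiv_mem_feasible i
  set r := p - q with hr
  have hr1 : r.l1Norm ≤ 2 * lam := (MPoly.l1Norm_sub_le p q).trans (by linarith [hp.2.2, hq'.2.2])
  have hr0 : 0 ≤ r.l1Norm := Finset.sum_nonneg fun _ _ => abs_nonneg _
  have hrv : ∀ S, r S ≠ 0 → p S ≠ 0 ∨ q S ≠ 0 := by
    intro S hS
    by_contra! h0
    exact hS (by simp [hr, h0.1, h0.2])
  have hvars : r.VarsIn (neighbors ψ i) := fun S hS =>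
    (hrv S hS).elim (hp.1 S) (hq'.1 S)
  have hdeg : r.DegreeLE k := fun S hS => (hrv S hS).elim (hp.2.1 S) (hq'.2.1 S)
  have hF : ∀ S, r S ≠ 0 → S ∈ monos (neighbors ψ i) k := fun S hS =>
    mem_monos.2 ⟨hvars S hS, hdeg S hS⟩
  have h1 := h.le_sum_eval_sq hF
  have h2 := h.abs_sum_score_le hF
  have h3 : T * (spread d k lam * r.supNorm ^ 2)
      ≤ ∑ m : Fin T, (sampleKernel ψ i (freeSteps d n) *ᵥ fun x => r.eval x ^ 2) (y m) := by
    have h0 : T * (spread d k lam * r.supNorm ^ 2)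
        = ∑ _m : Fin T, spread d k lam * r.supNorm ^ 2 := by simp
    rw [h0]
    exact Finset.sum_le_sum fun (m : Fin T) _ => spread_mul_supNorm_sq_le (by omega) hlam
      (notMem_neighbors ψ i) (hM.card_neighbors i) hM.width hvars hdeg (le_freeSteps hd i.pos)
      (y m)
  set c := Real.exp (-(2 * lam)) with hc
  have hc0 : 0 < c := Real.exp_pos _
  have h4 : ∑ m : Fin T, logisticLoss (2 * spin (y (m + 1)) i * q.eval (y (m + 1)))
      - 2 * ∑ m : Fin T, spin (y (m + 1)) i *
        sigm (-(2 * spin (y (m + 1)) i * q.eval (y (m + 1)))) * r.eval (y (m + 1))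
      + c / 4 * ∑ m : Fin T, r.eval (y (m + 1)) ^ 2
      ≤ ∑ m : Fin T, logisticLoss (2 * spin (y (m + 1)) i * p.eval (y (m + 1))) := by
    rw [Finset.mul_sum, Finset.mul_sum, ← Finset.sum_sub_distrib, ← Finset.sum_add_distrib]
    exact Finset.sum_le_sum fun m _ => loss_diff_ge hp.2.2 hq'.2.2 i _
  have h5 : ∑ m : Fin T, logisticLoss (2 * spin (y (m + 1)) i * p.eval (y (m + 1)))
      ≤ ∑ m : Fin T, logisticLoss (2 * spin (y (m + 1)) i * q.eval (y (m + 1))) + T * slack := by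
    have := mul_le_mul_of_nonneg_left hloss hT'.le
    unfold empLoss at this
    rw [mul_add, ← mul_assoc, ← mul_assoc, mul_one_div_cancel hT'.ne', one_mul, one_mul] at this
    exact this
  have h6 : r.l1Norm * (T * η) ≤ 2 * lam * (T * η) :=
    mul_le_mul_of_nonneg_right hr1 (by positivity)
  have h7 : r.l1Norm * (r.l1Norm * (T * η)) ≤ 2 * lam * (2 * lam * (T * η)) :=
    mul_le_mul hr1 h6 (by positivity) (by linarith)
  have h8 := (abs_le.1 h2).2
  have h9 : c / 4 * (T * (spread d k lam * r.supNorm ^ 2) - 2 * lam * (2 * lam * (T * η)))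
      ≤ c / 4 * ∑ m : Fin T, r.eval (y (m + 1)) ^ 2 :=
    mul_le_mul_of_nonneg_left (by linarith) (by positivity)
  -- With the 1-norm of r at most 2λ, the gradient term is at most 2·2λ·η and the second-moment
  -- error at most (c/4)(2λ)²η = cλ²η for each sample.
  have h10 : T * (c / 4 * spread d k lam * r.supNorm ^ 2)
      ≤ T * (slack + 4 * lam * η + c * lam ^ 2 * η) := by nlinarith
  exact le_of_mul_le_mul_left h10 hT'

/-- Union bound over |F|² + |F| ≤ 2(d+1)^{2k} functions, each with two tails. -/
theorem IsGlauber.measure_not_typical_le {Ω : Type*} [MeasurableSpace Ω] {n : ℕ} {ψ : MPoly n}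
    {P : Measure Ω} [IsProbabilityMeasure P] {X : ℕ → Ω → Config n} {U : ℕ → Ω → Fin n}
    (hG : IsGlauber ψ P X U) {d k : ℕ} {lam : ℝ} (hM : IsMRF k d lam ψ) (hd : 3 ≤ d) (i : Fin n)
    (T : ℕ) {η : ℝ} (hη : 0 ≤ η) :
    P {ω | ¬ Typical (sampleKernel ψ i (freeSteps d n)) i (monos (neighbors ψ i) k)
        (ψ.pderiv i) T η (fun m => X (tau d i (fun t => U t ω) m) ω)}
      ≤ ENNReal.ofReal (4 * ((d + 1) ^ k) ^ 2 * Real.exp (-(T * η ^ 2 / 16))) := by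
  set K := sampleKernel ψ i (freeSteps d n) with hK
  set F := monos (neighbors ψ i) k with hF
  set Y : ℕ → Ω → Config n := fun m ω => X (tau d i (fun t => U t ω) m) ω with hY
  set b := ENNReal.ofReal (Real.exp (-(T * η ^ 2 / 16))) with hb
  have hcc : ∀ S S' x, |(fun x : Config n => chi S x * chi S' x) x| ≤ 1 := fun S S' x => by
    simp only [abs_mul, abs_chi, mul_one, le_refl]
  have hch : IsChain P Y K := hG.isChain hd i
  have hsub : {ω | ¬ Typical K i F (ψ.pderiv i) T η (fun m => Y m ω)} ⊆
      (⋃ S ∈ F, ⋃ S' ∈ F, {ω | ¬ |∑ m : Fin T, ((fun x => chi S x * chi S' x) (Y (m + 1) ω)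
        - (K *ᵥ fun x => chi S x * chi S' x) (Y m ω))| ≤ T * η}) ∪
      ⋃ S ∈ F, {ω | ¬ |∑ m : Fin T, (score i (ψ.pderiv i) S (Y (m + 1) ω)
        - (K *ᵥ score i (ψ.pderiv i) S) (Y m ω))| ≤ T * η} := by
    intro ω hω
    by_contra hcon
    simp only [Set.mem_union, Set.mem_iUnion, not_or, not_exists, Set.mem_ofPred_eq,
      not_not] at hcon
    refine hω ⟨fun S hS S' hS' => hcon.1 S hS S' hS', fun S hS => ?_⟩
    have h1 := hcon.2 S hS
    -- The compensator of the score vanishes, so its martingale deviation is the score sum itself.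
    have h2 : ∀ x, (K *ᵥ score i (ψ.pderiv i) S) x = 0 :=
      sampleKernel_mulVec_eq_zero ψ i _ (updOp_score ψ (pderiv_varsIn_neighbors ψ i)
        (notMem_neighbors ψ i) fun h => notMem_neighbors ψ i ((mem_monos.1 hS).1 h))
    simpa only [h2, sub_zero] using h1
  have hcard : (F.card : ENNReal) ≤ ((d + 1) ^ k : ℕ) := by
    exact_mod_cast card_monos_le (hM.card_neighbors i) k
  have h1 : ((1 : ℕ) : ENNReal) ≤ ((d + 1) ^ k : ℕ) := by
    exact_mod_cast Nat.one_le_pow _ _ (by omega)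
  calc _ ≤ _ := measure_mono hsub
    _ ≤ _ := measure_union_le _ _
    _ ≤ ∑ S ∈ F, ∑ S' ∈ F, 2 * b + ∑ S ∈ F, 2 * b := by
        refine add_le_add ((measure_biUnion_finset_le _ _).trans (Finset.sum_le_sum fun S _ =>
          (measure_biUnion_finset_le _ _).trans (Finset.sum_le_sum fun S' _ => ?_)))
          ((measure_biUnion_finset_le _ _).trans (Finset.sum_le_sum fun S _ => ?_))
        · exact hch.measure_abs_deviation_le (hcc S S') T hη
        · exact hch.measure_abs_deviation_le (abs_score_le_one i (ψ.pderiv i) S) T hη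
    _ = F.card * (F.card * (2 * b)) + F.card * (1 * (2 * b)) := by
        simp [Finset.sum_const, nsmul_eq_mul]
    _ ≤ ((d + 1) ^ k : ℕ) * (((d + 1) ^ k : ℕ) * (2 * b))
        + ((d + 1) ^ k : ℕ) * (((d + 1) ^ k : ℕ) * (2 * b)) := by
        rw [Nat.cast_one] at h1
        gcongr
    _ = _ := by
        rw [ENNReal.ofReal_mul (by positivity), ← hb, ENNReal.ofReal_mul (by positivity),
          ENNReal.ofReal_pow (by positivity)]
        have : ENNReal.ofReal (((d : ℝ) + 1) ^ k) = ((d + 1) ^ k : ℕ) := by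
          rw [← ENNReal.ofReal_natCast]; push_cast; rfl
        rw [this, ENNReal.ofReal_ofNat]
        ring

/-! ### Existence of minimizers -/

theorem isCompact_feasible {n : ℕ} (N : Finset (Fin n)) (k : ℕ) (lam : ℝ) :
    IsCompact (feasible N k lam) := by
  have hcl : IsClosed (feasible N k lam) := by
    have h1 : ∀ S : Finset (Fin n), ∀ Q : Prop, IsClosed {p : MPoly n | p S ≠ 0 → Q} := by
      intro S Q
      by_cases hQ : Q
      · simp [hQ]
      · simpa [hQ] using isClosed_eq (continuous_apply S) continuous_const
    have h2 : feasible N k lam = (⋂ S, {p | p S ≠ 0 → S ⊆ N}) ∩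
        ((⋂ S, {p | p S ≠ 0 → S.card ≤ k}) ∩ {p : MPoly n | p.l1Norm ≤ lam}) := by
      ext p; simp [feasible, MPoly.DegreeLE]
    rw [h2]
    refine (isClosed_iInter fun S => h1 S _).inter ((isClosed_iInter fun S => h1 S _).inter ?_)
    refine isClosed_le ?_ continuous_const
    exact continuous_finsetSum _ fun S _ => (continuous_apply S).abs
  refine (isCompact_univ_pi fun S : Finset (Fin n) =>
    isCompact_Icc (a := -lam) (b := lam)).of_isClosed_subset hcl fun p hp S _ => ?_
  have : |p S| ≤ MPoly.l1Norm p :=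
    Finset.single_le_sum (f := fun S => |p S|) (fun _ _ => abs_nonneg _) (Finset.mem_univ S)
  exact abs_le.1 (this.trans hp.2.2)

theorem exists_isLogReg {n T : ℕ} (i : Fin n) (N : Finset (Fin n)) (k : ℕ) {lam : ℝ}
    (hlam : 0 ≤ lam) (Z : Fin T → Config n) : ∃ p, IsLogReg i N k lam Z p := by
  have hcont : Continuous (empLoss i Z) := by
    unfold empLoss MPoly.eval
    refine continuous_const.mul (continuous_finsetSum _ fun m _ => ?_)
    have h1 : Continuous logisticLoss :=
      continuous_iff_continuousAt.2 fun z => (hasDerivAt_logisticLoss z).continuousAt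
    exact h1.comp (continuous_const.mul (continuous_finsetSum _ fun S _ =>
      (continuous_apply S).mul continuous_const))
  obtain ⟨p, hp, h⟩ := (isCompact_feasible N k lam).exists_isMinOn
    ⟨0, by simp [feasible, MPoly.DegreeLE, MPoly.l1Norm, hlam]⟩ hcont.continuousOn
  exact ⟨p, hp, fun q hq => h hq⟩

end

end GlauberMRF

namespace GlauberMRF

noncomputable section

/-! ### Exponentiated gradient descent for the empirical loss -/

/-- The partial derivatives of the empirical loss with respect to the coefficients. -/
def lossGrad {n T : ℕ} (i : Fin n) (Z : Fin T → Config n) (p : MPoly n)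
    (S : Finset (Fin n)) : ℝ :=
  -(2 / (T : ℝ)) * ∑ m, score i p S (Z m)

theorem abs_lossGrad_le {n T : ℕ} (i : Fin n) (Z : Fin T → Config n) (p : MPoly n)
    (S : Finset (Fin n)) : |lossGrad i Z p S| ≤ 2 := by
  have h : |∑ m, score i p S (Z m)| ≤ T := by
    refine (Finset.abs_sum_le_sum_abs _ _).trans
      ((Finset.sum_le_sum fun m _ => abs_score_le_one i p S (Z m)).trans (le_of_eq ?_))
    simp
  unfold lossGrad
  rw [abs_mul, abs_neg, abs_of_nonneg (by positivity : 0 ≤ 2 / (T : ℝ)), div_mul_eq_mul_div]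
  exact div_le_of_le_mul₀ (by positivity) (by norm_num) (by linarith)

theorem empLoss_add_lossGrad_le {n T : ℕ} {lam : ℝ} {p q : MPoly n} (hp : p.l1Norm ≤ lam)
    (hq : q.l1Norm ≤ lam) (i : Fin n) (Z : Fin T → Config n) :
    empLoss i Z q + ∑ S, lossGrad i Z q S * (p S - q S) ≤ empLoss i Z p := by
  have h1 : ∑ S, lossGrad i Z q S * (p S - q S) = (1 / (T : ℝ)) * ∑ m, -(2 * (spin (Z m) i *
      sigm (-(2 * spin (Z m) i * q.eval (Z m))) * (p - q).eval (Z m))) := by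
    simp only [lossGrad, MPoly.eval_eq_sum_chi (p - q), Finset.mul_sum, Finset.sum_mul, score,
      Pi.sub_apply, ← Finset.sum_neg_distrib]
    rw [Finset.sum_comm]
    exact Finset.sum_congr rfl fun m _ => Finset.sum_congr rfl fun S _ => by ring
  unfold empLoss
  rw [h1, ← mul_add, ← Finset.sum_add_distrib]
  refine mul_le_mul_of_nonneg_left (Finset.sum_le_sum fun m _ => ?_) (by positivity)
  have h2 := loss_diff_ge hp hq i (Z m)
  have h3 : 0 ≤ Real.exp (-(2 * lam)) / 4 * (p - q).eval (Z m) ^ 2 := by positivity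
  linarith

/-- The sum of the weights of the experts `±S`, `S ∈ F`, with accumulated gradient `G`. -/
def hedgeWeight {n : ℕ} (F : Finset (Finset (Fin n))) (a : ℝ) (G : Finset (Fin n) → ℝ) : ℝ :=
  ∑ S ∈ F, (Real.exp (-(a * G S)) + Real.exp (a * G S))

/-- The weighted mean of the polynomials `±lam S`, `S ∈ F`. -/
def hedgePoly {n : ℕ} (F : Finset (Finset (Fin n))) (lam a : ℝ) (G : Finset (Fin n) → ℝ) :
    MPoly n :=
  fun S => if S ∈ F then
    lam * (Real.exp (-(a * G S)) - Real.exp (a * G S)) / hedgeWeight F a G else 0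

/-- The accumulated gradient after `r` rounds of exponentiated gradient descent. -/
def hedgeGrad {n T : ℕ} (i : Fin n) (F : Finset (Finset (Fin n))) (lam a : ℝ)
    (Z : Fin T → Config n) : ℕ → Finset (Fin n) → ℝ
  | 0 => fun _ => 0
  | r + 1 => fun S => hedgeGrad i F lam a Z r S
      + lossGrad i Z (hedgePoly F lam a (hedgeGrad i F lam a Z r)) S

/-- The average of the iterates of exponentiated gradient descent in `R` rounds. -/
def hedgeAvg {n T : ℕ} (i : Fin n) (F : Finset (Finset (Fin n))) (lam a : ℝ) (R : ℕ)
    (Z : Fin T → Config n) : MPoly n :=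
  fun S => (1 / (R : ℝ)) * ∑ r ∈ Finset.range R, hedgePoly F lam a (hedgeGrad i F lam a Z r) S

section Hedge

variable {n : ℕ} {F : Finset (Finset (Fin n))}

theorem hedgeWeight_pos (hF : F.Nonempty) (a : ℝ) (G : Finset (Fin n) → ℝ) :
    0 < hedgeWeight F a G :=
  Finset.sum_pos (fun S _ => by positivity) hF

theorem l1Norm_hedgePoly_le (hF : F.Nonempty) {lam : ℝ} (hlam : 0 ≤ lam) (a : ℝ)
    (G : Finset (Fin n) → ℝ) :
    (hedgePoly F lam a G).l1Norm ≤ lam := by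
  have hW := hedgeWeight_pos hF a G
  calc (hedgePoly F lam a G).l1Norm
      ≤ ∑ S, if S ∈ F then
          lam * (Real.exp (-(a * G S)) + Real.exp (a * G S)) / hedgeWeight F a G else 0 := by
        refine Finset.sum_le_sum fun S _ => ?_
        unfold hedgePoly
        split_ifs
        · rw [abs_div, abs_mul, abs_of_nonneg hlam, abs_of_pos hW]
          gcongr
          refine (abs_sub _ _).trans ?_
          rw [abs_of_pos (Real.exp_pos _), abs_of_pos (Real.exp_pos _)]
        · simp
    _ = lam * hedgeWeight F a G / hedgeWeight F a G := by
        rw [← Finset.sum_filter, Finset.filter_mem_eq_inter, Finset.univ_inter,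
          ← Finset.sum_div, ← Finset.mul_sum]
        rfl
    _ = lam := by field_simp

/-- Under the current weights, the experts' losses ±g_S have mean u. All of them and u lie in [-2,
2], so the centred losses are at most 4 in absolute value; the linear term averages out and (4a)² =
16a² remains. -/
theorem hedgeWeight_add_le (hF : F.Nonempty) {lam : ℝ} (hlam : 0 < lam) (a : ℝ)
    (G : Finset (Fin n) → ℝ)
    {g : Finset (Fin n) → ℝ} (hg : ∀ S, |g S| ≤ 2) :
    hedgeWeight F a (fun S => G S + g S) ≤ hedgeWeight F a G *
      Real.exp (-(a / lam * ∑ S, g S * hedgePoly F lam a G S) + 16 * a ^ 2) := by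
  have hW := hedgeWeight_pos hF a G
  set W := hedgeWeight F a G with hWd
  set u := (∑ S, g S * hedgePoly F lam a G S) / lam with hu
  have hu2 : |u| ≤ 2 := by
    rw [hu, abs_div, abs_of_pos hlam, div_le_iff₀ hlam]
    refine (Finset.abs_sum_le_sum_abs _ _).trans ?_
    calc _ ≤ ∑ S, 2 * |hedgePoly F lam a G S| := Finset.sum_le_sum fun S _ => by
          rw [abs_mul]; exact mul_le_mul_of_nonneg_right (hg S) (abs_nonneg _)
      _ = 2 * (hedgePoly F lam a G).l1Norm := by rw [← Finset.mul_sum]; rfl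
      _ ≤ _ := by linarith [l1Norm_hedgePoly_le hF hlam.le a G]
  have huW : u * W = ∑ S ∈ F, (Real.exp (-(a * G S)) * g S + Real.exp (a * G S) * (-g S)) := by
    have h1 : ∑ S, g S * hedgePoly F lam a G S
        = ∑ S ∈ F, g S * (lam * (Real.exp (-(a * G S)) - Real.exp (a * G S)) / W) := by
      rw [← Finset.sum_subset (Finset.subset_univ F)]
      · exact Finset.sum_congr rfl fun S hS => by simp only [hedgePoly, if_pos hS, hWd]
      · intro S _ hS; simp [hedgePoly, hS]
    rw [hu, h1, div_mul_eq_mul_div, div_eq_iff hlam.ne', Finset.sum_mul, Finset.sum_mul]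
    refine Finset.sum_congr rfl fun S _ => ?_
    field_simp
    ring
  have hle : ∀ v, |v| ≤ 2 → Real.exp (-(a * v))
      ≤ Real.exp (-(a * u)) * (-(a * (v - u)) + Real.exp (16 * a ^ 2)) := by
    intro v hv
    have h1 := exp_le_add_exp_sq (-(a * (v - u)))
    have h2 : Real.exp ((-(a * (v - u))) ^ 2) ≤ Real.exp (16 * a ^ 2) := by
      refine Real.exp_le_exp.2 ?_
      have h3 : (v - u) ^ 2 ≤ 4 ^ 2 := by
        rw [abs_le] at hv hu2
        exact sq_le_sq' (by linarith) (by linarith)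
      rw [neg_sq, mul_pow]
      nlinarith [sq_nonneg a]
    have h3 : Real.exp (-(a * v)) = Real.exp (-(a * u)) * Real.exp (-(a * (v - u))) := by
      rw [← Real.exp_add]; congr 1; ring
    rw [h3]
    exact mul_le_mul_of_nonneg_left (h1.trans (by linarith)) (Real.exp_pos _).le
  calc hedgeWeight F a (fun S => G S + g S)
      = ∑ S ∈ F, (Real.exp (-(a * G S)) * Real.exp (-(a * g S))
        + Real.exp (a * G S) * Real.exp (-(a * (-g S)))) := by
        refine Finset.sum_congr rfl fun S _ => ?_
        rw [← Real.exp_add, ← Real.exp_add]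
        congr 2 <;> ring
    _ ≤ ∑ S ∈ F, (Real.exp (-(a * G S)) *
          (Real.exp (-(a * u)) * (-(a * (g S - u)) + Real.exp (16 * a ^ 2)))
        + Real.exp (a * G S) *
          (Real.exp (-(a * u)) * (-(a * (-g S - u)) + Real.exp (16 * a ^ 2)))) :=
        Finset.sum_le_sum fun S _ => add_le_add
          (mul_le_mul_of_nonneg_left (hle _ (hg S)) (Real.exp_pos _).le)
          (mul_le_mul_of_nonneg_left (hle _ (by rw [abs_neg]; exact hg S)) (Real.exp_pos _).le)
    _ = Real.exp (-(a * u)) * (-a * (∑ S ∈ F,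
          (Real.exp (-(a * G S)) * g S + Real.exp (a * G S) * (-g S)) - u * W)
          + W * Real.exp (16 * a ^ 2)) := by
        rw [hWd, hedgeWeight, Finset.mul_sum _ _ u, ← Finset.sum_sub_distrib, Finset.mul_sum,
          Finset.sum_mul, ← Finset.sum_add_distrib, Finset.mul_sum]
        exact Finset.sum_congr rfl fun S _ => by ring
    _ = W * Real.exp (-(a / lam * ∑ S, g S * hedgePoly F lam a G S) + 16 * a ^ 2) := by
        rw [← huW, sub_self, mul_zero, zero_add, Real.exp_add, hu]
        have : a * ((∑ S, g S * hedgePoly F lam a G S) / lam)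
          = a / lam * ∑ S, g S * hedgePoly F lam a G S := by ring
        rw [this]; ring

theorem hedgeWeight_hedgeGrad_le (hF : F.Nonempty) {T : ℕ} (i : Fin n) {lam : ℝ}
    (hlam : 0 < lam) (a : ℝ)
    (Z : Fin T → Config n) (R : ℕ) :
    hedgeWeight F a (hedgeGrad i F lam a Z R) ≤ 2 * F.card *
      Real.exp (-(a / lam * ∑ r ∈ Finset.range R, ∑ S,
        lossGrad i Z (hedgePoly F lam a (hedgeGrad i F lam a Z r)) S
          * hedgePoly F lam a (hedgeGrad i F lam a Z r) S) + 16 * a ^ 2 * R) := by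
  induction R with
  | zero => simp [hedgeWeight, hedgeGrad]; linarith
  | succ R ih =>
    refine (hedgeWeight_add_le hF hlam a _ (abs_lossGrad_le i Z _)).trans ?_
    refine (mul_le_mul_of_nonneg_right ih (Real.exp_pos _).le).trans (le_of_eq ?_)
    rw [mul_assoc, ← Real.exp_add, Finset.sum_range_succ]
    congr 2
    push_cast
    ring

theorem l1Norm_hedgeAvg_le (hF : F.Nonempty) {T : ℕ} (i : Fin n) {lam : ℝ}
    (hlam : 0 ≤ lam) (a : ℝ) (R : ℕ)
    (Z : Fin T → Config n) : (hedgeAvg i F lam a R Z).l1Norm ≤ lam := by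
  calc _ ≤ ∑ S, (1 / (R : ℝ)) * ∑ r ∈ Finset.range R,
        |hedgePoly F lam a (hedgeGrad i F lam a Z r) S| := by
        refine Finset.sum_le_sum fun S _ => ?_
        unfold hedgeAvg
        rw [abs_mul, abs_of_nonneg (by positivity : 0 ≤ 1 / (R : ℝ))]
        exact mul_le_mul_of_nonneg_left (Finset.abs_sum_le_sum_abs _ _) (by positivity)
    _ = (1 / (R : ℝ)) * ∑ r ∈ Finset.range R,
        (hedgePoly F lam a (hedgeGrad i F lam a Z r)).l1Norm := by
        rw [← Finset.mul_sum, Finset.sum_comm]; rfl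
    _ ≤ (1 / (R : ℝ)) * ∑ r ∈ Finset.range R, lam :=
        mul_le_mul_of_nonneg_left (Finset.sum_le_sum fun r _ =>
          l1Norm_hedgePoly_le hF hlam a _) (by positivity)
    _ ≤ lam := by
        rw [Finset.sum_const, Finset.card_range, nsmul_eq_mul, one_div_mul_eq_div]
        rcases Nat.eq_zero_or_pos R with h | h
        · simp [h, hlam]
        · rw [mul_div_cancel_left₀ _ (Nat.cast_pos.2 h).ne']

/-- The total weight dominates the weight of each expert, so its logarithm bounds every |G S|. Since
the 1-norm ball of radius λ is the hull of ±λ·monomials, this bounds the regret against every q. -/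
theorem hedge_regret_le (hF : F.Nonempty) {T : ℕ} (i : Fin n) {lam : ℝ}
    (hlam : 0 < lam) {a : ℝ} (ha : 0 < a)
    (R : ℕ) (Z : Fin T → Config n) {q : MPoly n} (hq : q.l1Norm ≤ lam)
    (hqF : ∀ S, q S ≠ 0 → S ∈ F) :
    ∑ r ∈ Finset.range R, ∑ S, lossGrad i Z (hedgePoly F lam a (hedgeGrad i F lam a Z r)) S
        * (hedgePoly F lam a (hedgeGrad i F lam a Z r) S - q S)
      ≤ lam * (Real.log (2 * F.card) / a + 16 * a * R) := by
  set p : ℕ → MPoly n := fun r => hedgePoly F lam a (hedgeGrad i F lam a Z r) with hp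
  set V := ∑ r ∈ Finset.range R, ∑ S, lossGrad i Z (p r) S * p r S with hV
  set G := hedgeGrad i F lam a Z R with hG
  have hGsum : ∀ S, G S = ∑ r ∈ Finset.range R, lossGrad i Z (p r) S := by
    intro S
    rw [hG]
    clear_value V
    clear hG hV G
    induction R with
    | zero => simp [hedgeGrad]
    | succ R ih => rw [Finset.sum_range_succ, ← ih]; rfl
  have hcard : (0 : ℝ) < 2 * F.card := by
    have : 0 < F.card := hF.card_pos
    positivity
  -- The logarithm of the bound in `hedgeWeight_hedgeGrad_le`, divided by a.
  set b := Real.log (2 * F.card) / a - V / lam + 16 * a * R with hb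
  have hGb : ∀ S ∈ F, |G S| ≤ b := by
    intro S hS
    have h1 : Real.exp (a * |G S|) ≤ hedgeWeight F a G := by
      have h2 : Real.exp (-(a * G S)) + Real.exp (a * G S) ≤ hedgeWeight F a G :=
        Finset.single_le_sum (f := fun S => Real.exp (-(a * G S)) + Real.exp (a * G S))
          (fun S _ => by positivity) hS
      have h3 := Real.exp_pos (-(a * G S))
      have h4 := Real.exp_pos (a * G S)
      rcases abs_cases (G S) with ⟨h, -⟩ | ⟨h, -⟩ <;> rw [h]
      · linarith
      · rw [mul_neg]; linarith
    have h2 := h1.trans (hedgeWeight_hedgeGrad_le hF i hlam a Z R)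
    rw [← Real.exp_log hcard, ← Real.exp_add, Real.exp_le_exp] at h2
    change a * |G S| ≤ Real.log (2 * F.card) + (-(a / lam * V) + 16 * a ^ 2 * R) at h2
    have h3 : a * b = Real.log (2 * F.card) + (-(a / lam * V) + 16 * a ^ 2 * R) := by
      rw [hb]; field_simp; ring
    rw [← h3] at h2
    exact le_of_mul_le_mul_left h2 ha
  have h1 := abs_sum_mul_le hqF hGb
  obtain ⟨S₀, hS₀⟩ := hF
  have hb0 : 0 ≤ b := (abs_nonneg _).trans (hGb S₀ hS₀)
  have h2 : -(∑ S, q S * G S) ≤ lam * b :=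
    (neg_le_abs _).trans (h1.trans (mul_le_mul_of_nonneg_right hq hb0))
  have h3 : ∑ r ∈ Finset.range R, ∑ S, lossGrad i Z (p r) S * (p r S - q S)
      = V + -(∑ S, q S * G S) := by
    rw [hV, ← sub_eq_add_neg]
    have : ∑ S, q S * G S = ∑ r ∈ Finset.range R, ∑ S, lossGrad i Z (p r) S * q S := by
      rw [Finset.sum_comm]
      refine Finset.sum_congr rfl fun S _ => ?_
      rw [hGsum, ← Finset.sum_mul, mul_comm]
    rw [this, ← Finset.sum_sub_distrib]
    refine Finset.sum_congr rfl fun r _ => ?_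
    rw [← Finset.sum_sub_distrib]
    exact Finset.sum_congr rfl fun S _ => by ring
  rw [h3]
  have h4 : lam * b = lam * (Real.log (2 * F.card) / a + 16 * a * R) - V := by
    rw [hb]; field_simp; ring
  linarith

/-- Convexity turns regret into excess loss for the iterates, and Jensen's inequality passes to
their average. -/
theorem empLoss_hedgeAvg_le (hF : F.Nonempty) {T : ℕ} (i : Fin n) {lam : ℝ}
    (hlam : 0 < lam) {a : ℝ} (ha : 0 < a)
    {R : ℕ} (hR : 0 < R) (Z : Fin T → Config n) {q : MPoly n} (hq : q.l1Norm ≤ lam)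
    (hqF : ∀ S, q S ≠ 0 → S ∈ F) :
    empLoss i Z (hedgeAvg i F lam a R Z)
      ≤ empLoss i Z q + lam * (Real.log (2 * F.card) / (a * R) + 16 * a) := by
  have hR' : (0 : ℝ) < R := Nat.cast_pos.2 hR
  set p : ℕ → MPoly n := fun r => hedgePoly F lam a (hedgeGrad i F lam a Z r) with hp
  set A := hedgeAvg i F lam a R Z with hA
  have hpl : ∀ r, (p r).l1Norm ≤ lam := fun r => l1Norm_hedgePoly_le hF hlam.le a _
  have h1 : ∑ r ∈ Finset.range R, empLoss i Z (p r) ≤ R * empLoss i Z q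
      + lam * (Real.log (2 * F.card) / a + 16 * a * R) := by
    have h2 := hedge_regret_le hF i hlam ha R Z hq hqF
    have h3 : ∀ r, empLoss i Z (p r) ≤ empLoss i Z q
        + ∑ S, lossGrad i Z (p r) S * (p r S - q S) := by
      intro r
      have h4 := empLoss_add_lossGrad_le hq (hpl r) i Z
      have h5 : ∑ S, lossGrad i Z (p r) S * (p r S - q S)
          = -∑ S, lossGrad i Z (p r) S * (q S - p r S) := by
        rw [← Finset.sum_neg_distrib]
        exact Finset.sum_congr rfl fun S _ => by ring
      linarith
    have h4 := Finset.sum_le_sum fun r (_ : r ∈ Finset.range R) => h3 r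
    rw [Finset.sum_add_distrib, Finset.sum_const, Finset.card_range, nsmul_eq_mul] at h4
    linarith
  have h2 : R * empLoss i Z A ≤ ∑ r ∈ Finset.range R, empLoss i Z (p r) := by
    have h3 := Finset.sum_le_sum fun r (_ : r ∈ Finset.range R) =>
      empLoss_add_lossGrad_le (hpl r) (l1Norm_hedgeAvg_le hF i hlam.le a R Z) i Z
    rw [Finset.sum_add_distrib, Finset.sum_const, Finset.card_range, nsmul_eq_mul] at h3
    -- Jensen through the tangent at the average: the deviations from the average sum to zero.
    have h4 : ∑ r ∈ Finset.range R, ∑ S, lossGrad i Z A S * (p r S - A S) = 0 := by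
      rw [Finset.sum_comm]
      refine Finset.sum_eq_zero fun S _ => ?_
      rw [← Finset.mul_sum, Finset.sum_sub_distrib, Finset.sum_const, Finset.card_range,
        nsmul_eq_mul]
      have : R * A S = ∑ r ∈ Finset.range R, p r S := by
        rw [hA]; unfold hedgeAvg
        rw [← mul_assoc, mul_one_div_cancel hR'.ne', one_mul]
      rw [this, sub_self, mul_zero]
    rw [h4, add_zero] at h3
    exact h3
  have h3 : R * empLoss i Z A ≤ R * (empLoss i Z q
      + lam * (Real.log (2 * F.card) / (a * R) + 16 * a)) := by
    refine (h2.trans h1).trans (le_of_eq ?_)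
    field_simp
  exact le_of_mul_le_mul_left h3 hR'

end Hedge

theorem hedgeAvg_mem_feasible {n T : ℕ} (i : Fin n) (N : Finset (Fin n)) (k : ℕ) {lam : ℝ}
    (hlam : 0 ≤ lam) (a : ℝ) (R : ℕ) (Z : Fin T → Config n) :
    hedgeAvg i (monos N k) lam a R Z ∈ feasible N k lam := by
  have h0 : ∀ S, hedgeAvg i (monos N k) lam a R Z S ≠ 0 → S ∈ monos N k := by
    intro S hS
    by_contra h
    exact hS (by simp [hedgeAvg, hedgePoly, h])
  exact ⟨fun S hS => (mem_monos.1 (h0 S hS)).1, fun S hS => (mem_monos.1 (h0 S hS)).2,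
    l1Norm_hedgeAvg_le ⟨∅, mem_monos.2 (by simp)⟩ i hlam a R Z⟩

end

end GlauberMRF

namespace GlauberMRF

noncomputable section

/-! ### Straight-line programs -/

/-- Every program that has the functions in `A` in its registers can be continued by `c`
instructions to a program that has the functions in `F` in its registers, too. -/
def Reach {D : Type*} (A : Set (D → ℝ)) (c : ℕ) (F : Set (D → ℝ)) : Prop :=
  ∀ (inputs : Set (D → ℝ)) (m : ℕ) (R : Set (D → ℝ)), Computes inputs m R → A ⊆ R →
    ∃ R', Computes inputs (m + c) R' ∧ R ⊆ R' ∧ F ⊆ R'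

namespace Reach

variable {D : Type*} {A F F' : Set (D → ℝ)} {c c' : ℕ} {f g : D → ℝ}

theorem of_subset (h : F ⊆ A) : Reach A 0 F := fun _ _ _ hR hA => ⟨_, hR, subset_rfl, h.trans hA⟩

theorem of_mem (h : f ∈ A) : Reach A 0 {f} := of_subset (Set.singleton_subset_iff.2 h)

theorem trans (h : Reach A c F) (h' : Reach (A ∪ F) c' F') : Reach A (c + c') F' := by
  intro inputs m R hR hA
  obtain ⟨R₁, h1, h2, h3⟩ := h inputs m R hR hA
  obtain ⟨R₂, h4, h5, h6⟩ := h' inputs _ R₁ h1 (Set.union_subset (hA.trans h2) h3)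
  exact ⟨R₂, by rwa [← add_assoc], h2.trans h5, h6⟩

theorem union (h : Reach A c F) (h' : Reach A c' F') : Reach A (c + c') (F ∪ F') := by
  intro inputs m R hR hA
  obtain ⟨R₁, h1, h2, h3⟩ := h inputs m R hR hA
  obtain ⟨R₂, h4, h5, h6⟩ := h' inputs _ R₁ h1 (hA.trans h2)
  exact ⟨R₂, by rwa [← add_assoc], h2.trans h5, Set.union_subset (h3.trans h5) h6⟩

theorem const (A : Set (D → ℝ)) (c : ℝ) : Reach A 1 {fun _ => c} := fun _ _ _ hR _ =>
  ⟨_, hR.const c, Set.subset_insert _ _, Set.singleton_subset_iff.2 (Set.mem_insert _ _)⟩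

/-- Padding by a useless constant. `Computes` counts instructions exactly; this makes the counts of
`Reach` behave as upper bounds. -/
theorem succ (h : Reach A c F) : Reach A (c + 1) F := by
  have := h.union (const A 0)
  intro inputs m R hR hA
  obtain ⟨R₁, h1, h2, h3⟩ := this inputs m R hR hA
  exact ⟨R₁, h1, h2, Set.subset_union_left.trans h3⟩

theorem mono (h : Reach A c F) (hc : c ≤ c') : Reach A c' F := by
  induction hc with
  | refl => exact h
  | step _ ih => exact ih.succ

theorem binary {op : ℝ → ℝ → ℝ}
    (hop : ∀ (inputs : Set (D → ℝ)) (m : ℕ) (R : Set (D → ℝ)) (f g : D → ℝ),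
      Computes inputs m R → f ∈ R → g ∈ R →
      Computes inputs (m + 1) (insert (fun z => op (f z) (g z)) R))
    (hf : Reach A c {f}) (hg : Reach A c' {g}) :
    Reach A (c + c' + 1) {fun z => op (f z) (g z)} := by
  refine (hf.union hg).trans fun inputs m R hR hA => ⟨_, hop inputs m R f g hR ?_ ?_,
    Set.subset_insert _ _, Set.singleton_subset_iff.2 (Set.mem_insert _ _)⟩
  · exact hA (Or.inr (Or.inl rfl))
  · exact hA (Or.inr (Or.inr rfl))

theorem add (hf : Reach A c {f}) (hg : Reach A c' {g}) :
    Reach A (c + c' + 1) {fun z => f z + g z} :=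
  binary (op := fun x y => x + y) (fun _ _ _ _ _ h h1 h2 => h.add h1 h2) hf hg

theorem sub (hf : Reach A c {f}) (hg : Reach A c' {g}) :
    Reach A (c + c' + 1) {fun z => f z - g z} :=
  binary (op := fun x y => x - y) (fun _ _ _ _ _ h h1 h2 => h.sub h1 h2) hf hg

theorem mul (hf : Reach A c {f}) (hg : Reach A c' {g}) :
    Reach A (c + c' + 1) {fun z => f z * g z} :=
  binary (op := fun x y => x * y) (fun _ _ _ _ _ h h1 h2 => h.mul h1 h2) hf hg

theorem div (hf : Reach A c {f}) (hg : Reach A c' {g}) :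
    Reach A (c + c' + 1) {fun z => f z / g z} :=
  binary (op := fun x y => x / y) (fun _ _ _ _ _ h h1 h2 => h.div h1 h2) hf hg

theorem exp (hf : Reach A c {f}) : Reach A (c + 1) {fun z => Real.exp (f z)} :=
  hf.trans fun _ _ _ hR hA => ⟨_, hR.exp (hA (Or.inr rfl)),
    Set.subset_insert _ _, Set.singleton_subset_iff.2 (Set.mem_insert _ _)⟩

theorem sum {ι : Type*} (s : Finset ι) {f : ι → D → ℝ} (h : ∀ j ∈ s, Reach A c {f j}) :
    Reach A (s.card * (c + 1) + 1) {fun z => ∑ j ∈ s, f j z} := by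
  classical
  induction s using Finset.induction_on with
  | empty => simpa using const A 0
  | insert j s hj ih =>
    have := (h j (Finset.mem_insert_self j s)).add
      (ih fun l hl => h l (Finset.mem_insert_of_mem hl))
    simp only [Finset.sum_insert hj, Finset.card_insert_of_notMem hj]
    exact this.mono (by ring_nf; omega)

theorem prod {ι : Type*} (s : Finset ι) {f : ι → D → ℝ} (h : ∀ j ∈ s, Reach A c {f j}) :
    Reach A (s.card * (c + 1) + 1) {fun z => ∏ j ∈ s, f j z} := by
  classical
  induction s using Finset.induction_on with
  | empty => simpa using const A 1
  | insert j s hj ih =>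
    have := (h j (Finset.mem_insert_self j s)).mul
      (ih fun l hl => h l (Finset.mem_insert_of_mem hl))
    simp only [Finset.prod_insert hj, Finset.card_insert_of_notMem hj]
    exact this.mono (by ring_nf; omega)

theorem biUnion {ι : Type*} (s : Finset ι) {F : ι → Set (D → ℝ)}
    (h : ∀ j ∈ s, Reach A c (F j)) : Reach A (s.card * c) (⋃ j ∈ s, F j) := by
  classical
  induction s using Finset.induction_on with
  | empty => simpa using of_subset (Set.empty_subset A)
  | insert j s hj ih =>
    have := (h j (Finset.mem_insert_self j s)).union
      (ih fun l hl => h l (Finset.mem_insert_of_mem hl))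
    rw [Finset.set_biUnion_insert, Finset.card_insert_of_notMem hj]
    exact this.mono (by ring_nf; omega)

end Reach

/-! ### The instruction count of exponentiated gradient descent -/

section Program

variable {n T : ℕ} {N : Fin n → Finset (Fin n)} {i : Fin n} {k L : ℕ} {lam a : ℝ}
  {A : Set ((Fin n → Fin T → Config n) → ℝ)}

theorem reach_chi (hA : dataInputs T N ⊆ A) {S : Finset (Fin n)} (hS : S ⊆ N i)
    (hk : S.card ≤ L) (m : Fin T) : Reach A (L + 1) {fun z => chi S (z i m)} := by
  have := Reach.prod (A := A) (c := 0) S (f := fun j z => spin (z i m) j) fun j hj =>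
    Reach.of_mem (hA ⟨i, m, j, Finset.mem_insert_of_mem (hS hj), rfl⟩)
  exact this.mono (by omega)

theorem reach_hedgeWeight {F : Finset (Finset (Fin n))} (hF : F.card ≤ L)
    {G : (Fin n → Fin T → Config n) → Finset (Fin n) → ℝ}
    (hG : ∀ S ∈ F, (fun z => G z S) ∈ A) :
    Reach A (8 * L + 1) {fun z => hedgeWeight F a (G z)} := by
  have h : ∀ S ∈ F, Reach A 7
      {fun z => Real.exp (-(a * G z S)) + Real.exp (a * G z S)} := by
    intro S hS
    have h1 := ((Reach.const A (-a)).mul (Reach.of_mem (hG S hS))).exp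
    have h2 := ((Reach.const A a).mul (Reach.of_mem (hG S hS))).exp
    simpa only [neg_mul] using h1.add h2
  exact (Reach.sum F h).mono (by nlinarith)

theorem reach_hedgePoly {F : Finset (Finset (Fin n))} (hF : F.card ≤ L)
    {G : (Fin n → Fin T → Config n) → Finset (Fin n) → ℝ}
    (hG : ∀ S ∈ F, (fun z => G z S) ∈ A) {S : Finset (Fin n)} (hS : S ∈ F) :
    Reach A (8 * L + 11) {fun z => hedgePoly F lam a (G z) S} := by
  have h1 := ((Reach.const A (-a)).mul (Reach.of_mem (hG S hS))).exp
  have h2 := ((Reach.const A a).mul (Reach.of_mem (hG S hS))).exp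
  have h3 := ((Reach.const A lam).mul (h1.sub h2)).div (reach_hedgeWeight (a := a) hF hG)
  simp only [hedgePoly, if_pos hS]
  simp only [neg_mul] at h3
  exact h3.mono (by omega)

/-- Nothing is shared between the coefficients: the normalizing weight is recomputed for each of
them. The single parameter L bounds all relevant sizes, so such waste only raises a power of L. -/
theorem reach_eval_hedgePoly (hA : dataInputs T N ⊆ A) (hF : (monos (N i) k).card ≤ L)
    (hk : k ≤ L) (hL : 1 ≤ L) {G : (Fin n → Fin T → Config n) → Finset (Fin n) → ℝ}
    (hG : ∀ S ∈ monos (N i) k, (fun z => G z S) ∈ A) (m : Fin T) :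
    Reach A (24 * L ^ 2) {fun z => (hedgePoly (monos (N i) k) lam a (G z)).eval (z i m)} := by
  have h : ∀ S ∈ monos (N i) k, Reach A (9 * L + 13)
      {fun z => hedgePoly (monos (N i) k) lam a (G z) S * chi S (z i m)} := fun S hS =>
    ((reach_hedgePoly hF hG hS).mul (reach_chi hA (mem_monos.1 hS).1
      ((mem_monos.1 hS).2.trans hk) m)).mono (by omega)
  have h1 := Reach.sum _ h
  have h2 : (fun z : Fin n → Fin T → Config n =>
        (hedgePoly (monos (N i) k) lam a (G z)).eval (z i m))
      = fun z => ∑ S ∈ monos (N i) k,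
        hedgePoly (monos (N i) k) lam a (G z) S * chi S (z i m) := by
    funext z
    rw [MPoly.eval_eq_sum_chi]
    refine (Finset.sum_subset (Finset.subset_univ _) fun S _ hS => ?_).symm
    simp [hedgePoly, hS]
  rw [h2]
  refine h1.mono ?_
  have : (monos (N i) k).card * (9 * L + 13 + 1) ≤ L * (9 * L + 13 + 1) :=
    Nat.mul_le_mul_right _ hF
  nlinarith

theorem reach_score_hedgePoly (hA : dataInputs T N ⊆ A) (hF : (monos (N i) k).card ≤ L)
    (hk : k ≤ L) (hL : 1 ≤ L) {G : (Fin n → Fin T → Config n) → Finset (Fin n) → ℝ}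
    (hG : ∀ S ∈ monos (N i) k, (fun z => G z S) ∈ A) {S : Finset (Fin n)}
    (hS : S ∈ monos (N i) k) (m : Fin T) :
    Reach A (36 * L ^ 2)
      {fun z => score i (hedgePoly (monos (N i) k) lam a (G z)) S (z i m)} := by
  have hs : Reach A 0 {fun z => spin (z i m) i} :=
    Reach.of_mem (hA ⟨i, m, i, Finset.mem_insert_self _ _, rfl⟩)
  have h1 := (((Reach.const A 2).mul hs).mul
    (reach_eval_hedgePoly (lam := lam) (a := a) hA hF hk hL hG m)).exp
  have h2 := (Reach.const A 1).div ((Reach.const A 1).add h1)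
  have h3 := (hs.mul h2).mul (reach_chi hA (mem_monos.1 hS).1 ((mem_monos.1 hS).2.trans hk) m)
  simp only [score, sigm, neg_neg]
  exact h3.mono (by nlinarith)

theorem reach_hedgeGrad_succ (hA : dataInputs T N ⊆ A) (hF : (monos (N i) k).card ≤ L)
    (hk : k ≤ L) (hL : 1 ≤ L) (hT : T ≤ L) {r : ℕ}
    (hG : ∀ S ∈ monos (N i) k, (fun z => hedgeGrad i (monos (N i) k) lam a (z i) r S) ∈ A)
    {S : Finset (Fin n)} (hS : S ∈ monos (N i) k) :
    Reach A (41 * L ^ 3) {fun z => hedgeGrad i (monos (N i) k) lam a (z i) (r + 1) S} := by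
  have h1 := Reach.sum (A := A) Finset.univ fun (m : Fin T) _ =>
    reach_score_hedgePoly (lam := lam) (a := a) hA hF hk hL hG hS m
  have h2 := (Reach.of_mem (hG S hS)).add ((Reach.const A (-(2 / (T : ℝ)))).mul h1)
  simp only [hedgeGrad, lossGrad]
  refine h2.mono ?_
  rw [Finset.card_univ, Fintype.card_fin]
  have h3 : T * (36 * L ^ 2 + 1) ≤ L * (36 * L ^ 2 + 1) := Nat.mul_le_mul_right _ hT
  have h4 : 1 ≤ L ^ 3 := Nat.one_le_pow _ _ hL
  have h5 : L ≤ L ^ 3 := Nat.le_self_pow (by norm_num) L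
  nlinarith

/-- The accumulated gradients of all rounds stay in registers. A round adds at most L coordinates,
each at cost 41L³; round 0 is one constant 0 shared by all coordinates. -/
theorem reach_hedgeGrad (hA : dataInputs T N ⊆ A) (hF : (monos (N i) k).card ≤ L)
    (hk : k ≤ L) (hL : 1 ≤ L) (hT : T ≤ L) (lam a : ℝ) (R : ℕ) :
    Reach A (41 * L ^ 4 * R + 1) {f | ∃ r ≤ R, ∃ S ∈ monos (N i) k,
      f = fun z => hedgeGrad i (monos (N i) k) lam a (z i) r S} := by
  induction R with
  | zero =>
    have h := Reach.const A 0
    rw [mul_zero, zero_add]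
    intro inputs m R hR hAR
    obtain ⟨R', h1, h2, h3⟩ := h inputs m R hR hAR
    refine ⟨R', h1, h2, ?_⟩
    rintro f ⟨r, hr, S, -, rfl⟩
    obtain rfl : r = 0 := by omega
    exact h3 rfl
  | succ R ih =>
    set St := {f | ∃ r ≤ R, ∃ S ∈ monos (N i) k,
      f = fun z : Fin n → Fin T → Config n => hedgeGrad i (monos (N i) k) lam a (z i) r S}
    have hSt : ∀ S ∈ monos (N i) k,
        (fun z => hedgeGrad i (monos (N i) k) lam a (z i) R S) ∈ St := fun S hS =>
      ⟨R, le_rfl, S, hS, rfl⟩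
    have h1 := Reach.biUnion (A := A ∪ St) (monos (N i) k) fun S hS =>
      reach_hedgeGrad_succ (A := A ∪ St) (lam := lam) (a := a) (r := R)
        (hA.trans Set.subset_union_left)
        hF hk hL hT (fun S hS => Or.inr (hSt S hS)) hS
    have h2 := ih.trans ((Reach.of_subset (F := St) Set.subset_union_right).union h1)
    have hc : (monos (N i) k).card * (41 * L ^ 3) ≤ L * (41 * L ^ 3) :=
      Nat.mul_le_mul_right _ hF
    refine Reach.mono (c := 41 * L ^ 4 * R + 1 + (0 + (monos (N i) k).card * (41 * L ^ 3)))
      ?_ (by nlinarith)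
    intro inputs m R₀ hR hAR
    obtain ⟨R', h3, h4, h5⟩ := h2 inputs m R₀ hR hAR
    refine ⟨R', h3, h4, ?_⟩
    rintro f ⟨r, hr, S, hS, rfl⟩
    apply h5
    rcases Nat.lt_or_ge r (R + 1) with h | h
    · exact Or.inl ⟨r, by omega, S, hS, rfl⟩
    · obtain rfl : r = R + 1 := by omega
      right
      simp only [Set.mem_iUnion]
      exact ⟨S, hS, rfl⟩

theorem reach_hedgeAvg (hA : dataInputs T N ⊆ A) (hF : (monos (N i) k).card ≤ L)
    (hk : k ≤ L) (hL : 1 ≤ L) (hT : T ≤ L) (lam a : ℝ) {R : ℕ} (hR : 1 ≤ R) :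
    Reach A (67 * L ^ 4 * R) {f | ∃ S ∈ monos (N i) k,
      f = fun z => hedgeAvg i (monos (N i) k) lam a R (z i) S} := by
  set St := {f | ∃ r ≤ R, ∃ S ∈ monos (N i) k,
      f = fun z : Fin n → Fin T → Config n => hedgeGrad i (monos (N i) k) lam a (z i) r S}
  have h1 : ∀ S ∈ monos (N i) k, Reach (A ∪ St) (R * (8 * L + 11 + 1) + 1 + 2)
      {fun z => hedgeAvg i (monos (N i) k) lam a R (z i) S} := by
    intro S hS
    have h2 := Reach.sum (A := A ∪ St) (Finset.range R) fun r hr =>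
      reach_hedgePoly (lam := lam) (a := a) hF
        (G := fun z S => hedgeGrad i (monos (N i) k) lam a (z i) r S)
        (fun S hS => Or.inr ⟨r, (Finset.mem_range.1 hr).le, S, hS, rfl⟩) hS
    rw [Finset.card_range] at h2
    exact ((Reach.const _ (1 / (R : ℝ))).mul h2).mono (by omega)
  have h2 := (reach_hedgeGrad (i := i) hA hF hk hL hT lam a R).trans
    (Reach.biUnion (monos (N i) k) h1)
  have h3 : (⋃ S ∈ monos (N i) k, {fun z : Fin n → Fin T → Config n =>
      hedgeAvg i (monos (N i) k) lam a R (z i) S}) = {f | ∃ S ∈ monos (N i) k,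
      f = fun z => hedgeAvg i (monos (N i) k) lam a R (z i) S} := by
    ext f; simp
  rw [h3] at h2
  refine h2.mono ?_
  have h4 : (monos (N i) k).card * (R * (8 * L + 11 + 1) + 1 + 2)
      ≤ L * (R * (8 * L + 11 + 1) + 1 + 2) := Nat.mul_le_mul_right _ hF
  have h5 : L * (R * (8 * L + 11 + 1) + 1 + 2) ≤ 23 * (L ^ 4 * R) := by
    have h6 : R * (8 * L + 11 + 1) + 1 + 2 ≤ 23 * (L * R) := by nlinarith
    have h7 : L ^ 2 * R ≤ L ^ 4 * R :=
      Nat.mul_le_mul_right _ (Nat.pow_le_pow_right hL (by norm_num))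
    nlinarith [Nat.mul_le_mul_left L h6]
  have h6 : 1 ≤ L ^ 4 * R := Nat.mul_pos (Nat.pow_pos hL) hR
  nlinarith

theorem exists_computes_assemble_hedgeAvg (hn : 1 ≤ n) (hF : ∀ i, (monos (N i) k).card ≤ L)
    (hk : k ≤ L) (hL : 1 ≤ L) (hT : T ≤ L) (lam a : ℝ) {R : ℕ} (hR : 1 ≤ R) :
    ∃ Q : Set ((Fin n → Fin T → Config n) → ℝ),
      Computes (dataInputs T N) (n * (68 * L ^ 4 * R)) Q ∧
      ∀ S, (fun z => assemble (fun i => hedgeAvg i (monos (N i) k) lam a R (z i)) S) ∈ Q := by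
  have h1 := Reach.biUnion (A := dataInputs T N) Finset.univ fun (i : Fin n) _ =>
    reach_hedgeAvg (i := i) subset_rfl (hF i) hk hL hT lam a hR
  have h2 := h1.union (Reach.const _ 0)
  have h3 : Reach (dataInputs T N) (n * (68 * L ^ 4 * R)) _ := h2.mono (by
    rw [Finset.card_univ, Fintype.card_fin]
    have h6 : 1 ≤ n * (L ^ 4 * R) := Nat.mul_pos hn (Nat.mul_pos (Nat.pow_pos hL) hR)
    nlinarith)
  obtain ⟨Q, h4, -, h5⟩ := h3 _ 0 _ Computes.start subset_rfl
  rw [zero_add] at h4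
  refine ⟨Q, h4, fun S => h5 ?_⟩
  unfold assemble
  by_cases hS : S.Nonempty
  · simp only [dif_pos hS]
    -- A coefficient outside the admissible monomials is identically 0 and is served by the one
    -- extra constant register.
    by_cases hS' : S.erase (S.min' hS) ∈ monos (N (S.min' hS)) k
    · left
      simp only [Set.mem_iUnion]
      exact ⟨S.min' hS, Finset.mem_univ _, _, hS', rfl⟩
    · right
      rw [Set.mem_singleton_iff]
      funext z
      simp [hedgeAvg, hedgePoly, hS']
  · right
    simp only [dif_neg hS, Set.mem_singleton_iff]

end Program

end

end GlauberMRF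

namespace GlauberMRF

noncomputable section

open MeasureTheory

/-! ### Sample size and accuracy -/

/-- The excess loss that can be tolerated when the accuracy `ε` is wanted. -/
def tolerance (d k : ℕ) (lam ε : ℝ) : ℝ :=
  Real.exp (-(2 * lam)) / 8 * spread d k lam * ε ^ 2

theorem exp_le_natCast_rpow {d : ℕ} (hd : 3 ≤ d) {z : ℝ} (hz : 0 ≤ z) :
    Real.exp z ≤ (d : ℝ) ^ z := by
  have hd' : (3 : ℝ) ≤ d := by exact_mod_cast hd
  have h1 : Real.exp 1 ≤ d := by linarith [Real.exp_one_lt_d9]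
  rw [← Real.exp_one_rpow z]
  exact Real.rpow_le_rpow (Real.exp_pos 1).le h1 hz

theorem succ_pow_le_rpow {d : ℕ} (hd : 3 ≤ d) (k : ℕ) :
    ((d : ℝ) + 1) ^ k ≤ (d : ℝ) ^ (2 * (k : ℝ)) := by
  have hd' : (3 : ℝ) ≤ d := by exact_mod_cast hd
  rw [Real.rpow_mul (by linarith), Real.rpow_natCast]
  refine pow_le_pow_left₀ (by linarith) ?_ k
  rw [Real.rpow_two]
  nlinarith

theorem spread_pos {d : ℕ} (hd : 3 ≤ d) (k : ℕ) (lam : ℝ) : 0 < spread d k lam := by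
  have hd' : (3 : ℝ) ≤ d := by exact_mod_cast hd
  unfold spread
  positivity

theorem tolerance_pos {d : ℕ} (hd : 3 ≤ d) (k : ℕ) (lam : ℝ) {ε : ℝ} (hε : 0 < ε) :
    0 < tolerance d k lam ε := by
  have := spread_pos hd k lam
  unfold tolerance
  positivity

/-- All factors of the inverse are converted into powers of d. The exponents 2, 2, 3k and 6k² add up
to at most 13k², and 2λ + 2λk to at most 4λk². -/
theorem one_le_rpow_mul_spread {d k : ℕ} (hd : 3 ≤ d) (hk : 1 ≤ k) {lam : ℝ} (hlam : 0 ≤ lam) :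
    1 ≤ (d : ℝ) ^ ((13 + 4 * lam) * (k : ℝ) ^ 2) *
      (Real.exp (-(2 * lam)) / 8 * spread d k lam) := by
  have hd' : (3 : ℝ) ≤ d := by exact_mod_cast hd
  have hd0 : (0 : ℝ) < d := by linarith
  have hd1 : (1 : ℝ) ≤ d := by linarith
  have hk' : (1 : ℝ) ≤ k := by exact_mod_cast hk
  have h1 : Real.exp (-(2 * lam)) / 8 * spread d k lam =
      (8 * Real.exp (2 * lam) * ((1 + d) * (6 * d * Real.exp (2 * lam)) ^ k
        * (1 + (d + 1) ^ k) ^ (2 * k)))⁻¹ := by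
    have h2 : (Real.exp (-(2 * lam)) / (6 * d)) ^ k
        = ((6 * d * Real.exp (2 * lam)) ^ k)⁻¹ := by
      rw [← inv_pow, Real.exp_neg]; congr 1; field_simp
    unfold spread
    rw [h2, Real.exp_neg]
    have := Real.exp_pos (2 * lam)
    field_simp
  have e1 : (8 : ℝ) ≤ d ^ (2 : ℝ) := by rw [Real.rpow_two]; nlinarith
  have e2 : Real.exp (2 * lam) ≤ (d : ℝ) ^ (2 * lam) := exp_le_natCast_rpow hd (by linarith)
  have e3 : (1 + d : ℝ) ≤ (d : ℝ) ^ (2 : ℝ) := by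
    have := mul_le_mul_of_nonneg_right hd' hd0.le
    rw [Real.rpow_two, sq]
    linarith
  have e4 : (6 * d * Real.exp (2 * lam)) ^ k ≤ (d : ℝ) ^ ((3 + 2 * lam) * k) := by
    rw [Real.rpow_mul hd0.le, Real.rpow_natCast]
    refine pow_le_pow_left₀ (by positivity) ?_ k
    rw [Real.rpow_add hd0]
    refine mul_le_mul ?_ e2 (Real.exp_pos _).le (by positivity)
    have : (d : ℝ) ^ (3 : ℝ) = d ^ 3 := by exact_mod_cast Real.rpow_natCast (d : ℝ) 3
    rw [this]
    nlinarith [sq_nonneg ((d : ℝ) - 3)]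
  have e5 : (1 + (d + 1 : ℝ) ^ k) ^ (2 * k) ≤ (d : ℝ) ^ ((3 * k) * (2 * k : ℕ) : ℝ) := by
    rw [Real.rpow_mul hd0.le, Real.rpow_natCast]
    refine pow_le_pow_left₀ (by positivity) ?_ _
    have h2 := succ_pow_le_rpow hd k
    have h3 : (1 : ℝ) ≤ (d : ℝ) ^ (2 * (k : ℝ)) := Real.one_le_rpow hd1 (by positivity)
    calc _ ≤ d * (d : ℝ) ^ (2 * (k : ℝ)) := by nlinarith
      _ = (d : ℝ) ^ (1 + 2 * (k : ℝ)) := by rw [Real.rpow_add hd0, Real.rpow_one]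
      _ ≤ _ := Real.rpow_le_rpow_of_exponent_le hd1 (by linarith)
  rw [h1, ← div_eq_mul_inv, one_le_div (by positivity)]
  calc _ ≤ (d : ℝ) ^ (2 : ℝ) * (d : ℝ) ^ (2 * lam) * ((d : ℝ) ^ (2 : ℝ) *
        (d : ℝ) ^ ((3 + 2 * lam) * k) * (d : ℝ) ^ ((3 * k) * (2 * k : ℕ) : ℝ)) := by gcongr
    _ = (d : ℝ) ^ (2 + 2 * lam + (2 + (3 + 2 * lam) * k + (3 * k) * (2 * k : ℕ)) : ℝ) := by
        rw [← Real.rpow_add hd0, ← Real.rpow_add hd0, ← Real.rpow_add hd0, ← Real.rpow_add hd0]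
    _ ≤ _ := by
        refine Real.rpow_le_rpow_of_exponent_le hd1 ?_
        push_cast
        have hk2 : (k : ℝ) ≤ k ^ 2 := by nlinarith
        have hl2 : lam * k ≤ lam * k ^ 2 := mul_le_mul_of_nonneg_left hk2 hlam
        have hl3 : lam ≤ lam * k ^ 2 := le_mul_of_one_le_right hlam (by linarith)
        nlinarith

theorem log_four_mul_div_le {d k : ℕ} (hd : 3 ≤ d) (hk : 1 ≤ k) {δ : ℝ} (hδ : 0 < δ)
    (hδ1 : δ < 1) :
    Real.log (4 * (((d : ℝ) + 1) ^ k) ^ 2 / δ) ≤ 6 * k * Real.log (d / δ) := by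
  have hd' : (3 : ℝ) ≤ d := by exact_mod_cast hd
  have h1 : 6 * (k : ℝ) * Real.log (d / δ) = Real.log ((d / δ) ^ (6 * k)) := by
    rw [Real.log_pow]; push_cast; ring
  rw [h1]
  refine Real.log_le_log (by positivity) ?_
  have h2 : δ ^ (6 * k) ≤ δ := pow_le_of_le_one hδ.le hδ1.le (by omega)
  have h3 : 4 * (((d : ℝ) + 1) ^ k) ^ 2 ≤ (d : ℝ) ^ (6 * k) := by
    have h4 : ((d : ℝ) + 1) ^ k ≤ (d : ℝ) ^ (2 * k) := by
      rw [pow_mul]; exact pow_le_pow_left₀ (by linarith) (by nlinarith) k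
    calc 4 * (((d : ℝ) + 1) ^ k) ^ 2 ≤ (d : ℝ) ^ 2 * ((d : ℝ) ^ (2 * k)) ^ 2 := by
          gcongr; nlinarith
      _ = (d : ℝ) ^ (2 + 4 * k) := by rw [← pow_mul, ← pow_add]; congr 1; ring
      _ ≤ _ := pow_le_pow_right₀ (by linarith) (by omega)
  rw [div_pow]
  gcongr

/-- The constant of the theorem. -/
def mainConst (lam₀ : ℝ) : ℝ := 45 / lam₀ + 10

theorem ten_le_mainConst {lam₀ : ℝ} (h : 0 < lam₀) : 10 ≤ mainConst lam₀ := by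
  unfold mainConst
  linarith [div_pos (by norm_num : (0 : ℝ) < 45) h]

/-- Additive constants in the exponent of d are absorbed into Cλk² because λ is bounded below. The
numbers 45 and 10 are those required by `instruction_count_le`, the more demanding of the two uses.
-/
theorem le_mainConst_mul {lam₀ lam : ℝ} (h : 0 < lam₀) (hlam : lam₀ ≤ lam) :
    45 + 10 * lam ≤ mainConst lam₀ * lam := by
  have : 45 ≤ 45 / lam₀ * lam := by
    rw [div_mul_eq_mul_div, le_div_iff₀ h]
    linarith
  unfold mainConst
  linarith

theorem rpow_le_rpow_mainConst {d k : ℕ} (hd : 3 ≤ d) {lam₀ lam : ℝ}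
    (h : 0 < lam₀) (hlam : lam₀ ≤ lam) {t : ℝ} (ht : t ≤ (45 + 10 * lam) * (k : ℝ) ^ 2) :
    (d : ℝ) ^ t ≤ (d : ℝ) ^ (mainConst lam₀ * lam * (k : ℝ) ^ 2) := by
  refine Real.rpow_le_rpow_of_exponent_le (by exact_mod_cast (by omega : 1 ≤ d)) (ht.trans ?_)
  exact mul_le_mul_of_nonneg_right (le_mainConst_mul h hlam) (sq_nonneg _)

theorem rate_pos {C : ℝ} {k d : ℕ} {lam ε δ : ℝ} (hd : 3 ≤ d) (hk : 1 ≤ k) (hlam : 0 < lam)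
    (hε : 0 < ε) (hδ : 0 < δ) (hδ1 : δ < 1) : 0 < rate C k d lam ε δ := by
  have hd' : (3 : ℝ) ≤ d := by exact_mod_cast hd
  have hk' : (1 : ℝ) ≤ k := by exact_mod_cast hk
  have : 0 < Real.log (d / δ) := Real.log_pos (by rw [one_lt_div hδ]; linarith)
  unfold rate
  positivity

/-- The logarithmic factor is at least 1, so the proof needs only T ≥ A. -/
theorem rate_le_sampleBound {C : ℝ} (hC : 1 ≤ C) {k d : ℕ} {lam ε δ : ℝ} (hd : 3 ≤ d)
    (hk : 1 ≤ k) (hlam : 0 < lam) (hε : 0 < ε) (hδ : 0 < δ) (hδ1 : δ < 1) :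
    rate C k d lam ε δ ≤ sampleBound C k d lam ε δ := by
  have h0 := rate_pos (C := C) hd hk hlam hε hδ hδ1
  have h1 : 1 ≤ Real.log (3 + rate C k d lam ε δ) := by
    rw [Real.le_log_iff_exp_le (by linarith)]
    linarith [Real.exp_one_lt_d9]
  have h2 : 1 ≤ (Real.log (3 + rate C k d lam ε δ)) ^ C := Real.one_le_rpow h1 (by linarith)
  unfold sampleBound
  nlinarith [mul_le_mul_of_nonneg_right hC h0.le, mul_pos (by linarith : 0 < C) h0]

theorem confidence_le {lam₀ : ℝ} (hlam₀ : 0 < lam₀) {k d T : ℕ} {lam ε δ : ℝ} (hd : 3 ≤ d)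
    (hk : 1 ≤ k) (hlam : lam₀ ≤ lam) (hε : 0 < ε) (hδ : 0 < δ) (hδ1 : δ < 1)
    (hT : sampleBound (mainConst lam₀) k d lam ε δ ≤ T) :
    4 * (((d : ℝ) + 1) ^ k) ^ 2 *
      Real.exp (-(T * (tolerance d k lam ε / (4 * lam + lam ^ 2)) ^ 2 / 16)) ≤ δ := by
  have hl : 0 < lam := hlam₀.trans_le hlam
  have hd' : (3 : ℝ) ≤ d := by exact_mod_cast hd
  have hd0 : (0 : ℝ) < d := by linarith
  have hk' : (1 : ℝ) ≤ k := by exact_mod_cast hk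
  set E := (d : ℝ) ^ ((13 + 4 * lam) * (k : ℝ) ^ 2) with hE
  have hE0 : 0 < E := by positivity
  set g := Real.exp (-(2 * lam)) / 8 * spread d k lam with hg
  have hg0 : 0 < g := by have := spread_pos hd k lam; positivity
  have hEg : 1 ≤ E * g := one_le_rpow_mul_spread hd hk hl.le
  set l := Real.log (d / δ) with hlog
  have hl0 : 0 < l := Real.log_pos (by rw [one_lt_div hδ]; linarith)
  have hT1 : rate (mainConst lam₀) k d lam ε δ ≤ T :=
    (rate_le_sampleBound (by linarith [ten_le_mainConst hlam₀]) hd hk hl hε hδ hδ1).trans hT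
  -- The 96 is 16·6: the denominator in the Azuma exponent times the constant of
  -- `log_four_mul_div_le`. The factor (4 + λ)² comes from squaring 4λ + λ² and splitting off λ².
  have hpow : 96 * (4 + lam) ^ 2 * E ^ 2
      ≤ (d : ℝ) ^ (mainConst lam₀ * lam * (k : ℝ) ^ 2) := by
    have e1 : (4 + lam) ^ 2 ≤ 16 * (d : ℝ) ^ (2 * lam) := by
      have h1 := Real.add_one_le_exp lam
      calc (4 + lam) ^ 2 ≤ (4 * Real.exp lam) ^ 2 :=
            pow_le_pow_left₀ (by linarith) (by linarith) 2
        _ = 16 * Real.exp (2 * lam) := by rw [mul_pow, ← Real.exp_nat_mul]; norm_num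
        _ ≤ _ := by
          have := exp_le_natCast_rpow hd (z := 2 * lam) (by linarith)
          linarith
    have e2 : (96 * 16 : ℝ) ≤ (d : ℝ) ^ (8 : ℝ) := by
      have : (d : ℝ) ^ (8 : ℝ) = d ^ 8 := by exact_mod_cast Real.rpow_natCast (d : ℝ) 8
      rw [this]
      exact le_trans (by norm_num) (pow_le_pow_left₀ (by norm_num) hd' 8)
    have e3 : E ^ 2 = (d : ℝ) ^ ((26 + 8 * lam) * (k : ℝ) ^ 2) := by
      rw [hE, ← Real.rpow_natCast, ← Real.rpow_mul hd0.le]; congr 1; push_cast; ring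
    calc 96 * (4 + lam) ^ 2 * E ^ 2 ≤ 96 * (16 * (d : ℝ) ^ (2 * lam)) * E ^ 2 := by gcongr
      _ = (96 * 16) * (d : ℝ) ^ (2 * lam) * E ^ 2 := by ring
      _ ≤ (d : ℝ) ^ (8 : ℝ) * (d : ℝ) ^ (2 * lam) * E ^ 2 := by gcongr
      _ = (d : ℝ) ^ (8 + 2 * lam + (26 + 8 * lam) * (k : ℝ) ^ 2) := by
          rw [e3, ← Real.rpow_add hd0, ← Real.rpow_add hd0]
      _ ≤ _ := rpow_le_rpow_mainConst hd hlam₀ hlam (by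
          nlinarith [one_le_pow₀ hk' (n := 2),
            mul_le_mul_of_nonneg_left (one_le_pow₀ hk' (n := 2)) hl.le])
  have hbound : 16 * (6 * k * l) ≤ T * (g * ε ^ 2 / (4 * lam + lam ^ 2)) ^ 2 := by
    have h1 : lam ^ 2 * k * l * (96 * (4 + lam) ^ 2 * E ^ 2) / ε ^ 4 ≤ T := by
      refine le_trans ?_ hT1
      unfold rate
      gcongr
    have h2 : 4 * lam + lam ^ 2 = lam * (4 + lam) := by ring
    calc 16 * (6 * k * l) ≤ 16 * (6 * k * l) * (E * g) ^ 2 :=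
          le_mul_of_one_le_right (by positivity) (one_le_pow₀ hEg)
      _ = lam ^ 2 * k * l * (96 * (4 + lam) ^ 2 * E ^ 2) / ε ^ 4
            * (g * ε ^ 2 / (4 * lam + lam ^ 2)) ^ 2 := by
          rw [h2]; field_simp; ring
      _ ≤ _ := mul_le_mul_of_nonneg_right h1 (sq_nonneg _)
  have h1 := log_four_mul_div_le hd hk hδ hδ1
  have h2 : Real.log (4 * (((d : ℝ) + 1) ^ k) ^ 2 / δ)
      ≤ T * (tolerance d k lam ε / (4 * lam + lam ^ 2)) ^ 2 / 16 := by
    rw [le_div_iff₀ (by norm_num)]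
    unfold tolerance
    linarith
  rw [Real.exp_neg, ← div_eq_mul_inv, div_le_iff₀ (Real.exp_pos _)]
  rw [Real.log_le_iff_le_exp (by positivity), div_le_iff₀ hδ] at h2
  linarith

theorem natCast_pos_of_sampleBound_le {lam₀ : ℝ} (hlam₀ : 0 < lam₀) {k d T : ℕ} {lam ε δ : ℝ}
    (hd : 3 ≤ d) (hk : 1 ≤ k) (hlam : lam₀ ≤ lam) (hε : 0 < ε) (hδ : 0 < δ) (hδ1 : δ < 1)
    (hT : sampleBound (mainConst lam₀) k d lam ε δ ≤ T) : 0 < T := by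
  have hl : 0 < lam := hlam₀.trans_le hlam
  have h1 := rate_le_sampleBound (C := mainConst lam₀) (by linarith [ten_le_mainConst hlam₀])
    hd hk hl hε hδ hδ1
  have h2 := rate_pos (C := mainConst lam₀) hd hk hl hε hδ hδ1
  exact_mod_cast h2.trans_le (h1.trans hT)

/-- With high probability, every feasible polynomial with almost minimal loss is accurate. -/
theorem IsGlauber.measure_inaccurate_le {lam₀ : ℝ} (hlam₀ : 0 < lam₀) {n k d T : ℕ}
    {lam ε δ : ℝ} (hd : 3 ≤ d) (hk : 1 ≤ k) (hlam : lam₀ ≤ lam) (hε : 0 < ε) (hδ : 0 < δ)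
    (hδ1 : δ < 1) (hT : sampleBound (mainConst lam₀) k d lam ε δ ≤ T) {ψ : MPoly n}
    (hM : IsMRF k d lam ψ) {Ω : Type*} [MeasurableSpace Ω] {P : Measure Ω}
    [IsProbabilityMeasure P] {X : ℕ → Ω → Config n} {U : ℕ → Ω → Fin n}
    (hG : IsGlauber ψ P X U) (i : Fin n) :
    P {ω | ¬ ∀ p ∈ feasible (neighbors ψ i) k lam,
      empLoss i (samples d X U i T ω) p
        ≤ empLoss i (samples d X U i T ω) (ψ.pderiv i) + tolerance d k lam ε →
      (p - ψ.pderiv i).supNorm ≤ ε} ≤ ENNReal.ofReal δ := by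
  have hl : 0 < lam := hlam₀.trans_le hlam
  have ht := tolerance_pos hd k lam hε
  -- The deviation terms then sum to at most one `tolerance`. The admitted excess loss is another,
  -- and two of them equal (c/4)·`spread`·ε², which explains the 8 in `tolerance`.
  set η := tolerance d k lam ε / (4 * lam + lam ^ 2) with hη
  have hη0 : 0 ≤ η := by positivity
  refine (measure_mono ?_).trans ((hG.measure_not_typical_le hM hd i T hη0).trans
    (ENNReal.ofReal_le_ofReal (confidence_le hlam₀ hd hk hlam hε hδ hδ1 hT)))
  intro ω hω htyp
  apply hω
  intro p hp hloss
  have h1 := htyp.supNorm_sq_le hM hd hl.le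
    (natCast_pos_of_sampleBound_le hlam₀ hd hk hlam hε hδ hδ1 hT) hη0 hp hloss
  have hs := spread_pos hd k lam
  set c := Real.exp (-(2 * lam)) with hc
  have hc0 : 0 < c := Real.exp_pos _
  have hc1 : c ≤ 1 := Real.exp_le_one_iff.2 (by linarith)
  have h2 : (4 * lam + lam ^ 2) * η = tolerance d k lam ε := by rw [hη]; field_simp
  have h3 : c * lam ^ 2 * η ≤ lam ^ 2 * η := by
    rw [mul_assoc]; exact mul_le_of_le_one_left (by positivity) hc1
  have h4 : tolerance d k lam ε = c / 8 * spread d k lam * ε ^ 2 := rfl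
  have h5 : c / 4 * spread d k lam * (p - ψ.pderiv i).supNorm ^ 2
      ≤ c / 4 * spread d k lam * ε ^ 2 := by linarith
  have h6 := le_of_mul_le_mul_left h5 (by positivity)
  exact (sq_le_sq₀ (MPoly.supNorm_nonneg _) hε.le).1 h6

/-! ### Assembling the nodes and union bounds -/

theorem supNorm_assemble_sub_le {n : ℕ} {p : Fin n → MPoly n} {ψ : MPoly n} {ε : ℝ}
    (hε : 0 ≤ ε) (h : ∀ i, (p i - ψ.pderiv i).supNorm ≤ ε) :
    (assemble p - ψ.dropConst).supNorm ≤ ε := by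
  rw [MPoly.supNorm_le_iff]
  intro S
  rw [Pi.sub_apply]
  unfold assemble
  by_cases hS : S.Nonempty
  · rw [dif_pos hS]
    refine le_trans (le_of_eq ?_) (((p (S.min' hS) - ψ.pderiv (S.min' hS)).supNorm_le_iff _).1
      (h _) (S.erase (S.min' hS)))
    rw [Pi.sub_apply, MPoly.dropConst, Function.update_of_ne hS.ne_empty, MPoly.pderiv,
      if_neg (Finset.notMem_erase _ _), Finset.insert_erase (Finset.min'_mem S hS)]
  · rw [dif_neg hS, Finset.not_nonempty_iff_eq_empty.1 hS]
    simpa [MPoly.dropConst] using hε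

/-- Only subadditivity is used, so the event need not be measurable. -/
theorem one_sub_le_measureReal {Ω : Type*} [MeasurableSpace Ω] {P : Measure Ω}
    [IsProbabilityMeasure P] {δ : ℝ} (hδ : 0 ≤ δ) {p : Ω → Prop}
    (h : P {ω | ¬ p ω} ≤ ENNReal.ofReal δ) : 1 - δ ≤ P.real {ω | p ω} := by
  have h1 : (1 : ENNReal) ≤ P {ω | p ω} + P {ω | ¬ p ω} := by
    rw [← measure_univ (μ := P)]
    refine (measure_mono fun ω _ => ?_).trans (measure_union_le _ _)
    exact em (p ω)
  have h2 := ENNReal.toReal_mono (by finiteness) (h1.trans (add_le_add le_rfl h))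
  rw [ENNReal.toReal_add (by finiteness) (by finiteness), ENNReal.toReal_ofReal hδ,
    ENNReal.toReal_one] at h2
  unfold Measure.real
  linarith

theorem measure_not_forall_fin_le {Ω : Type*} [MeasurableSpace Ω] {P : Measure Ω} {n : ℕ}
    (hn : 1 ≤ n) {δ : ℝ} {p : Fin n → Ω → Prop}
    (h : ∀ i, P {ω | ¬ p i ω} ≤ ENNReal.ofReal (δ / n)) :
    P {ω | ¬ ∀ i, p i ω} ≤ ENNReal.ofReal δ := by
  have hn' : (n : ℝ) ≠ 0 := Nat.cast_ne_zero.2 (by omega)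
  have hsub : {ω | ¬ ∀ i, p i ω} ⊆ ⋃ i ∈ (Finset.univ : Finset (Fin n)), {ω | ¬ p i ω} := by
    intro ω hω
    rw [Set.mem_ofPred_eq, not_forall] at hω
    obtain ⟨i, hi⟩ := hω
    simp only [Set.mem_iUnion]
    exact ⟨i, Finset.mem_univ _, hi⟩
  calc _ ≤ _ := measure_mono hsub
    _ ≤ _ := measure_biUnion_finset_le _ _
    _ ≤ ∑ _i : Fin n, ENNReal.ofReal (δ / n) := Finset.sum_le_sum fun i _ => h i
    _ = ENNReal.ofReal δ := by
        rw [Finset.sum_const, Finset.card_univ, Fintype.card_fin, ← ENNReal.ofReal_nsmul,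
          nsmul_eq_mul, mul_div_cancel₀ _ hn']

/-! ### Accuracy and cost of exponentiated gradient descent -/

/-- The excess loss at which exponentiated gradient descent is stopped. -/
def descentTarget (d k : ℕ) (lam ε : ℝ) : ℝ := min ε (tolerance d k lam ε)

/-- The step size of exponentiated gradient descent. -/
def descentStep (d k : ℕ) (lam ε : ℝ) : ℝ := descentTarget d k lam ε / (32 * lam)

/-- The number of rounds of exponentiated gradient descent. -/
def descentRounds (d k : ℕ) (lam ε : ℝ) : ℕ :=
  ⌈128 * lam ^ 2 * ((d : ℝ) + 1) ^ k / descentTarget d k lam ε ^ 2⌉₊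

theorem descentTarget_pos {d : ℕ} (hd : 3 ≤ d) (k : ℕ) (lam : ℝ) {ε : ℝ} (hε : 0 < ε) :
    0 < descentTarget d k lam ε := lt_min hε (tolerance_pos hd k lam hε)

theorem descentRounds_pos {d : ℕ} (hd : 3 ≤ d) (k : ℕ) {lam ε : ℝ} (hlam : 0 < lam)
    (hε : 0 < ε) : 0 < descentRounds d k lam ε := by
  have := descentTarget_pos hd k lam hε
  exact Nat.ceil_pos.2 (by positivity)

/-- Step size and number of rounds make each of the two regret terms at most half the target. The
crude log x ≤ x is why (d+1)^k, not its logarithm, appears in the number of rounds. -/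
theorem empLoss_descent_le {n d k T : ℕ} (hd : 3 ≤ d) {lam ε : ℝ} (hlam : 0 < lam)
    (hε : 0 < ε) (i : Fin n) {N : Finset (Fin n)} (hN : N.card ≤ d) (Z : Fin T → Config n)
    {q : MPoly n} (hq : q ∈ feasible N k lam) :
    empLoss i Z (hedgeAvg i (monos N k) lam (descentStep d k lam ε) (descentRounds d k lam ε) Z)
      ≤ empLoss i Z q + descentTarget d k lam ε := by
  set s := descentTarget d k lam ε with hs
  have hs0 : 0 < s := descentTarget_pos hd k lam hε
  set R := descentRounds d k lam ε with hR
  have hR0 : 0 < R := descentRounds_pos hd k hlam hε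
  have hR' : (0 : ℝ) < R := Nat.cast_pos.2 hR0
  have hne : (monos N k).Nonempty := ⟨∅, mem_monos.2 (by simp)⟩
  have ha : 0 < descentStep d k lam ε := div_pos hs0 (by positivity)
  refine (empLoss_hedgeAvg_le hne i hlam ha hR0 Z hq.2.2
    fun S hS => mem_monos.2 ⟨hq.1 S hS, hq.2.1 S hS⟩).trans (add_le_add le_rfl ?_)
  have h1 : 128 * lam ^ 2 * ((d : ℝ) + 1) ^ k / s ^ 2 ≤ R := Nat.le_ceil _
  have hcard : ((monos N k).card : ℝ) ≤ ((d : ℝ) + 1) ^ k := by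
    exact_mod_cast card_monos_le hN k
  have h2 : Real.log (2 * (monos N k).card) ≤ 2 * ((d : ℝ) + 1) ^ k :=
    (Real.log_le_self (by positivity)).trans (by linarith)
  rw [div_le_iff₀ (by positivity)] at h1
  have h3 : Real.log (2 * (monos N k).card) / (descentStep d k lam ε * R) ≤ s / (2 * lam) := by
    rw [div_le_div_iff₀ (by positivity) (by positivity)]
    have h4 : descentStep d k lam ε * (32 * lam) = s := by
      unfold descentStep; field_simp; rfl
    have h5 : Real.log (2 * (monos N k).card) * (64 * lam ^ 2) ≤ R * s ^ 2 := by
      have := mul_le_mul_of_nonneg_right h2 (by positivity : 0 ≤ 64 * lam ^ 2)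
      linarith
    have h6 : (32 * lam) * (Real.log (2 * (monos N k).card) * (2 * lam))
        ≤ (32 * lam) * (s * (descentStep d k lam ε * R)) := by
      calc _ = Real.log (2 * (monos N k).card) * (64 * lam ^ 2) := by ring
        _ ≤ _ := h5
        _ = s * (descentStep d k lam ε * (32 * lam)) * R := by rw [h4]; ring
        _ = _ := by ring
    exact le_of_mul_le_mul_left h6 (by positivity)
  have h4 : 16 * descentStep d k lam ε = s / (2 * lam) := by
    unfold descentStep; rw [← hs]; field_simp; norm_num
  calc _ ≤ lam * (s / (2 * lam) + s / (2 * lam)) := by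
        rw [h4]; exact mul_le_mul_of_nonneg_left (by linarith) hlam.le
    _ = s := by field_simp; norm_num

theorem instruction_count_le {lam₀ : ℝ} (hlam₀ : 0 < lam₀) {k d T : ℕ} {lam ε : ℝ} (hd : 3 ≤ d)
    (hk : 1 ≤ k) (hlam : lam₀ ≤ lam) (hε : 0 < ε) (hT : 0 < T) :
    ((68 * ((d + 1) ^ k * T) ^ 4 * descentRounds d k lam ε : ℕ) : ℝ) ≤
      mainConst lam₀ * (d : ℝ) ^ (mainConst lam₀ * lam * (k : ℝ) ^ 2) *
        ((T : ℝ) * (1 + 1 / ε)) ^ mainConst lam₀ := by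
  have hl : 0 < lam := hlam₀.trans_le hlam
  have hd' : (3 : ℝ) ≤ d := by exact_mod_cast hd
  have hd0 : (0 : ℝ) < d := by linarith
  have hd1 : (1 : ℝ) ≤ d := by linarith
  have hk' : (1 : ℝ) ≤ k := by exact_mod_cast hk
  have hT' : (1 : ℝ) ≤ T := by exact_mod_cast hT
  set E := (d : ℝ) ^ ((13 + 4 * lam) * (k : ℝ) ^ 2) with hE
  have hE1 : 1 ≤ E := Real.one_le_rpow hd1 (by positivity)
  set B := (d : ℝ) ^ (2 * (k : ℝ)) with hB
  have hB1 : 1 ≤ B := Real.one_le_rpow hd1 (by positivity)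
  have hdB : ((d : ℝ) + 1) ^ k ≤ B := succ_pow_le_rpow hd k
  set w := 1 + 1 / ε with hw
  have hw1 : 1 ≤ w := by have := one_div_pos.2 hε; linarith
  set s := descentTarget d k lam ε with hs
  have hs0 : 0 < s := descentTarget_pos hd k lam hε
  -- A lower bound for the target valid in both cases of the minimum; E compensates `spread`, and wε
  -- ≥ 1 compensates the powers of ε.
  have hsinv : 1 ≤ E * w ^ 2 * s := by
    have h1 : 1 ≤ w * ε := by rw [hw]; field_simp; linarith
    rcases min_choice ε (tolerance d k lam ε) with h | h <;>
      rw [hs, descentTarget, h]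
    · have h2 : 1 ≤ E * w := one_le_mul_of_one_le_of_one_le hE1 hw1
      calc 1 ≤ (E * w) * (w * ε) := one_le_mul_of_one_le_of_one_le h2 h1
        _ = _ := by ring
    · have h2 := one_le_rpow_mul_spread hd hk hl.le
      rw [← hE] at h2
      calc 1 ≤ (E * (Real.exp (-(2 * lam)) / 8 * spread d k lam)) * (w * ε) ^ 2 :=
            one_le_mul_of_one_le_of_one_le h2 (one_le_pow₀ h1)
        _ = _ := by unfold tolerance; ring
  have hR : (descentRounds d k lam ε : ℝ) ≤ (128 * lam ^ 2 + 1) * B * (E * w ^ 2) ^ 2 := by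
    have h1 : (descentRounds d k lam ε : ℝ) ≤ 128 * lam ^ 2 * ((d : ℝ) + 1) ^ k / s ^ 2 + 1 :=
      (Nat.ceil_lt_add_one (by positivity)).le
    have h2 : 128 * lam ^ 2 * ((d : ℝ) + 1) ^ k / s ^ 2
        ≤ 128 * lam ^ 2 * B * (E * w ^ 2) ^ 2 := by
      rw [div_le_iff₀ (by positivity)]
      calc 128 * lam ^ 2 * ((d : ℝ) + 1) ^ k ≤ 128 * lam ^ 2 * B := by gcongr
        _ ≤ 128 * lam ^ 2 * B * (E * w ^ 2 * s) ^ 2 :=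
            le_mul_of_one_le_right (by positivity) (one_le_pow₀ hsinv)
        _ = _ := by ring
    have h3 : 1 ≤ B * (E * w ^ 2) ^ 2 :=
      one_le_mul_of_one_le_of_one_le hB1
        (one_le_pow₀ (one_le_mul_of_one_le_of_one_le hE1 (one_le_pow₀ hw1)))
    linarith
  have hlam2 : 128 * lam ^ 2 + 1 ≤ (d : ℝ) ^ (5 + 2 * lam) := by
    have h1 := Real.add_one_le_exp lam
    have h2 : Real.exp (2 * lam) = Real.exp lam ^ 2 := by rw [← Real.exp_nat_mul]; norm_num
    have h3 := exp_le_natCast_rpow hd (z := 2 * lam) (by linarith)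
    have h4 : (128 : ℝ) ≤ (d : ℝ) ^ (5 : ℝ) := by
      have : (d : ℝ) ^ (5 : ℝ) = d ^ 5 := by exact_mod_cast Real.rpow_natCast (d : ℝ) 5
      rw [this]
      exact le_trans (by norm_num) (pow_le_pow_left₀ (by norm_num) hd' 5)
    rw [Real.rpow_add hd0]
    calc 128 * lam ^ 2 + 1 ≤ 128 * (lam + 1) ^ 2 := by nlinarith
      _ ≤ 128 * Real.exp lam ^ 2 := by gcongr
      _ = 128 * Real.exp (2 * lam) := by rw [h2]
      _ ≤ _ := mul_le_mul h4 h3 (Real.exp_pos _).le (by positivity)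
  have h68 : (68 : ℝ) ≤ (d : ℝ) ^ (4 : ℝ) := by
    have : (d : ℝ) ^ (4 : ℝ) = d ^ 4 := by exact_mod_cast Real.rpow_natCast (d : ℝ) 4
    rw [this]
    exact le_trans (by norm_num) (pow_le_pow_left₀ (by norm_num) hd' 4)
  have hB4 : B ^ 4 = (d : ℝ) ^ (8 * (k : ℝ)) := by
    rw [hB, ← Real.rpow_natCast, ← Real.rpow_mul hd0.le]; congr 1; push_cast; ring
  have hE2 : E ^ 2 = (d : ℝ) ^ ((26 + 8 * lam) * (k : ℝ) ^ 2) := by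
    rw [hE, ← Real.rpow_natCast, ← Real.rpow_mul hd0.le]; congr 1; push_cast; ring
  have hC := ten_le_mainConst hlam₀
  have hTw : 1 ≤ T * w := one_le_mul_of_one_le_of_one_le hT' hw1
  push_cast
  calc 68 * (((d : ℝ) + 1) ^ k * T) ^ 4 * descentRounds d k lam ε
      ≤ (d : ℝ) ^ (4 : ℝ) * (B * T) ^ 4 * ((d : ℝ) ^ (5 + 2 * lam) * B * (E * w ^ 2) ^ 2) := by
        have h1 : (descentRounds d k lam ε : ℝ)
            ≤ (d : ℝ) ^ (5 + 2 * lam) * B * (E * w ^ 2) ^ 2 := hR.trans (by gcongr)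
        gcongr
    _ = ((d : ℝ) ^ (4 : ℝ) * B ^ 4 * ((d : ℝ) ^ (5 + 2 * lam) * B * E ^ 2)) * (T * w) ^ 4 := by
        ring
    _ = (d : ℝ) ^ (4 + 8 * (k : ℝ) + (5 + 2 * lam + 2 * (k : ℝ)
          + (26 + 8 * lam) * (k : ℝ) ^ 2)) * (T * w) ^ 4 := by
        rw [hB4, hE2, hB, ← Real.rpow_add hd0, ← Real.rpow_add hd0, ← Real.rpow_add hd0,
          ← Real.rpow_add hd0]
    _ ≤ (d : ℝ) ^ (mainConst lam₀ * lam * (k : ℝ) ^ 2) * (T * w) ^ mainConst lam₀ := by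
        refine mul_le_mul (rpow_le_rpow_mainConst hd hlam₀ hlam ?_) ?_
          (by positivity) (by positivity)
        · nlinarith [mul_le_mul_of_nonneg_left (one_le_pow₀ hk' (n := 2)) hl.le]
        · rw [← Real.rpow_natCast]
          exact Real.rpow_le_rpow_of_exponent_le hTw (by push_cast; linarith)
    _ ≤ _ := by
        have h0 : 0 ≤ (d : ℝ) ^ (mainConst lam₀ * lam * (k : ℝ) ^ 2) *
            (T * w) ^ mainConst lam₀ := by positivity
        exact (le_mul_of_one_le_left h0 (show 1 ≤ mainConst lam₀ by linarith)).trans_eq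
          (mul_assoc _ _ _).symm

end

end GlauberMRF

/-! ### The three claims -/

theorem mainTheorem2 (lam₀ : ℝ) (hlam₀ : 0 < lam₀) :
    ∃ C : ℝ, 0 < C ∧
    -- a single node
    (∀ (n d k T : ℕ) (lam ε δ : ℝ), 3 ≤ d → 1 ≤ k → lam₀ ≤ lam → 0 < ε → 0 < δ → δ < 1 →
      sampleBound C k d lam ε δ ≤ T →
      ∀ (ψ : MPoly n), IsMRF k d lam ψ →
      ∀ (Ω : Type*) [MeasurableSpace Ω] (P : MeasureTheory.Measure Ω)
        [MeasureTheory.IsProbabilityMeasure P] (X : ℕ → Ω → Config n) (U : ℕ → Ω → Fin n),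
        IsGlauber ψ P X U → ∀ i : Fin n,
        1 - δ ≤ P.real {ω |
          (∃ p, IsLogReg i (neighbors ψ i) k lam (samples d X U i T ω) p) ∧
          ∀ p, IsLogReg i (neighbors ψ i) k lam (samples d X U i T ω) p →
            (p - ψ.pderiv i).supNorm ≤ ε}) ∧
    -- all nodes
    (∀ (n d k T : ℕ) (lam ε δ : ℝ), 1 ≤ n → 3 ≤ d → 1 ≤ k → lam₀ ≤ lam → 0 < ε → 0 < δ → δ < 1 →
      sampleBound C k d lam ε (δ / n) ≤ T →
      ∀ (ψ : MPoly n), IsMRF k d lam ψ →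
      ∀ (Ω : Type*) [MeasurableSpace Ω] (P : MeasureTheory.Measure Ω)
        [MeasureTheory.IsProbabilityMeasure P] (X : ℕ → Ω → Config n) (U : ℕ → Ω → Fin n),
        IsGlauber ψ P X U →
        1 - δ ≤ P.real {ω |
          (∃ p : Fin n → MPoly n,
            ∀ i, IsLogReg i (neighbors ψ i) k lam (samples d X U i T ω) (p i)) ∧
          ∀ p : Fin n → MPoly n,
            (∀ i, IsLogReg i (neighbors ψ i) k lam (samples d X U i T ω) (p i)) →
            (assemble p - ψ.dropConst).supNorm ≤ ε}) ∧
    -- efficient construction, the neighborhoods `N` being known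
    (∀ (n d k T : ℕ) (lam ε δ : ℝ), 1 ≤ n → 3 ≤ d → 1 ≤ k → lam₀ ≤ lam → 0 < ε → 0 < δ → δ < 1 →
      sampleBound C k d lam ε (δ / n) ≤ T →
      ∀ N : Fin n → Finset (Fin n), (∀ i, (N i).card ≤ d) →
      ∃ (q : Fin n → (Fin T → Config n) → MPoly n) (m : ℕ)
        (R : Set ((Fin n → Fin T → Config n) → ℝ)),
        (∀ i Z, q i Z ∈ feasible (N i) k lam ∧
          ∀ p ∈ feasible (N i) k lam, empLoss i Z (q i Z) ≤ empLoss i Z p + ε) ∧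
        Computes (dataInputs T N) m R ∧
        (∀ S, (fun z => assemble (fun i => q i (z i)) S) ∈ R) ∧
        (m : ℝ) ≤ n * (C * (d : ℝ) ^ (C * lam * (k : ℝ) ^ 2) * ((T : ℝ) * (1 + 1 / ε)) ^ C) ∧
        ∀ (ψ : MPoly n), IsMRF k d lam ψ → (∀ i, neighbors ψ i = N i) →
        ∀ (Ω : Type*) [MeasurableSpace Ω] (P : MeasureTheory.Measure Ω)
          [MeasureTheory.IsProbabilityMeasure P] (X : ℕ → Ω → Config n) (U : ℕ → Ω → Fin n),
          IsGlauber ψ P X U →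
          1 - δ ≤ P.real {ω |
            (assemble (fun i => q i (samples d X U i T ω)) - ψ.dropConst).supNorm ≤ ε}) := by
  refine ⟨mainConst lam₀, by linarith [ten_le_mainConst hlam₀], ?_, ?_, ?_⟩
  · intro n d k T lam ε δ hd hk hlam hε hδ hδ1 hT ψ hM Ω _ P _ X U hG i
    have hl : 0 < lam := hlam₀.trans_le hlam
    refine one_sub_le_measureReal hδ.le (le_trans (MeasureTheory.measure_mono ?_)
      (hG.measure_inaccurate_le hlam₀ hd hk hlam hε hδ hδ1 hT hM i))
    intro ω hω hgood
    refine hω ⟨exists_isLogReg i _ k hl.le _, fun p hp => hgood p hp.1 ?_⟩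
    exact (hp.2 _ (hM.pderiv_mem_feasible i)).trans
      (le_add_of_nonneg_right (tolerance_pos hd k lam hε).le)
  · intro n d k T lam ε δ hn hd hk hlam hε hδ hδ1 hT ψ hM Ω _ P _ X U hG
    have hl : 0 < lam := hlam₀.trans_le hlam
    have hn' : (1 : ℝ) ≤ n := by exact_mod_cast hn
    have hδn : 0 < δ / n := by positivity
    have hδn1 : δ / n < 1 := by rw [div_lt_one (by linarith)]; linarith
    refine one_sub_le_measureReal hδ.le (le_trans (MeasureTheory.measure_mono ?_)
      (measure_not_forall_fin_le hn fun i =>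
        hG.measure_inaccurate_le hlam₀ hd hk hlam hε hδn hδn1 hT hM i))
    intro ω hω hgood
    choose p hp using fun i => exists_isLogReg i (neighbors ψ i) k hl.le (samples d X U i T ω)
    refine hω ⟨⟨p, hp⟩, fun p hp => supNorm_assemble_sub_le hε.le fun i =>
      hgood i (p i) (hp i).1 ?_⟩
    exact ((hp i).2 _ (hM.pderiv_mem_feasible i)).trans
      (le_add_of_nonneg_right (tolerance_pos hd k lam hε).le)
  · intro n d k T lam ε δ hn hd hk hlam hε hδ hδ1 hT N hN
    have hl : 0 < lam := hlam₀.trans_le hlam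
    have hn' : (1 : ℝ) ≤ n := by exact_mod_cast hn
    have hδn : 0 < δ / n := by positivity
    have hδn1 : δ / n < 1 := by rw [div_lt_one (by linarith)]; linarith
    have hT0 := natCast_pos_of_sampleBound_le hlam₀ hd hk hlam hε hδn hδn1 hT
    have hpow : 0 < (d + 1) ^ k := by positivity
    have hkd : k ≤ (d + 1) ^ k := (Nat.lt_pow_self (by omega)).le
    -- The product (d+1)^k·T dominates the number of monomials, the degree and the sample size at
    -- once.
    obtain ⟨Q, hQ, hQS⟩ := exists_computes_assemble_hedgeAvg (T := T) (N := N) (k := k)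
      (L := (d + 1) ^ k * T) hn
      (fun i => (card_monos_le (hN i) k).trans (Nat.le_mul_of_pos_right _ hT0))
      (hkd.trans (Nat.le_mul_of_pos_right _ hT0)) (Nat.mul_pos hpow hT0)
      (Nat.le_mul_of_pos_left _ hpow) lam (descentStep d k lam ε)
      (descentRounds_pos hd k hl hε)
    refine ⟨fun i Z => hedgeAvg i (monos (N i) k) lam (descentStep d k lam ε)
      (descentRounds d k lam ε) Z, _, Q, fun i Z => ⟨hedgeAvg_mem_feasible i _ k hl.le _ _ Z,
        fun p hp => ?_⟩, hQ, hQS, ?_, ?_⟩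
    · exact (empLoss_descent_le hd hl hε i (hN i) Z hp).trans
        (add_le_add le_rfl (min_le_left _ _))
    · rw [Nat.cast_mul]
      exact mul_le_mul_of_nonneg_left (instruction_count_le hlam₀ hd hk hlam hε hT0)
        (by linarith)
    · intro ψ hM hψ Ω _ P _ X U hG
      refine one_sub_le_measureReal hδ.le (le_trans (MeasureTheory.measure_mono ?_)
        (measure_not_forall_fin_le hn fun i =>
          hG.measure_inaccurate_le hlam₀ hd hk hlam hε hδn hδn1 hT hM i))
      intro ω hω hgood
      refine hω (supNorm_assemble_sub_le hε.le fun i => hgood i _ ?_ ?_)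
      · rw [hψ i]
        exact hedgeAvg_mem_feasible i _ k hl.le _ _ _
      -- The target is a minimum: its bound by ε gave the claimed excess loss, its bound by
      -- `tolerance` gives accuracy here.
      · refine (empLoss_descent_le hd hl hε i (hN i) _ ?_).trans
          (add_le_add le_rfl (min_le_right _ _))
        rw [← hψ i]
        exact hM.pderiv_mem_feasible i
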